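/- **Setting.** Let $T>0$, $\omega=\frac{2\pi}{T}$, $\mathbb T=\mathbb R/T\mathbb Z$ with the normalized Lebesgue measure $\mathrm dt$ of total mass $1$, $e_k(t)=e^{ik\omega t}$, and $c\in(0,1)$. For a function $v$ or a finite real Borel measure $\lambda$ on $\mathbb T$ put $\mathcal F_k[v]=\hat v_k=\int_{\mathbb T}v\,\overline{e_k}\,\mathrm dt$ and $\mathcal F_k[\lambda]=\int_{\mathbb T}\overline{e_k}\,\mathrm d\lambda$; for functions on $\mathbb R\times\mathbb T$ the coefficient is taken in $t$. Let $\mathcal M(\cdot)$ denote the finite real (signed) Borel measures with the total variation norm. The periodic reduction of a measure in $\mathcal M(\mathbb R)$ is its push-forward to $\mathbb T$. Let $G:\mathbb R\to\mathcal M(\mathbb R)$ be measurable, $h\in L^\infty(\mathbb R)$ real-valued and $\nu\in\mathcal M(\mathbb R)$ (the material coefficients of a slab waveguide), with periodic reductions $\mathcal G(x)$ of $G(x)$ and $\mathcal N$ of $\nu$. Assume: 1. $\sup_{x}\|G(x)\|_{\mathcal M(\mathbb R)}<\infty$, and $h\le 0$ a.e. does not hold. 2. $\mathcal G(x)$ is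 even for every $x\in\mathbb R$ and $\sup_{x\in\mathbb R,\,k\in\mathbb Z}\mathcal F_k[\mathcal G(x)]<\frac1{c^2}-1$. 3. $\mathcal N$ is even, the set $\mathfrak R=\{k\in\mathbb Z\setminus\{0\}:\mathcal F_k[\mathcal N]\ne0\}$ is nonempty, and there are $\beta\ge\alpha>1$ and $C_1,C_2>0$ with $C_1|k|^{-\beta}\le\mathcal F_k[\mathcal N]\le C_2|k|^{-\alpha}$ for all $k\in\mathfrak R$. 4. One of the following holds: * (A6a) $h(x)\to0$ as $x\to\pm\infty$; * (A6b) $\mathcal G=\mathcal G^{\rm per}+\mathcal G^{\rm loc}$ and $h=h^{\rm per}+h^{\rm loc}$, where $\mathcal G^{\rm per}$ and $h^{\rm per}$ are periodic in $x$ with a common period $X>0$, $\|\mathcal G^{\rm loc}(x)\|_{\mathcal M(\mathbb T)}\to0$ and $h^{\rm loc}(x)\to0$ as $x\to\pm\infty$, $\mathcal F_k[\mathcal G^{\rm loc}(x)]\ge0$ for all $k\in\mathbb Z$ and $x\in\mathbb R$, $h^{\rm loc}\ge0$, and $h^{\rm per}\le0$ a.e. does not hold. (Properties and limits of $h,h^{\rm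 per},h^{\rm loc}$ are understood up to null sets.) Let $H$ be the space of real-valued $u\in L^2(\mathbb R\times\mathbb T)$ with $\hat u_k=0$ for $k\notin\mathfrak R$, with $\hat u_k\in H^1(\mathbb R)$ for $k\in\mathfrak R$, and with $$\|u\|_H^2=\sum_{k\in\mathfrak R}\frac1{\omega^2k^2\mathcal F_k[\mathcal N]}\int_{\mathbb R}\bigl(|\hat u_k'|^2+\omega^2k^2|\hat u_k|^2\bigr)\,\mathrm dx<\infty .$$ With $V_k(x)=\frac1{c^2}-1-\mathcal F_k[\mathcal G(x)]$ set, for $u,v\in H$, $$\langle u,v\rangle_H=\sum_{k\in\mathfrak R}\frac1{\omega^2k^2\mathcal F_k[\mathcal N]}\int_{\mathbb R}\bigl(\hat u_k'\,\overline{\hat v_k'}+\omega^2k^2V_k(x)\,\hat u_k\,\overline{\hat v_k}\bigr)\,\mathrm dx,$$ $$J(u)=\tfrac12\langle u,u\rangle_H-\tfrac14\int_{\mathbb R\times\mathbb T}h(x)\,u^4\,\mathrm d(x,t).$$ **Theorem 3.1.** Under these assumptions $J:H\to\mathbb R$ has a ground state: there is $u\in H\setminus\{0\}$ with $J'(u)=0$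 (the Fréchet derivative on $H$) and $$J(u)=c_{\rm gs}:=\inf\{J(v): v\in H\setminus\{0\},\ J'(v)=0\}.$$ -/

import Mathlib

open MeasureTheory Filter Topology
open scoped ContDiff

noncomputable section

namespace Breather

/-- The periodic reduction of a finite real Borel measure on `ℝ`: its push-forward to the torus
`𝕋 = ℝ / Tℤ` under the canonical projection. -/
def periodicReduction (T : ℝ) (μ : SignedMeasure ℝ) : SignedMeasure (AddCircle T) :=
  μ.map (fun τ : ℝ => (τ : AddCircle T))

/-- Evenness in time of a measure on the torus. -/
def IsEvenMeasure {T : ℝ} (μ : SignedMeasure (AddCircle T)) : Prop :=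
  μ.map (fun t => -t) = μ

/-- The temporal frequency `ω = 2π / T`. -/
def freq (T : ℝ) : ℝ := 2 * Real.pi / T

/-- The `k`-th Fourier coefficient `∫ conj (e_k) dμ` of a real measure on the torus, where
`e_k t = exp (i k ω t)`. -/
def measureCoeff {T : ℝ} (μ : SignedMeasure (AddCircle T)) (k : ℤ) : ℂ :=
  ∫ᵛ t, (fourier (-k) t : ℂ) ∂<•μ

/-- Positive definiteness of a measure on the torus: all Fourier coefficients are (real and)
nonnegative. -/
def IsPositiveDefinite {T : ℝ} (μ : SignedMeasure (AddCircle T)) : Prop :=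
  ∀ k : ℤ, (measureCoeff μ k).im = 0 ∧ 0 ≤ (measureCoeff μ k).re

/-- The set `ℜ` of regular frequency indices: the `k ≠ 0` with `F_k[N] ≠ 0`. -/
def regularSet {T : ℝ} (N : SignedMeasure (AddCircle T)) : Set ℤ :=
  {k | k ≠ 0 ∧ measureCoeff N k ≠ 0}

/-- `g` is a weak derivative of `f` on the real line. -/
def IsWeakDeriv (f g : ℝ → ℂ) : Prop :=
  LocallyIntegrable f ∧ LocallyIntegrable g ∧
    ∀ φ : ℝ → ℝ, ContDiff ℝ ∞ φ → HasCompactSupport φ →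
      ∫ x, ((deriv φ x : ℝ) : ℂ) * f x = -∫ x, (φ x : ℂ) * g x

open Classical in
/-- The weak derivative of `f` (unique almost everywhere), and `0` if there is none. -/
def weakDeriv (f : ℝ → ℂ) : ℝ → ℂ :=
  if hf : ∃ g, IsWeakDeriv f g then hf.choose else 0

section Torus

variable {T : ℝ} [Fact (0 < T)]

variable (T) in
/-- The measure `d(x,t)` on `ℝ × 𝕋`; the torus carries the normalized measure of total mass `1`. -/
def spaceTime : Measure (ℝ × AddCircle T) :=
  (volume : Measure ℝ).prod AddCircle.haarAddCircle

variable (T) in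
/-- The space `L²(ℝ × 𝕋)` of real-valued functions. -/
abbrev RealL2 : Type := Lp ℝ 2 (spaceTime T)

/-- The Fourier coefficient in time `û_k (x) = ∫ u(x,t) conj (e_k t) dt`. -/
def timeCoeff (u : RealL2 T) (k : ℤ) (x : ℝ) : ℂ :=
  fourierCoeff (fun t : AddCircle T => ((u (x, t) : ℝ) : ℂ)) k

/-- The weighted inner product
`∑_{k ∈ ℜ} 1 / (ω² k² F_k[N]) ∫ (û_k' conj (v̂_k') + ω² k² W_k(x) û_k conj (v̂_k)) dx`
of real-valued functions `u`, `v`. The coefficients `F_k[N]` are real, since `N` is even. The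
terms for `k` and `-k` are complex conjugate to each other if `W_k = W_{-k}`, so the sum is real and
only the real parts of the terms have to be summed. -/
def weightedInner (N : SignedMeasure (AddCircle T)) (W : ℤ → ℝ → ℝ) (u v : RealL2 T) : ℝ :=
  ∑' k : regularSet N, 1 / (freq T ^ 2 * (k : ℝ) ^ 2 * (measureCoeff N k).re) *
    ∫ x, (weakDeriv (timeCoeff u k) x * starRingEnd ℂ (weakDeriv (timeCoeff v k) x)
      + ((freq T ^ 2 * (k : ℝ) ^ 2 * W k x : ℝ) : ℂ)
        * (timeCoeff u k x * starRingEnd ℂ (timeCoeff v k x))).re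

/-- The norm of `H`, with `‖u‖² = ∑_{k ∈ ℜ} 1 / (ω² k² F_k[N]) ∫ (|û_k'|² + ω² k² |û_k|²) dx`. -/
def normH (N : SignedMeasure (AddCircle T)) (u : RealL2 T) : ℝ :=
  Real.sqrt (weightedInner N (fun _ _ => 1) u u)

/-- The space `H`: the real-valued `u ∈ L²(ℝ × 𝕋)` with `û_k = 0` for `k ∉ ℜ`, such that `û_k` has a
weak derivative in `L²(ℝ)` for `k ∈ ℜ` and the series defining `‖u‖²` is finite. -/
def MemH (N : SignedMeasure (AddCircle T)) (u : RealL2 T) : Prop :=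
  (∀ k : ℤ, k ∉ regularSet N → timeCoeff u k =ᵐ[volume] 0) ∧
  (∀ k ∈ regularSet N, (∃ g, IsWeakDeriv (timeCoeff u k) g) ∧
    MemLp (weakDeriv (timeCoeff u k)) 2 volume) ∧
  Summable fun k : regularSet N => 1 / (freq T ^ 2 * (k : ℝ) ^ 2 * (measureCoeff N k).re) *
    ∫ x, (‖weakDeriv (timeCoeff u k) x‖ ^ 2
      + freq T ^ 2 * (k : ℝ) ^ 2 * ‖timeCoeff u k x‖ ^ 2)

/-- The potential `V_k(x) = 1/c² - 1 - F_k[𝒢(x)]`; the coefficients `F_k[𝒢(x)]` are real, since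
`𝒢(x)` is even. -/
def potential (c : ℝ) (𝒢 : ℝ → SignedMeasure (AddCircle T)) (k : ℤ) (x : ℝ) : ℝ :=
  1 / c ^ 2 - 1 - (measureCoeff (𝒢 x) k).re

/-- The energy functional `J(u) = ½ ⟨u, u⟩_H - ¼ ∫ h u⁴ d(x,t)` on `H`. -/
def energy (c : ℝ) (𝒢 : ℝ → SignedMeasure (AddCircle T)) (N : SignedMeasure (AddCircle T))
    (h : ℝ → ℝ) (u : RealL2 T) : ℝ :=
  1 / 2 * weightedInner N (potential c 𝒢) u u
    - 1 / 4 * ∫ p : ℝ × AddCircle T, h p.1 * u p ^ 4 ∂(spaceTime T)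

/-- `u ∈ H` and `J'(u) = 0`: the Fréchet derivative at `u` of `J` on the normed space `H` exists
and vanishes. -/
def IsCriticalPoint (c : ℝ) (𝒢 : ℝ → SignedMeasure (AddCircle T))
    (N : SignedMeasure (AddCircle T)) (h : ℝ → ℝ) (u : RealL2 T) : Prop :=
  MemH N u ∧ ∀ ε > 0, ∃ δ > 0, ∀ v : RealL2 T, MemH N v → normH N v ≤ δ →
    |energy c 𝒢 N h (u + v) - energy c 𝒢 N h u| ≤ ε * normH N v

/-- The ground state energy level: the infimum of `J` over all nonzero critical points, which is
`+∞` if there are none. -/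
def groundStateLevel (c : ℝ) (𝒢 : ℝ → SignedMeasure (AddCircle T))
    (N : SignedMeasure (AddCircle T)) (h : ℝ → ℝ) : EReal :=
  ⨅ u : {u : RealL2 T // u ≠ 0 ∧ IsCriticalPoint c 𝒢 N h u}, (energy c 𝒢 N h u : EReal)

/-- A ground state: a nonzero critical point of `J` whose energy is the ground state level. -/
def IsGroundState (c : ℝ) (𝒢 : ℝ → SignedMeasure (AddCircle T))
    (N : SignedMeasure (AddCircle T)) (h : ℝ → ℝ) (u : RealL2 T) : Prop :=
  u ≠ 0 ∧ IsCriticalPoint c 𝒢 N h u ∧ (energy c 𝒢 N h u : EReal) = groundStateLevel c 𝒢 N h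

end Torus

/-- The localized case: `h(x) → 0` as `x → ±∞` (for a function in `L^∞`, so up to null sets). -/
def LocalizedCase (h : ℝ → ℝ) : Prop :=
  Tendsto h (cocompact ℝ ⊓ ae volume) (𝓝 0)

/-- The periodic-plus-localized case: `𝒢 = 𝒢per + 𝒢loc` and `h = hper + hloc`, where `𝒢per` and
`hper` have a common period `X`, `𝒢loc` (in total variation norm) and `hloc` tend to `0` at `±∞`,
`𝒢loc(x)` is positive definite for all `x`, `hloc ≥ 0`, and `hper ≤ 0` fails. -/
def PeriodicPlusLocalizedCase {T : ℝ} (𝒢 : ℝ → SignedMeasure (AddCircle T)) (h : ℝ → ℝ) : Prop :=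
  ∃ (𝒢per 𝒢loc : ℝ → SignedMeasure (AddCircle T)) (hper hloc : ℝ → ℝ) (X : ℝ),
    0 < X ∧
    (∀ x, 𝒢 x = 𝒢per x + 𝒢loc x) ∧
    AEStronglyMeasurable hper volume ∧ AEStronglyMeasurable hloc volume ∧
    (∀ᵐ x, h x = hper x + hloc x) ∧
    (∀ x, 𝒢per (x + X) = 𝒢per x) ∧
    (∀ᵐ x, hper (x + X) = hper x) ∧
    Tendsto (fun x => (𝒢loc x).variation Set.univ) (cocompact ℝ) (𝓝 0) ∧
    Tendsto hloc (cocompact ℝ ⊓ ae volume) (𝓝 0) ∧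
    (∀ x, IsPositiveDefinite (𝒢loc x)) ∧
    (∀ᵐ x, 0 ≤ hloc x) ∧
    ¬ ∀ᵐ x, hper x ≤ 0

end Breather

end

noncomputable section

namespace Breather

/-! ### Weak derivatives on the line -/

/-! Let q(v) = ⟨v, v⟩_H and b(v) = ∫ h v⁴. The ground state is found by maximizing the quotient b /
q² over the nonzero elements of H. The gap between sup F_k[𝒢] and 1/c² - 1 makes q comparable to the
squared norm of H, the embedding of H into L⁴ makes the supremum M finite, and positivity of h on a
set of positive measure makes M positive (`exists_quartic_pos`). A maximizer, scaled so that M q(u)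
= 1, satisfies ∫ h u³ v = ⟨u, v⟩_H for all v and is therefore a critical point
(`IsMaximizer.isCriticalPoint`), with J(u) = q(u)/4 = 1/(4M). Any nonzero critical point v satisfies
q(v) = b(v) ≤ M q(v)², hence q(v) ≥ 1/M and J(v) = q(v)/4 ≥ 1/(4M). So u has least energy
(`IsMaximizer.exists_isGroundState`).

The L⁴ estimate rests on writing the squared norm of H as the integral over x of an energy density.
Cauchy–Schwarz with ∑ F_k[N] < ∞ bounds u(x,t)² by a constant times the density at x, uniformly in
t. Parseval gives ∫ u(x,t)² dt = ∑ |û_k(x)|², and a one-dimensional Sobolev inequality at length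
scale 1/|k| bounds |û_k(x)|² by |k| F_k[N] times the energy of mode k near x
(`ae_enorm_sq_coeffL_le`). Multiplying the two bounds controls ∫ u⁴ (`quart_le_of_ae_le`). Since α >
1, |k| F_k[N] → 0, so high modes are uniformly small; the finitely many low modes are compact in the
usual way. Hence bounded, weakly null sequences tend to zero in L⁴ on bounded intervals
(`WeakNull.tendsto_quart`).

Take a maximizing sequence with q = 1 and its weak limit u₀. If u₀ ≠ 0, q and b both split
asymptotically into the contributions of u₀ and of the remainder. With q₀ = q(u₀) this gives M ≤ M
(q₀² + (1 - q₀)²), so q₀ = 1 and u₀ is a maximizer (`isMaximizer_of_weakNull`). If u₀ = 0, the L⁴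
mass escapes to infinity, and the alternatives on h and 𝒢 enter: when h → 0, escape would give b →
0, contradicting M > 0; when the coefficients are periodic, translation by periods brings a cell
with non-negligible mass back to the origin, so a nonzero limit can be arranged; when they are
periodic plus localized, an escaping sequence sees only the periodic coefficients, whose supremum M'
is attained at some w. Then M ≤ M', while the signs of the localized parts make the quotient of w
for the full problem at least M', so w is a maximizer for the full problem
(`exists_isMaximizer_of_perturbation`). -/

theorem integral_mul_locallyIntegrable_integrable {φ f : ℝ → ℝ} (hφ : Continuous φ)
    (hφc : HasCompactSupport φ) (hf : LocallyIntegrable f) : Integrable fun x => φ x * f x := by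
  simpa only [smul_eq_mul] using hf.integrable_smul_left_of_hasCompactSupport hφ hφc

theorem exists_support_subset_Ioo {φ : ℝ → ℝ} (hφc : HasCompactSupport φ) :
    ∃ a > 0, ∀ x, a ≤ |x| → φ x = 0 := by
  obtain ⟨a, ha⟩ := hφc.isCompact.isBounded.subset_closedBall (0 : ℝ)
  refine ⟨max a 0 + 1, by positivity, fun x hx => ?_⟩
  by_contra h
  have h1 := ha (subset_tsupport _ (Function.mem_support.2 h))
  rw [mem_closedBall_zero_iff, Real.norm_eq_abs] at h1
  have := le_max_left a 0
  linarith

theorem integral_eq_intervalIntegral_of_support {f : ℝ → ℝ} {a : ℝ}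
    (hf : ∀ x, a ≤ |x| → f x = 0) : ∫ x, f x = ∫ x in -a..a, f x := by
  rw [intervalIntegral.integral_eq_integral_of_support_subset]
  intro x hx
  have : |x| < a := by
    by_contra h
    exact hx (hf x (not_lt.1 h))
  rw [abs_lt] at this
  exact ⟨this.1, this.2.le⟩

theorem deriv_eq_zero_of_support {φ : ℝ → ℝ} {a : ℝ} (hφ : Differentiable ℝ φ)
    (ha : ∀ x, a ≤ |x| → φ x = 0) : ∀ x, a ≤ |x| → deriv φ x = 0 := by
  intro x hx
  -- At |x| = a the function is known to vanish only on one side, so the derivative is computed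
  -- within a half-line.
  have key : ∀ s : Set ℝ, UniqueDiffWithinAt ℝ s x → (∀ y ∈ s, φ y = 0) → φ x = 0 →
      deriv φ x = 0 := by
    intro s hs h0 hx0
    rw [← (hφ x).derivWithin hs, derivWithin_congr (f := fun _ => (0 : ℝ)) h0 hx0]
    simp
  rcases le_abs.1 hx with h | h
  · refine key (Set.Ici x) (uniqueDiffOn_Ici x x Set.self_mem_Ici) (fun y hy => ha y ?_) (ha x hx)
    exact le_trans (h.trans hy) (le_abs_self y)
  · refine key (Set.Iic x) (uniqueDiffOn_Iic x x Set.self_mem_Iic) (fun y hy => ha y ?_) (ha x hx)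
    have hy' : y ≤ x := hy
    exact le_trans (by linarith) (neg_le_abs y)

/-- The primitive of a locally integrable function has that function as its weak derivative. -/
theorem integral_deriv_mul_primitive {g φ : ℝ → ℝ} (hg : LocallyIntegrable g)
    (hφ : ContDiff ℝ ∞ φ) (hφc : HasCompactSupport φ) :
    ∫ x, deriv φ x * ∫ y in (0 : ℝ)..x, g y = -∫ x, φ x * g x := by
  obtain ⟨a, ha, hs⟩ := exists_support_subset_Ioo hφc
  have hφd : Differentiable ℝ φ := hφ.differentiable (by simp)
  have hs' := deriv_eq_zero_of_support hφd hs
  rw [integral_eq_intervalIntegral_of_support (fun x hx => by rw [hs' x hx, zero_mul]),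
    integral_eq_intervalIntegral_of_support (fun x hx => by rw [hs x hx, zero_mul])]
  have hgi : ∀ u v, IntervalIntegrable g volume u v := fun u v =>
    (hg.integrableOn_isCompact isCompact_uIcc).intervalIntegrable
  have h0 : (0 : ℝ) ∈ Set.uIcc (-a) a := by
    rw [Set.uIcc_of_le (by linarith)]; exact ⟨by linarith, ha.le⟩
  have h1 := (hφ.of_le (m := 1) (by exact_mod_cast le_top)).contDiffOn (s := Set.uIcc (-a) a)
    |>.absolutelyContinuousOnInterval
  have h2 := (hgi (-a) a).absolutelyContinuousOnInterval_intervalIntegral h0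
  -- Integration by parts for absolutely continuous functions; the boundary terms vanish with φ at
  -- ±a.
  have h3 := h1.integral_mul_deriv_eq_deriv_mul h2
  rw [hs a (le_abs_self a), hs (-a) (by rw [abs_neg]; exact le_abs_self a)] at h3
  have h4 : ∫ x in -a..a, φ x * deriv (fun x => ∫ y in (0 : ℝ)..x, g y) x
      = ∫ x in -a..a, φ x * g x := by
    refine intervalIntegral.integral_congr_ae ?_
    filter_upwards [LocallyIntegrable.ae_hasDerivAt_integral hg] with x hx _
    rw [(hx 0).deriv]
  rw [← h4, h3]
  ring

/-- A locally integrable function with vanishing weak derivative is constant. -/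
theorem ae_const_of_integral_deriv_mul_eq_zero {f : ℝ → ℝ} (hf : LocallyIntegrable f)
    (h : ∀ φ : ℝ → ℝ, ContDiff ℝ ∞ φ → HasCompactSupport φ → ∫ x, deriv φ x * f x = 0) :
    ∃ c, ∀ᵐ x, f x = c := by
  obtain ⟨η, hηc, hη, hη1⟩ : ∃ η : ℝ → ℝ, HasCompactSupport η ∧ ContDiff ℝ ∞ η ∧ ∫ x, η x = 1 := by
    let b : ContDiffBump (0 : ℝ) := ⟨1, 2, by norm_num, by norm_num⟩
    exact ⟨b.normed volume, b.hasCompactSupport_normed, b.contDiff_normed, b.integral_normed⟩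
  refine ⟨∫ x, η x * f x, ?_⟩
  refine ae_eq_of_integral_contDiff_smul_eq hf (locallyIntegrable_const _) fun φ hφ hφc => ?_
  set m := ∫ x, φ x with hm
  -- Removing the mean makes the primitive of ψ compactly supported, hence an admissible test
  -- function whose derivative is ψ.
  let ψ : ℝ → ℝ := fun x => φ x - m * η x
  have hψ : ContDiff ℝ ∞ ψ := hφ.sub (contDiff_const.mul hη)
  have hψc : HasCompactSupport ψ := hφc.sub (hηc.mul_left)
  have hφi : Integrable φ := hφ.continuous.integrable_of_hasCompactSupport hφc
  have hηi : Integrable η := hη.continuous.integrable_of_hasCompactSupport hηc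
  have hψi : ∫ x, ψ x = 0 := by
    simp only [ψ]
    rw [integral_sub hφi (hηi.const_mul m), integral_const_mul, hη1, mul_one, hm, sub_self]
  obtain ⟨a, ha, hs⟩ := exists_support_subset_Ioo hψc
  let Ψ : ℝ → ℝ := fun x => ∫ y in (-a)..x, ψ y
  have hΨd : ∀ x, HasDerivAt Ψ (ψ x) x := fun x =>
    (hψ.continuous.integral_hasStrictDerivAt (-a) x).hasDerivAt
  have hΨ' : deriv Ψ = ψ := funext fun x => (hΨd x).deriv
  have hΨ : ContDiff ℝ ∞ Ψ := by
    rw [contDiff_infty_iff_deriv]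
    exact ⟨fun x => (hΨd x).differentiableAt, hΨ' ▸ hψ⟩
  have hint : ∀ u v, IntervalIntegrable ψ volume u v := fun u v => hψ.continuous.intervalIntegrable u v
  have hΨc : HasCompactSupport Ψ := by
    refine HasCompactSupport.of_support_subset_isCompact (isCompact_Icc (a := -a) (b := a)) ?_
    intro x hx
    by_contra hx'
    apply hx
    have hcases : x < -a ∨ a < x := by
      by_contra hcon
      push Not at hcon
      exact hx' ⟨hcon.1, hcon.2⟩
    rcases hcases with h1 | h1
    · refine intervalIntegral.integral_zero_ae (Eventually.of_forall fun y hy => ?_)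
      rw [Set.uIoc_of_ge h1.le] at hy
      exact hs y (le_trans (by linarith [hy.2]) (neg_le_abs y))
    · have h2 : ∫ y in a..x, ψ y = 0 := by
        refine intervalIntegral.integral_zero_ae (Eventually.of_forall fun y hy => ?_)
        rw [Set.uIoc_of_le h1.le] at hy
        exact hs y (le_trans hy.1.le (le_abs_self y))
      have h3 := integral_eq_intervalIntegral_of_support hs
      simp only [Ψ]
      rw [← intervalIntegral.integral_add_adjacent_intervals (hint (-a) a) (hint a x), h2, ← h3, hψi,
        add_zero]
  have h5 := h Ψ hΨ hΨc
  rw [hΨ'] at h5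
  have h6 := integral_mul_locallyIntegrable_integrable hφ.continuous hφc hf
  have h7 := integral_mul_locallyIntegrable_integrable hη.continuous hηc hf
  have h8 : ∫ x, ψ x * f x = (∫ x, φ x * f x) - m * ∫ x, η x * f x := by
    rw [← integral_const_mul, ← integral_sub h6 (h7.const_mul m)]
    congr 1; ext x; simp only [ψ]; ring
  rw [h5] at h8
  simp only [smul_eq_mul]
  rw [integral_mul_const, ← hm]
  linarith

/-- The difference between f and the primitive of g has zero weak derivative, hence is constant. -/
theorem exists_primitive_of_weakDeriv_real {f g : ℝ → ℝ} (hf : LocallyIntegrable f)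
    (hg : LocallyIntegrable g)
    (h : ∀ φ : ℝ → ℝ, ContDiff ℝ ∞ φ → HasCompactSupport φ →
      ∫ x, deriv φ x * f x = -∫ x, φ x * g x) :
    ∃ c : ℝ, ∀ᵐ x, f x = c + ∫ y in (0 : ℝ)..x, g y := by
  have hF : Continuous fun x => ∫ y in (0 : ℝ)..x, g y :=
    intervalIntegral.continuous_primitive
      (fun u v => (hg.integrableOn_isCompact isCompact_uIcc).intervalIntegrable) 0
  obtain ⟨c, hc⟩ := ae_const_of_integral_deriv_mul_eq_zero
    (f := fun x => f x - ∫ y in (0 : ℝ)..x, g y) (hf.sub hF.locallyIntegrable) (by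
      intro φ hφ hφc
      have hd : Continuous (deriv φ) := hφ.continuous_deriv (by simp)
      simp only [mul_sub]
      rw [integral_sub (integral_mul_locallyIntegrable_integrable hd hφc.deriv hf)
        (integral_mul_locallyIntegrable_integrable hd hφc.deriv hF.locallyIntegrable),
        h φ hφ hφc, integral_deriv_mul_primitive hg hφ hφc, sub_self])
  refine ⟨c, ?_⟩
  filter_upwards [hc] with x hx
  linarith

theorem LocallyIntegrable.re {f : ℝ → ℂ} (hf : LocallyIntegrable f) :
    LocallyIntegrable fun x => (f x).re := by
  intro x
  obtain ⟨s, hs, h⟩ := hf x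
  exact ⟨s, hs, h.re⟩

theorem LocallyIntegrable.im {f : ℝ → ℂ} (hf : LocallyIntegrable f) :
    LocallyIntegrable fun x => (f x).im := by
  intro x
  obtain ⟨s, hs, h⟩ := hf x
  exact ⟨s, hs, h.im⟩

theorem integrable_ofReal_mul {φ : ℝ → ℝ} {f : ℝ → ℂ} (hφ : Continuous φ)
    (hφc : HasCompactSupport φ) (hf : LocallyIntegrable f) :
    Integrable fun x => (φ x : ℂ) * f x := by
  simpa only [Complex.real_smul] using hf.integrable_smul_left_of_hasCompactSupport hφ hφc

theorem re_integral_ofReal_mul {φ : ℝ → ℝ} {f : ℝ → ℂ}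
    (h : Integrable fun x => (φ x : ℂ) * f x) :
    (∫ x, (φ x : ℂ) * f x).re = ∫ x, φ x * (f x).re := by
  have := integral_re h
  simp only [RCLike.re_to_complex, Complex.re_ofReal_mul] at this
  exact this.symm

theorem im_integral_ofReal_mul {φ : ℝ → ℝ} {f : ℝ → ℂ}
    (h : Integrable fun x => (φ x : ℂ) * f x) :
    (∫ x, (φ x : ℂ) * f x).im = ∫ x, φ x * (f x).im := by
  have := integral_im h
  simp only [RCLike.im_to_complex, Complex.im_ofReal_mul] at this
  exact this.symm

/-- A function with a weak derivative has a continuous representative, given by the fundamental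
theorem of calculus. -/
theorem IsWeakDeriv.exists_continuous {f g : ℝ → ℂ} (h : IsWeakDeriv f g) :
    ∃ F : ℝ → ℂ, f =ᵐ[volume] F ∧ ∀ x y, F y - F x = ∫ z in x..y, g z := by
  obtain ⟨hf, hg, hφ⟩ := h
  have hgi : ∀ u v, IntervalIntegrable g volume u v := fun u v =>
    (hg.integrableOn_isCompact isCompact_uIcc).intervalIntegrable
  obtain ⟨c, hc⟩ := exists_primitive_of_weakDeriv_real (LocallyIntegrable.re hf)
    (LocallyIntegrable.re hg) (by
      intro φ h1 h2
      have hd : Continuous (deriv φ) := h1.continuous_deriv (by simp)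
      rw [← re_integral_ofReal_mul (integrable_ofReal_mul hd h2.deriv hf), hφ φ h1 h2,
        Complex.neg_re, re_integral_ofReal_mul (integrable_ofReal_mul h1.continuous h2 hg)])
  obtain ⟨d, hd⟩ := exists_primitive_of_weakDeriv_real (LocallyIntegrable.im hf)
    (LocallyIntegrable.im hg) (by
      intro φ h1 h2
      have hd : Continuous (deriv φ) := h1.continuous_deriv (by simp)
      rw [← im_integral_ofReal_mul (integrable_ofReal_mul hd h2.deriv hf), hφ φ h1 h2,
        Complex.neg_im, im_integral_ofReal_mul (integrable_ofReal_mul h1.continuous h2 hg)])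
  refine ⟨fun x => (⟨c, d⟩ : ℂ) + ∫ z in (0 : ℝ)..x, g z, ?_, fun x y => ?_⟩
  · filter_upwards [hc, hd] with x h1 h2
    have hr : (∫ z in (0 : ℝ)..x, g z).re = ∫ z in (0 : ℝ)..x, (g z).re := by
      have := Complex.reCLM.intervalIntegral_comp_comm (hgi 0 x)
      simpa using this.symm
    have hi : (∫ z in (0 : ℝ)..x, g z).im = ∫ z in (0 : ℝ)..x, (g z).im := by
      have := Complex.imCLM.intervalIntegral_comp_comm (hgi 0 x)
      simpa using this.symm
    apply Complex.ext
    · rw [Complex.add_re, hr, h1]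
    · rw [Complex.add_im, hi, h2]
  · simp only [add_sub_add_left_eq_sub]
    rw [intervalIntegral.integral_interval_sub_left (hgi _ _) (hgi _ _)]

theorem IsWeakDeriv.ae_unique {f g g' : ℝ → ℂ} (h : IsWeakDeriv f g) (h' : IsWeakDeriv f g') :
    g =ᵐ[volume] g' := by
  refine ae_eq_of_integral_contDiff_smul_eq h.2.1 h'.2.1 fun φ hφ hφc => ?_
  have h1 := h.2.2 φ hφ hφc
  rw [h'.2.2 φ hφ hφc] at h1
  simp only [Complex.real_smul]
  exact (neg_injective h1).symm

theorem IsWeakDeriv.weakDeriv_spec {f g : ℝ → ℂ} (h : IsWeakDeriv f g) :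
    IsWeakDeriv f (weakDeriv f) := by
  have hex : ∃ g, IsWeakDeriv f g := ⟨g, h⟩
  rw [weakDeriv, dif_pos hex]
  exact hex.choose_spec

theorem IsWeakDeriv.weakDeriv_ae {f g : ℝ → ℂ} (h : IsWeakDeriv f g) :
    weakDeriv f =ᵐ[volume] g := h.weakDeriv_spec.ae_unique h

theorem IsWeakDeriv.congr {f f' g g' : ℝ → ℂ} (h : IsWeakDeriv f g) (hf : f =ᵐ[volume] f')
    (hg : g =ᵐ[volume] g') : IsWeakDeriv f' g' := by
  refine ⟨h.1.congr hf, h.2.1.congr hg, fun φ hφ hφc => ?_⟩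
  have e1 : ∫ x, ((deriv φ x : ℝ) : ℂ) * f x = ∫ x, ((deriv φ x : ℝ) : ℂ) * f' x :=
    integral_congr_ae (hf.mono fun x hx => by simp only [hx])
  have e2 : ∫ x, (φ x : ℂ) * g x = ∫ x, (φ x : ℂ) * g' x :=
    integral_congr_ae (hg.mono fun x hx => by simp only [hx])
  rw [← e1, ← e2]
  exact h.2.2 φ hφ hφc

theorem IsWeakDeriv.add {f f' g g' : ℝ → ℂ} (h : IsWeakDeriv f g) (h' : IsWeakDeriv f' g') :
    IsWeakDeriv (fun x => f x + f' x) (fun x => g x + g' x) := by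
  refine ⟨h.1.add h'.1, h.2.1.add h'.2.1, fun φ hφ hφc => ?_⟩
  have hd : Continuous (deriv φ) := hφ.continuous_deriv (by simp)
  simp only [mul_add]
  rw [integral_add (integrable_ofReal_mul hd hφc.deriv h.1)
    (integrable_ofReal_mul hd hφc.deriv h'.1),
    integral_add (integrable_ofReal_mul hφ.continuous hφc h.2.1)
    (integrable_ofReal_mul hφ.continuous hφc h'.2.1), h.2.2 φ hφ hφc, h'.2.2 φ hφ hφc]
  ring

theorem IsWeakDeriv.const_mul {f g : ℝ → ℂ} (h : IsWeakDeriv f g) (c : ℂ) :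
    IsWeakDeriv (fun x => c * f x) (fun x => c * g x) := by
  refine ⟨?_, ?_, fun φ hφ hφc => ?_⟩
  · exact h.1.smul c
  · exact h.2.1.smul c
  · simp only [mul_left_comm _ c _]
    rw [integral_const_mul, integral_const_mul, h.2.2 φ hφ hφc]
    ring

theorem isWeakDeriv_zero : IsWeakDeriv (fun _ => 0) (fun _ => 0) :=
  ⟨locallyIntegrable_zero, locallyIntegrable_zero, fun φ _ _ => by simp⟩

theorem IsWeakDeriv.comp_add_right {f g : ℝ → ℂ} (h : IsWeakDeriv f g) (a : ℝ) :
    IsWeakDeriv (fun x => f (x + a)) (fun x => g (x + a)) := by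
  have hloc : ∀ {f : ℝ → ℂ}, LocallyIntegrable f → LocallyIntegrable fun x => f (x + a) := by
    intro f hf
    rw [locallyIntegrable_iff] at hf ⊢
    intro k hk
    have := hf _ (hk.image (continuous_add_const a))
    have hmp := (measurePreserving_add_right volume a)
    have := (hmp.integrableOn_comp_preimage (MeasurableEquiv.addRight a).measurableEmbedding
      (f := f) (s := (fun x => x + a) '' k)).2 this
    rwa [Set.preimage_image_eq _ (add_left_injective a)] at this
  refine ⟨hloc h.1, hloc h.2.1, fun φ hφ hφc => ?_⟩
  have h1 := h.2.2 (fun x => φ (x - a)) (hφ.comp (contDiff_id.sub contDiff_const))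
    (hφc.comp_homeomorph (Homeomorph.subRight a))
  rw [← integral_add_right_eq_self _ a, ← integral_add_right_eq_self (fun x => ((φ (x - a) : ℝ) : ℂ) * g x) a] at h1
  simpa only [deriv_comp_sub_const, add_sub_cancel_right] using h1

/-- The product rule for a smooth function and a weakly differentiable one. -/
theorem IsWeakDeriv.mul_contDiff {f g : ℝ → ℂ} (h : IsWeakDeriv f g) {χ : ℝ → ℝ}
    (hχ : ContDiff ℝ ∞ χ) :
    IsWeakDeriv (fun x => (χ x : ℂ) * f x)
      (fun x => ((deriv χ x : ℝ) : ℂ) * f x + (χ x : ℂ) * g x) := by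
  have hχd : Continuous (deriv χ) := hχ.continuous_deriv (by simp)
  have hloc : ∀ {u : ℝ → ℝ} {f : ℝ → ℂ}, Continuous u → LocallyIntegrable f →
      LocallyIntegrable fun x => (u x : ℂ) * f x := by
    intro u f hu hf
    rw [locallyIntegrable_iff] at hf ⊢
    intro k hk
    exact (hf k hk).continuousOn_mul (Complex.continuous_ofReal.comp hu).continuousOn hk
  refine ⟨hloc hχ.continuous h.1, (hloc hχd h.1).add (hloc hχ.continuous h.2.1),
    fun φ hφ hφc => ?_⟩
  have hφd : Continuous (deriv φ) := hφ.continuous_deriv (by simp)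
  -- The identity for f is tested with φχ; the Leibniz term φχ' moves to the right-hand side.
  have h1 := h.2.2 (fun x => φ x * χ x) (hφ.mul hχ) hφc.mul_right
  have h2 : ∀ x, deriv (fun x => φ x * χ x) x = deriv φ x * χ x + φ x * deriv χ x := fun x =>
    deriv_fun_mul (hφ.differentiable (by simp) x) (hχ.differentiable (by simp) x)
  simp only [h2, Complex.ofReal_add, Complex.ofReal_mul, add_mul] at h1
  have i1 := integrable_ofReal_mul (φ := fun x => deriv φ x * χ x) (hφd.mul hχ.continuous) hφc.deriv.mul_right h.1
  have i2 := integrable_ofReal_mul (φ := fun x => φ x * deriv χ x) (hφ.continuous.mul hχd) hφc.mul_right h.1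
  have i3 := integrable_ofReal_mul (φ := fun x => φ x * χ x) (hφ.continuous.mul hχ.continuous) hφc.mul_right h.2.1
  simp only [Complex.ofReal_mul] at i1 i2 i3
  rw [integral_add i1 i2] at h1
  have e : ∀ x, (φ x : ℂ) * (((deriv χ x : ℝ) : ℂ) * f x + (χ x : ℂ) * g x)
      = (φ x : ℂ) * ((deriv χ x : ℝ) : ℂ) * f x + (φ x : ℂ) * (χ x : ℂ) * g x := fun x => by ring
  have e' : ∀ x, ((deriv φ x : ℝ) : ℂ) * ((χ x : ℂ) * f x)
      = ((deriv φ x : ℝ) : ℂ) * (χ x : ℂ) * f x := fun x => by ring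
  rw [integral_congr_ae (Eventually.of_forall e'), integral_congr_ae (Eventually.of_forall e),
    integral_add i2 i3, neg_add, ← h1]
  ring

theorem isWeakDeriv_ofReal {χ : ℝ → ℝ} (hχ : ContDiff ℝ ∞ χ) :
    IsWeakDeriv (fun x => (χ x : ℂ)) (fun x => ((deriv χ x : ℝ) : ℂ)) := by
  have h1 : IsWeakDeriv (fun _ => 1) (fun _ => 0) := by
    refine ⟨locallyIntegrable_const _, locallyIntegrable_zero, fun φ hφ hφc => ?_⟩
    simp only [mul_one, mul_zero, integral_zero, neg_zero]
    rw [integral_complex_ofReal]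
    norm_cast
    obtain ⟨a, ha, hs⟩ := exists_support_subset_Ioo hφc
    have hφd : Differentiable ℝ φ := hφ.differentiable (by simp)
    rw [integral_eq_intervalIntegral_of_support (deriv_eq_zero_of_support hφd hs),
      intervalIntegral.integral_deriv_eq_sub (fun x _ => hφd x)
        ((hφ.continuous_deriv (by simp)).intervalIntegrable _ _),
      hs a (le_abs_self a), hs (-a) (by rw [abs_neg]; exact le_abs_self a), sub_self]
  simpa using h1.mul_contDiff hχ

/-! ### Local Sobolev estimates on the line -/

theorem sq_lintegral_le {μ : Measure ℝ} {g : ℝ → ℂ} (hg : AEStronglyMeasurable g μ) :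
    (∫⁻ y, ‖g y‖ₑ ∂μ) ^ 2 ≤ μ Set.univ * ∫⁻ y, ‖g y‖ₑ ^ 2 ∂μ := by
  have h := ENNReal.lintegral_mul_le_Lp_mul_Lq μ Real.HolderConjugate.two_two
    (f := fun _ => 1) (g := fun y => ‖g y‖ₑ) aemeasurable_const hg.enorm
  simp only [Pi.mul_apply, one_mul, ENNReal.one_rpow, lintegral_const] at h
  calc (∫⁻ y, ‖g y‖ₑ ∂μ) ^ 2
      ≤ ((μ Set.univ) ^ (1 / 2 : ℝ) * (∫⁻ y, ‖g y‖ₑ ^ (2 : ℝ) ∂μ) ^ (1 / 2 : ℝ)) ^ 2 := by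
        gcongr
    _ = μ Set.univ * ∫⁻ y, ‖g y‖ₑ ^ 2 ∂μ := by
        rw [mul_pow, ← ENNReal.rpow_natCast, ← ENNReal.rpow_natCast, ← ENNReal.rpow_mul,
          ← ENNReal.rpow_mul]
        norm_num

theorem enorm_sub_le_lintegral_Icc {F g : ℝ → ℂ} (hF : ∀ x y, F y - F x = ∫ z in x..y, g z)
    {a b x y : ℝ} (hx : x ∈ Set.Icc a b) (hy : y ∈ Set.Icc a b) :
    ‖F x - F y‖ₑ ≤ ∫⁻ z in Set.Icc a b, ‖g z‖ₑ := by
  have key : ∀ {x y : ℝ}, x ∈ Set.Icc a b → y ∈ Set.Icc a b → x ≤ y →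
      ‖F y - F x‖ₑ ≤ ∫⁻ z in Set.Icc a b, ‖g z‖ₑ := by
    intro x y hx hy hxy
    rw [hF x y, intervalIntegral.integral_of_le hxy]
    refine (enorm_integral_le_lintegral_enorm _).trans (lintegral_mono_set ?_)
    exact fun z hz => ⟨hx.1.trans hz.1.le, hz.2.trans hy.2⟩
  rcases le_total x y with h | h
  · rw [← enorm_neg, neg_sub]
    exact key hx hy h
  · exact key hy hx h

theorem enorm_add_sq_le {E : Type*} [SeminormedAddCommGroup E] (a b : E) :
    ‖a + b‖ₑ ^ 2 ≤ 2 * ‖a‖ₑ ^ 2 + 2 * ‖b‖ₑ ^ 2 := by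
  have h : ‖a + b‖ ^ 2 ≤ 2 * ‖a‖ ^ 2 + 2 * ‖b‖ ^ 2 := by
    have := norm_add_le a b
    nlinarith [sq_nonneg (‖a‖ - ‖b‖), norm_nonneg (a + b), norm_nonneg a, norm_nonneg b]
  rw [← ofReal_norm, ← ofReal_norm, ← ofReal_norm, ← ENNReal.ofReal_pow (norm_nonneg _),
    ← ENNReal.ofReal_pow (norm_nonneg _), ← ENNReal.ofReal_pow (norm_nonneg _)]
  rw [← ENNReal.ofReal_ofNat, ← ENNReal.ofReal_mul (by norm_num), ← ENNReal.ofReal_mul (by norm_num),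
    ← ENNReal.ofReal_add (by positivity) (by positivity)]
  exact ENNReal.ofReal_le_ofReal h

/-- For every y in the interval, |F(x)|² ≤ 2|F(y)|² + 2|F(x) - F(y)|², and Cauchy–Schwarz bounds the
last term by 2ℓ∫|g|². Integrating over y gives the claim. -/
theorem enorm_sq_le_of_primitive {F g : ℝ → ℂ} (hF : ∀ x y, F y - F x = ∫ z in x..y, g z)
    (hg : AEStronglyMeasurable g) {a ℓ : ℝ} {x : ℝ} (hx : x ∈ Set.Icc a (a + ℓ)) :
    ENNReal.ofReal ℓ * ‖F x‖ₑ ^ 2 ≤ 2 * (∫⁻ y in Set.Icc a (a + ℓ), ‖F y‖ₑ ^ 2) +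
      2 * ENNReal.ofReal ℓ ^ 2 * ∫⁻ y in Set.Icc a (a + ℓ), ‖g y‖ₑ ^ 2 := by
  have hvol : volume (Set.Icc a (a + ℓ)) = ENNReal.ofReal ℓ := by
    rw [Real.volume_Icc, add_sub_cancel_left]
  have h1 := sq_lintegral_le (μ := volume.restrict (Set.Icc a (a + ℓ))) hg.restrict
  rw [Measure.restrict_apply_univ, hvol] at h1
  have h2 : ∀ y ∈ Set.Icc a (a + ℓ), ‖F x‖ₑ ^ 2 ≤ 2 * ‖F y‖ₑ ^ 2 +
      2 * (ENNReal.ofReal ℓ * ∫⁻ y in Set.Icc a (a + ℓ), ‖g y‖ₑ ^ 2) := by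
    intro y hy
    have h3 := enorm_add_sq_le (F y) (F x - F y)
    rw [add_sub_cancel] at h3
    refine h3.trans (add_le_add le_rfl (mul_le_mul_right ?_ 2))
    exact (pow_le_pow_left' (enorm_sub_le_lintegral_Icc hF hx hy) 2).trans h1
  have h4 := setLIntegral_mono' (μ := volume) measurableSet_Icc h2
  rw [setLIntegral_const, hvol, lintegral_add_right _ measurable_const,
    lintegral_const_mul' _ _ (by simp), setLIntegral_const, hvol] at h4
  calc ENNReal.ofReal ℓ * ‖F x‖ₑ ^ 2 = ‖F x‖ₑ ^ 2 * ENNReal.ofReal ℓ := mul_comm _ _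
    _ ≤ _ := h4
    _ = _ := by ring

/-- One-dimensional Sobolev inequality on an interval, with the length scale `ℓ` at our disposal. -/
theorem IsWeakDeriv.ae_enorm_sq_le {f g : ℝ → ℂ} (h : IsWeakDeriv f g) {a b ℓ : ℝ} (hℓ : 0 < ℓ)
    (hab : a + 2 * ℓ ≤ b) : ∀ᵐ x, x ∈ Set.Icc a b →
      ENNReal.ofReal ℓ * ‖f x‖ₑ ^ 2 ≤ 2 * (∫⁻ y in Set.Icc a b, ‖f y‖ₑ ^ 2) +
        2 * ENNReal.ofReal ℓ ^ 2 * ∫⁻ y in Set.Icc a b, ‖g y‖ₑ ^ 2 := by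
  obtain ⟨F, hfF, hF⟩ := h.exists_continuous
  filter_upwards [hfF] with x hx hxI
  have hfF' : ∀ s : Set ℝ, ∫⁻ y in s, ‖f y‖ₑ ^ 2 = ∫⁻ y in s, ‖F y‖ₑ ^ 2 := fun s =>
    lintegral_congr_ae (ae_restrict_of_ae (hfF.mono fun y hy => by simp only [hy]))
  rw [hx, hfF']
  have key : ∀ c, a ≤ c → c + ℓ ≤ b → x ∈ Set.Icc c (c + ℓ) →
      ENNReal.ofReal ℓ * ‖F x‖ₑ ^ 2 ≤ 2 * (∫⁻ y in Set.Icc a b, ‖F y‖ₑ ^ 2) +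
        2 * ENNReal.ofReal ℓ ^ 2 * ∫⁻ y in Set.Icc a b, ‖g y‖ₑ ^ 2 := by
    intro c h1 h2 h3
    refine (enorm_sq_le_of_primitive hF h.2.1.aestronglyMeasurable h3).trans ?_
    gcongr
  -- A subinterval of length ℓ containing x: the leftmost one if it contains x, otherwise the one
  -- ending at x.
  rcases le_total x (a + ℓ) with h1 | h1
  · exact key x hxI.1 (by linarith) ⟨le_rfl, by linarith⟩
  · exact key (x - ℓ) (by linarith) (by linarith [hxI.2]) ⟨by linarith, by linarith⟩

/-- On an interval of length ℓ the oscillation is at most ∫|g| ≤ √ℓ ‖g‖₂, so f differs from its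
average by no more than that. -/
theorem IsWeakDeriv.ae_norm_le_average {f g : ℝ → ℂ} (h : IsWeakDeriv f g) {a ℓ G : ℝ}
    (hℓ : 0 < ℓ) (hG : 0 ≤ G) (hgG : ∫⁻ y, ‖g y‖ₑ ^ 2 ≤ ENNReal.ofReal (G ^ 2)) :
    ∀ᵐ x, x ∈ Set.Icc a (a + ℓ) →
      ‖f x‖ ≤ ‖∫ y in Set.Icc a (a + ℓ), f y‖ / ℓ + Real.sqrt ℓ * G := by
  obtain ⟨F, hfF, hF⟩ := h.exists_continuous
  filter_upwards [hfF] with x hx hxI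
  rw [hx, setIntegral_congr_ae (g := F) measurableSet_Icc (hfF.mono fun y hy _ => hy)]
  set J := Set.Icc a (a + ℓ) with hJ
  have hvol : volume J = ENNReal.ofReal ℓ := by
    rw [hJ, Real.volume_Icc, add_sub_cancel_left]
  have h1 := sq_lintegral_le (μ := volume.restrict J) h.2.1.aestronglyMeasurable.restrict
  rw [Measure.restrict_apply_univ, hvol] at h1
  have h2 : ∫⁻ z in J, ‖g z‖ₑ ≤ ENNReal.ofReal (Real.sqrt ℓ * G) := by
    rw [← (ENNReal.pow_right_strictMono two_ne_zero).le_iff_le,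
      ← ENNReal.ofReal_pow (by positivity), mul_pow, Real.sq_sqrt hℓ.le, ENNReal.ofReal_mul hℓ.le]
    refine h1.trans ?_
    gcongr
    exact (setLIntegral_le_lintegral _ _).trans hgG
  have h3 : ∀ y ∈ J, ‖F x - F y‖ ≤ Real.sqrt ℓ * G := by
    intro y hy
    have := (enorm_sub_le_lintegral_Icc hF hxI hy).trans h2
    rw [← ofReal_norm] at this
    exact (ENNReal.ofReal_le_ofReal_iff (by positivity)).1 this
  have h4 := norm_setIntegral_le_of_norm_le_const (μ := volume) (s := J)
    (by rw [hvol]; exact ENNReal.ofReal_lt_top) h3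
  have hFi : IntegrableOn F J :=
    ((h.1.congr hfF).integrableOn_isCompact isCompact_Icc)
  have hci : IntegrableOn (fun _ => F x) J :=
    integrableOn_const (by rw [hvol]; exact ENNReal.ofReal_ne_top)
  rw [integral_sub hci hFi,
    setIntegral_const, measureReal_def, hvol, ENNReal.toReal_ofReal hℓ.le] at h4
  have h5 : ℓ * ‖F x‖ ≤ ‖∫ y in J, F y‖ + Real.sqrt ℓ * G * ℓ := by
    have h6 : ‖ℓ • F x‖ = ℓ * ‖F x‖ := by rw [norm_smul, Real.norm_of_nonneg hℓ.le]
    rw [← h6]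
    have := norm_sub_norm_le (ℓ • F x) (∫ y in J, F y)
    linarith
  rw [div_add' _ _ _ hℓ.ne', le_div_iff₀ hℓ]
  linarith

/-- Bounded sequences in `H¹` whose local averages tend to `0` tend to `0` locally uniformly. -/
theorem eventually_ae_norm_le {ι : Type*} {l : Filter ι} {f g : ι → ℝ → ℂ} {G : ℝ} (hG : 0 ≤ G)
    (h : ∀ n, IsWeakDeriv (f n) (g n))
    (hgG : ∀ n, ∫⁻ y, ‖g n y‖ₑ ^ 2 ≤ ENNReal.ofReal (G ^ 2))
    (hf : ∀ a b, Tendsto (fun n => ∫ y in Set.Icc a b, f n y) l (𝓝 0)) (R : ℝ) {ε : ℝ}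
    (hε : 0 < ε) : ∀ᶠ n in l, ∀ᵐ x, x ∈ Set.Icc (-R) R → ‖f n x‖ ≤ ε := by
  -- Cells so short that the oscillation on each is at most ε/2, uniformly in n.
  obtain ⟨ℓ, hℓ, hℓε⟩ : ∃ ℓ : ℝ, 0 < ℓ ∧ Real.sqrt ℓ * G ≤ ε / 2 := by
    refine ⟨(ε / (2 * (G + 1))) ^ 2, by positivity, ?_⟩
    rw [Real.sqrt_sq (by positivity), div_mul_eq_mul_div, div_le_div_iff₀ (by positivity) (by positivity)]
    nlinarith
  -- Finitely many cells cover [-R, R], so finitely many averages have to be made small at once.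
  obtain ⟨m, hm⟩ := exists_nat_gt (2 * R / ℓ)
  have h1 : ∀ᶠ n in l, ∀ i ∈ Finset.range m,
      ‖∫ y in Set.Icc (-R + i * ℓ) (-R + i * ℓ + ℓ), f n y‖ < ε / 2 * ℓ := by
    rw [eventually_all_finset]
    intro i _
    have := (hf (-R + i * ℓ) (-R + i * ℓ + ℓ)).norm
    rw [norm_zero] at this
    exact this.eventually_lt_const (by positivity)
  filter_upwards [h1] with n hn
  have h2 : ∀ᵐ x, ∀ i : ℕ, x ∈ Set.Icc (-R + i * ℓ) (-R + i * ℓ + ℓ) →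
      ‖f n x‖ ≤ ‖∫ y in Set.Icc (-R + i * ℓ) (-R + i * ℓ + ℓ), f n y‖ / ℓ + Real.sqrt ℓ * G :=
    ae_all_iff.2 fun i => (h n).ae_norm_le_average hℓ hG (hgG n)
  have h3 : ∀ᵐ x : ℝ, x ≠ R := by simp [ae_iff, measure_singleton]
  filter_upwards [h2, h3] with x hx hxR hxI
  have hpos : 0 ≤ (x + R) / ℓ := div_nonneg (by linarith [hxI.1]) hℓ.le
  have h4 := Nat.floor_le hpos
  have h5 := Nat.lt_floor_add_one ((x + R) / ℓ)
  rw [le_div_iff₀ hℓ] at h4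
  rw [div_lt_iff₀ hℓ] at h5
  have h6 : ⌊(x + R) / ℓ⌋₊ ∈ Finset.range m := by
    rw [Finset.mem_range, Nat.floor_lt hpos]
    refine lt_of_le_of_lt ?_ hm
    gcongr
    linarith [hxI.2]
  refine (hx ⌊(x + R) / ℓ⌋₊ ⟨by linarith, by linarith⟩).trans ?_
  have h7 := (hn _ h6).le
  rw [← div_le_iff₀ hℓ] at h7
  linarith

/-! ### Fourier coefficients in time -/

section Torus

variable {T : ℝ} [Fact (0 < T)]

theorem enorm_sq_eq_ofReal {E : Type*} [SeminormedAddCommGroup E] (a : E) :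
    ‖a‖ₑ ^ 2 = ENNReal.ofReal (‖a‖ ^ 2) := by
  rw [← ofReal_norm, ENNReal.ofReal_pow (norm_nonneg _)]

theorem memLp_two_iff_lintegral {X E : Type*} [MeasurableSpace X] [NormedAddCommGroup E]
    {μ : Measure X} {f : X → E} (hf : AEStronglyMeasurable f μ) :
    MemLp f 2 μ ↔ ∫⁻ x, ‖f x‖ₑ ^ 2 ∂μ < ⊤ := by
  have h := eLpNorm_lt_top_iff_lintegral_rpow_enorm_lt_top (p := 2) (f := f) (μ := μ) (by norm_num)
    (by norm_num)
  simp only [ENNReal.toReal_ofNat, ENNReal.rpow_ofNat] at h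
  rw [← h]
  exact ⟨fun h => h.2, fun h => ⟨hf, h⟩⟩

theorem tsum_enorm_sq_fourierCoeff {f : AddCircle T → ℂ} (hf : MemLp f 2 AddCircle.haarAddCircle) :
    ∑' k : ℤ, ‖fourierCoeff f k‖ₑ ^ 2 = ∫⁻ t, ‖f t‖ₑ ^ 2 ∂AddCircle.haarAddCircle := by
  have h := hasSum_sq_fourierCoeff hf.toLp
  simp only [fourierCoeff_congr_ae hf.coeFn_toLp] at h
  rw [integral_congr_ae (hf.coeFn_toLp.mono fun t ht => by simp only [ht] :
    (fun t => ‖hf.toLp f t‖ ^ 2) =ᵐ[AddCircle.haarAddCircle] fun t => ‖f t‖ ^ 2)] at h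
  simp only [enorm_sq_eq_ofReal]
  rw [← ENNReal.ofReal_tsum_of_nonneg (fun _ => sq_nonneg _) h.summable, h.tsum_eq,
    ofReal_integral_eq_lintegral_ofReal hf.norm.integrable_sq (ae_of_all _ fun _ => sq_nonneg _)]

/-- There is nothing to show if the sum is infinite. Otherwise the Fourier series converges
uniformly, and its limit agrees almost everywhere with f because both have the same L² expansion. -/
theorem ae_enorm_le_tsum_fourierCoeff {f : AddCircle T → ℂ}
    (hf : MemLp f 2 AddCircle.haarAddCircle) :
    ∀ᵐ t ∂AddCircle.haarAddCircle, ‖f t‖ₑ ≤ ∑' k : ℤ, ‖fourierCoeff f k‖ₑ := by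
  by_cases htop : ∑' k : ℤ, ‖fourierCoeff f k‖ₑ = ⊤
  · simp [htop]
  have hs : Summable fun k : ℤ => ‖fourierCoeff f k‖ := by
    refine (ENNReal.summable_toReal htop).congr fun k => ?_
    rw [toReal_enorm]
  have hs' : Summable fun k : ℤ => fourierCoeff f k • (fourier k : C(AddCircle T, ℂ)) := by
    refine Summable.of_norm ?_
    simp_rw [norm_smul, fourier_norm, mul_one]
    exact hs
  have h1 := hasSum_fourier_series_L2 hf.toLp
  simp only [fourierCoeff_congr_ae hf.coeFn_toLp] at h1
  have h2 := (ContinuousMap.toLp (E := ℂ) 2 AddCircle.haarAddCircle ℂ).hasSum hs'.hasSum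
  simp only [map_smul] at h2
  have h3 := h1.unique h2
  have h4 := ContinuousMap.coeFn_toLp (p := 2) (𝕜 := ℂ) (AddCircle.haarAddCircle (T := T))
    (∑' k : ℤ, fourierCoeff f k • (fourier k : C(AddCircle T, ℂ)))
  rw [← h3] at h4
  filter_upwards [h4, hf.coeFn_toLp] with t ht1 ht2
  rw [← ht2, ht1]
  have h5 := (ContinuousMap.evalCLM ℂ t).hasSum hs'.hasSum
  have h6 : HasSum (fun k : ℤ => fourierCoeff f k * fourier k t)
    ((∑' k : ℤ, fourierCoeff f k • (fourier k : C(AddCircle T, ℂ))) t) := h5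
  have hn : ∀ k : ℤ, ‖fourierCoeff f k * fourier k t‖ = ‖fourierCoeff f k‖ := fun k => by
    rw [norm_mul, fourier_apply, Circle.norm_coe, mul_one]
  have h7 : ‖(∑' k : ℤ, fourierCoeff f k • (fourier k : C(AddCircle T, ℂ))) t‖ ≤
      ∑' k : ℤ, ‖fourierCoeff f k‖ := by
    rw [← h6.tsum_eq, ← tsum_congr hn]
    exact norm_tsum_le_tsum_norm (hs.congr fun k => (hn k).symm)
  rw [← ofReal_norm]
  refine (ENNReal.ofReal_le_ofReal h7).trans_eq ?_
  rw [ENNReal.ofReal_tsum_of_nonneg (fun _ => norm_nonneg _) hs]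
  simp only [ofReal_norm]

theorem lintegral_spaceTime {f : ℝ × AddCircle T → ENNReal} (hf : AEMeasurable f (spaceTime T)) :
    ∫⁻ p, f p ∂(spaceTime T) = ∫⁻ x, ∫⁻ t, f (x, t) ∂AddCircle.haarAddCircle :=
  lintegral_prod f hf

theorem ae_memLp_section (u : RealL2 T) :
    ∀ᵐ x : ℝ, MemLp (fun t => ((u (x, t) : ℝ) : ℂ)) 2 AddCircle.haarAddCircle := by
  have hu := Lp.memLp u
  have h1 := hu.1.prodMk_left
  have h2 : ∫⁻ p, ‖u p‖ₑ ^ 2 ∂(spaceTime T) < ⊤ := (memLp_two_iff_lintegral hu.1).1 hu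
  have h3 : AEMeasurable (fun p => ‖u p‖ₑ ^ 2) (spaceTime T) := hu.1.enorm.pow_const 2
  have h4 := ae_lt_top' h3.lintegral_prod_right' (by
    rw [lintegral_spaceTime h3] at h2
    exact h2.ne)
  filter_upwards [h1, h4] with x hx1 hx2
  have hm : AEStronglyMeasurable (fun t => ((u (x, t) : ℝ) : ℂ)) AddCircle.haarAddCircle :=
    Complex.continuous_ofReal.comp_aestronglyMeasurable hx1
  rw [memLp_two_iff_lintegral hm]
  simpa only [← ofReal_norm, Complex.norm_real] using hx2

theorem tsum_enorm_sq_timeCoeff (u : RealL2 T) :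
    ∀ᵐ x : ℝ, ∑' k : ℤ, ‖timeCoeff u k x‖ₑ ^ 2 =
      ∫⁻ t, ‖u (x, t)‖ₑ ^ 2 ∂AddCircle.haarAddCircle := by
  filter_upwards [ae_memLp_section u] with x hx
  rw [show (fun k => ‖timeCoeff u k x‖ₑ ^ 2) = fun k =>
    ‖fourierCoeff (fun t => ((u (x, t) : ℝ) : ℂ)) k‖ₑ ^ 2 from rfl, tsum_enorm_sq_fourierCoeff hx]
  simp only [← ofReal_norm, Complex.norm_real]

theorem ae_enorm_le_tsum_timeCoeff (u : RealL2 T) :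
    ∀ᵐ x : ℝ, ∀ᵐ t ∂(AddCircle.haarAddCircle (T := T)),
      ‖u (x, t)‖ₑ ≤ ∑' k : ℤ, ‖timeCoeff u k x‖ₑ := by
  filter_upwards [ae_memLp_section u] with x hx
  filter_upwards [ae_enorm_le_tsum_fourierCoeff hx] with t ht
  rw [← ofReal_norm, Complex.norm_real, ofReal_norm] at ht
  exact ht

theorem aestronglyMeasurable_timeCoeff (u : RealL2 T) (k : ℤ) :
    AEStronglyMeasurable (timeCoeff u k) volume := by
  have h : AEStronglyMeasurable
      (fun p : ℝ × AddCircle T => (fourier (-k) p.2 : ℂ) • ((u p : ℝ) : ℂ)) (spaceTime T) := by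
    have h1 : AEStronglyMeasurable (fun p : ℝ × AddCircle T => (fourier (-k) p.2 : ℂ))
        (spaceTime T) :=
      ((fourier (-k)).continuous.comp continuous_snd).aestronglyMeasurable
    exact h1.smul (Complex.continuous_ofReal.comp_aestronglyMeasurable (Lp.aestronglyMeasurable u))
  exact h.integral_prod_right'

theorem tsum_lintegral_timeCoeff (u : RealL2 T) :
    ∑' k : ℤ, ∫⁻ x, ‖timeCoeff u k x‖ₑ ^ 2 = ∫⁻ p, ‖u p‖ₑ ^ 2 ∂(spaceTime T) := by
  rw [← lintegral_tsum fun k => (aestronglyMeasurable_timeCoeff u k).enorm.pow_const 2,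
    lintegral_congr_ae (tsum_enorm_sq_timeCoeff u), 
    lintegral_spaceTime ((Lp.memLp u).1.enorm.pow_const 2)]

theorem memLp_timeCoeff (u : RealL2 T) (k : ℤ) : MemLp (timeCoeff u k) 2 volume := by
  rw [memLp_two_iff_lintegral (aestronglyMeasurable_timeCoeff u k)]
  refine lt_of_le_of_lt (ENNReal.le_tsum (f := fun k => ∫⁻ x, ‖timeCoeff u k x‖ₑ ^ 2) k) ?_
  rw [tsum_lintegral_timeCoeff u]
  exact (memLp_two_iff_lintegral (Lp.memLp u).1).1 (Lp.memLp u)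

theorem ae_section_eq {f g : ℝ × AddCircle T → ℝ} (h : f =ᵐ[spaceTime T] g) :
    ∀ᵐ x : ℝ, ∀ᵐ t ∂(AddCircle.haarAddCircle (T := T)), f (x, t) = g (x, t) :=
  Measure.ae_ae_of_ae_prod h

theorem timeCoeff_of_ae_eq {u : RealL2 T} {f : ℝ × AddCircle T → ℝ} (h : u =ᵐ[spaceTime T] f)
    (k : ℤ) :
    timeCoeff u k =ᵐ[volume] fun x => fourierCoeff (fun t : AddCircle T => ((f (x, t) : ℝ) : ℂ)) k := by
  filter_upwards [ae_section_eq h] with x hx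
  have h1 : (fun t => ((u (x, t) : ℝ) : ℂ)) =ᵐ[AddCircle.haarAddCircle]
      fun t => ((f (x, t) : ℝ) : ℂ) := hx.mono fun t ht => by simp only [ht]
  exact congrFun (fourierCoeff_congr_ae h1) k

theorem timeCoeff_add (u v : RealL2 T) (k : ℤ) :
    timeCoeff (u + v) k =ᵐ[volume] fun x => timeCoeff u k x + timeCoeff v k x := by
  filter_upwards [timeCoeff_of_ae_eq (Lp.coeFn_add u v) k, ae_memLp_section u, ae_memLp_section v]
    with x h1 h2 h3
  rw [h1]
  simp only [Pi.add_apply, Complex.ofReal_add]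
  rw [show timeCoeff u k x + timeCoeff v k x = fourierCoeff ((fun t => ((u (x, t) : ℝ) : ℂ)) +
    fun t => ((v (x, t) : ℝ) : ℂ)) k from ?_]
  · rfl
  · rw [fourierCoeff.add (h2.integrable one_le_two) (h3.integrable one_le_two)]
    rfl

theorem timeCoeff_smul (c : ℝ) (u : RealL2 T) (k : ℤ) :
    timeCoeff (c • u) k =ᵐ[volume] fun x => (c : ℂ) * timeCoeff u k x := by
  filter_upwards [timeCoeff_of_ae_eq (Lp.coeFn_smul c u) k] with x h1
  rw [h1]
  simp only [Pi.smul_apply, smul_eq_mul, Complex.ofReal_mul]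
  exact fourierCoeff.const_mul _ _ _

theorem norm_toLp_sq_eq {X E : Type*} [MeasurableSpace X] [NormedAddCommGroup E]
    {μ : Measure X} (f : Lp E 2 μ) :
    ENNReal.ofReal (‖f‖ ^ 2) = ∫⁻ x, ‖f x‖ₑ ^ 2 ∂μ := by
  rw [Lp.norm_def, ← ENNReal.toReal_pow, ENNReal.ofReal_toReal (ENNReal.pow_ne_top (Lp.eLpNorm_ne_top f)),
    eLpNorm_eq_lintegral_rpow_enorm_toReal (by norm_num) (by norm_num)]
  simp only [ENNReal.toReal_ofNat, ENNReal.rpow_ofNat]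
  rw [← ENNReal.rpow_natCast, ← ENNReal.rpow_mul]
  norm_num

/-- The `k`-th Fourier coefficient in time, as a continuous linear map. -/
def coeffL (T : ℝ) [Fact (0 < T)] (k : ℤ) : RealL2 T →L[ℝ] Lp ℂ 2 (volume : Measure ℝ) :=
  LinearMap.mkContinuous
    { toFun := fun u => (memLp_timeCoeff u k).toLp
      map_add' := fun u v => by
        rw [← MemLp.toLp_add]
        exact (MemLp.toLp_eq_toLp_iff _ _).2 (timeCoeff_add u v k)
      map_smul' := fun c u => by
        rw [RingHom.id_apply, ← MemLp.toLp_const_smul]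
        refine (MemLp.toLp_eq_toLp_iff _ _).2 ((timeCoeff_smul c u k).trans ?_)
        exact Eventually.of_forall fun x => by simp } 1 (by
      intro u
      simp only [LinearMap.coe_mk, AddHom.coe_mk, one_mul]
      rw [← sq_le_sq₀ (norm_nonneg _) (norm_nonneg _), ← ENNReal.ofReal_le_ofReal_iff (sq_nonneg _),
        norm_toLp_sq_eq, norm_toLp_sq_eq, ← tsum_lintegral_timeCoeff,
        lintegral_congr_ae ((memLp_timeCoeff u k).coeFn_toLp.mono fun x hx => by simp only [hx] :
          (fun x => ‖(memLp_timeCoeff u k).toLp _ x‖ₑ ^ 2) =ᵐ[volume] fun x => ‖timeCoeff u k x‖ₑ ^ 2)]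
      exact ENNReal.le_tsum (f := fun k => ∫⁻ x, ‖timeCoeff u k x‖ₑ ^ 2) k)

theorem coeffL_ae (u : RealL2 T) (k : ℤ) : coeffL T k u =ᵐ[volume] timeCoeff u k :=
  (memLp_timeCoeff u k).coeFn_toLp

end Torus

/-! ### The space `H` and its bilinear forms -/

/-- The complex-valued square integrable functions on the line, as a real Hilbert space. -/
abbrev L2C : Type := Lp ℂ 2 (volume : Measure ℝ)

section Torus

/-- The eigenvalue `ω² k²` of `-∂ₜ²`. -/
def freqSq (T : ℝ) (k : ℤ) : ℝ := freq T ^ 2 * (k : ℝ) ^ 2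

theorem freqSq_nonneg {T : ℝ} (k : ℤ) : 0 ≤ freqSq T k := by
  unfold freqSq
  positivity

variable {T : ℝ} [Fact (0 < T)]

/-- The weight `1 / (ω² k² F_k[N])`. -/
def weight (N : SignedMeasure (AddCircle T)) (k : ℤ) : ℝ :=
  1 / (freqSq T k * (measureCoeff N k).re)

/-- The properties of the Fourier coefficients of `N` used in the functional analysis. -/
structure RegularCoeff (N : SignedMeasure (AddCircle T)) : Prop where
  pos : ∀ k ∈ regularSet N, 0 < (measureCoeff N k).re
  summable : Summable fun k : regularSet N => (measureCoeff N k).re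
  tendsto : Tendsto (fun k : regularSet N => |(k : ℝ)| * (measureCoeff N k).re) cofinite (𝓝 0)

theorem freq_pos : 0 < freq T := by
  have : 0 < T := Fact.out
  unfold freq
  positivity

theorem freqSq_pos {k : ℤ} (hk : k ≠ 0) : 0 < freqSq T k := by
  have h : (k : ℝ) ≠ 0 := by exact_mod_cast hk
  have := freq_pos (T := T)
  unfold freqSq
  positivity

theorem RegularCoeff.weight_pos {N : SignedMeasure (AddCircle T)} (hN : RegularCoeff N)
    (k : regularSet N) : 0 < weight N k := by
  have h1 := freqSq_pos (T := T) k.2.1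
  have h2 := hN.pos k k.2
  unfold weight
  positivity

theorem RegularCoeff.weight_mul {N : SignedMeasure (AddCircle T)} (hN : RegularCoeff N)
    (k : regularSet N) : weight N k * freqSq T k = ((measureCoeff N k).re)⁻¹ := by
  have h1 := freqSq_pos (T := T) k.2.1
  have h2 := hN.pos k k.2
  unfold weight
  field_simp

/-- The weak derivative of the `k`-th Fourier coefficient, as an element of `L²`. -/
def derivL (u : RealL2 T) (k : ℤ) : L2C :=
  -- The default value 0 is never taken when u lies in H and k is a regular index.
  open Classical in
  if h : MemLp (weakDeriv (timeCoeff u k)) 2 volume then h.toLp else 0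

theorem derivL_ae {u : RealL2 T} {k : ℤ} (h : MemLp (weakDeriv (timeCoeff u k)) 2 volume) :
    derivL u k =ᵐ[volume] weakDeriv (timeCoeff u k) := by
  rw [derivL, dif_pos h]
  exact h.coeFn_toLp

theorem L2_inner_eq (f g : L2C) : inner ℝ f g = ∫ x, (f x * starRingEnd ℂ (g x)).re := by
  rw [L2.inner_def]
  congr 1; ext x
  rw [Complex.inner]
  simp only [Complex.mul_re, Complex.conj_re, Complex.conj_im]
  ring

theorem L2_norm_sq_eq (f : L2C) : ‖f‖ ^ 2 = ∫ x, ‖f x‖ ^ 2 := by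
  rw [← real_inner_self_eq_norm_sq, L2.inner_def]
  simp only [real_inner_self_eq_norm_sq]

/-- The summand of index `k` of the squared norm of `H`. -/
def normTerm (N : SignedMeasure (AddCircle T)) (u : RealL2 T) (k : ℤ) : ℝ :=
  weight N k * (‖derivL u k‖ ^ 2 + freqSq T k * ‖coeffL T k u‖ ^ 2)

theorem normTerm_eq {N : SignedMeasure (AddCircle T)} {u : RealL2 T} {k : ℤ}
    (h : MemLp (weakDeriv (timeCoeff u k)) 2 volume) :
    normTerm N u k = 1 / (freq T ^ 2 * (k : ℝ) ^ 2 * (measureCoeff N k).re) *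
      ∫ x, (‖weakDeriv (timeCoeff u k) x‖ ^ 2
        + freq T ^ 2 * (k : ℝ) ^ 2 * ‖timeCoeff u k x‖ ^ 2) := by
  rw [normTerm, weight, freqSq, L2_norm_sq_eq, L2_norm_sq_eq,
    integral_add h.norm.integrable_sq ((memLp_timeCoeff u k).norm.integrable_sq.const_mul _),
    integral_const_mul]
  congr 2
  · exact integral_congr_ae ((derivL_ae h).mono fun x hx => by simp only [hx])
  · congr 1
    exact integral_congr_ae ((coeffL_ae u k).mono fun x hx => by simp only [hx])

theorem memH_iff {N : SignedMeasure (AddCircle T)} {u : RealL2 T} :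
    MemH N u ↔ (∀ k : ℤ, k ∉ regularSet N → timeCoeff u k =ᵐ[volume] 0) ∧
      (∀ k ∈ regularSet N, (∃ g, IsWeakDeriv (timeCoeff u k) g) ∧
        MemLp (weakDeriv (timeCoeff u k)) 2 volume) ∧
      Summable fun k : regularSet N => normTerm N u k := by
  unfold MemH
  refine and_congr_right fun _ => and_congr_right fun h => ?_
  exact summable_congr fun k => (normTerm_eq (h k k.2).2).symm

theorem MemH.isWeakDeriv {N : SignedMeasure (AddCircle T)} {u : RealL2 T} (h : MemH N u)
    {k : ℤ} (hk : k ∈ regularSet N) : IsWeakDeriv (timeCoeff u k) (weakDeriv (timeCoeff u k)) := by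
  obtain ⟨g, hg⟩ := (h.2.1 k hk).1
  exact hg.weakDeriv_spec

theorem MemH.derivL_ae {N : SignedMeasure (AddCircle T)} {u : RealL2 T} (h : MemH N u)
    {k : ℤ} (hk : k ∈ regularSet N) : derivL u k =ᵐ[volume] weakDeriv (timeCoeff u k) :=
  Breather.derivL_ae (h.2.1 k hk).2

theorem MemH.isWeakDeriv_derivL {N : SignedMeasure (AddCircle T)} {u : RealL2 T} (h : MemH N u)
    {k : ℤ} (hk : k ∈ regularSet N) : IsWeakDeriv (coeffL T k u) (derivL u k) :=
  (h.isWeakDeriv hk).congr (coeffL_ae u k).symm (h.derivL_ae hk).symm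

/-- A criterion for membership in `H` which also identifies the weak derivatives. -/
theorem MemH.of_isWeakDeriv {N : SignedMeasure (AddCircle T)} {u : RealL2 T} (g : ℤ → L2C)
    (h0 : ∀ k : ℤ, k ∉ regularSet N → timeCoeff u k =ᵐ[volume] 0)
    (h1 : ∀ k ∈ regularSet N, IsWeakDeriv (timeCoeff u k) (g k))
    (h2 : Summable fun k : regularSet N =>
      weight N k * (‖g k‖ ^ 2 + freqSq T k * ‖coeffL T k u‖ ^ 2)) :
    MemH N u ∧ ∀ k ∈ regularSet N, derivL u k = g k := by
  have h3 : ∀ k ∈ regularSet N, MemLp (weakDeriv (timeCoeff u k)) 2 volume := fun k hk =>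
    (Lp.memLp (g k)).ae_eq (h1 k hk).weakDeriv_ae.symm
  have h4 : ∀ k ∈ regularSet N, derivL u k = g k := fun k hk =>
    Lp.ext ((Breather.derivL_ae (h3 k hk)).trans (h1 k hk).weakDeriv_ae)
  refine ⟨memH_iff.2 ⟨h0, fun k hk => ⟨⟨_, h1 k hk⟩, h3 k hk⟩, h2.congr fun k => ?_⟩, h4⟩
  rw [normTerm, h4 k k.2]

theorem norm_add_sq_le_two {E : Type*} [SeminormedAddCommGroup E] (a b : E) :
    ‖a + b‖ ^ 2 ≤ 2 * ‖a‖ ^ 2 + 2 * ‖b‖ ^ 2 := by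
  have := norm_add_le a b
  nlinarith [sq_nonneg (‖a‖ - ‖b‖), norm_nonneg (a + b), norm_nonneg a, norm_nonneg b]

theorem coeffL_eq_zero_iff {u : RealL2 T} {k : ℤ} :
    coeffL T k u = 0 ↔ timeCoeff u k =ᵐ[volume] 0 := by
  rw [Lp.eq_zero_iff_ae_eq_zero]
  exact ⟨fun h => (coeffL_ae u k).symm.trans h, fun h => (coeffL_ae u k).trans h⟩

variable {N : SignedMeasure (AddCircle T)}

theorem MemH.coeffL_eq_zero {u : RealL2 T} (h : MemH N u) {k : ℤ} (hk : k ∉ regularSet N) :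
    coeffL T k u = 0 := coeffL_eq_zero_iff.2 (h.1 k hk)

theorem MemH.summable {u : RealL2 T} (h : MemH N u) :
    Summable fun k : regularSet N => normTerm N u k := (memH_iff.1 h).2.2

theorem memH_add (hN : RegularCoeff N) {u v : RealL2 T} (hu : MemH N u) (hv : MemH N v) :
    MemH N (u + v) ∧ ∀ k ∈ regularSet N, derivL (u + v) k = derivL u k + derivL v k := by
  refine MemH.of_isWeakDeriv (fun k => derivL u k + derivL v k) ?_ ?_ ?_
  · intro k hk
    rw [← coeffL_eq_zero_iff, map_add, hu.coeffL_eq_zero hk, hv.coeffL_eq_zero hk, add_zero]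
  · intro k hk
    refine ((hu.isWeakDeriv_derivL hk).add (hv.isWeakDeriv_derivL hk)).congr ?_
      (Lp.coeFn_add _ _).symm
    refine EventuallyEq.trans ?_ (coeffL_ae (u + v) k)
    rw [map_add]
    exact (Lp.coeFn_add _ _).symm
  · refine Summable.of_nonneg_of_le (fun k => ?_) (fun k => ?_)
      ((hu.summable.mul_left 2).add (hv.summable.mul_left 2))
    · have := (hN.weight_pos k).le
      have := freqSq_nonneg (T := T) k
      positivity
    · have h1 := (hN.weight_pos k).le
      have h2 := freqSq_nonneg (T := T) k
      have h3 := norm_add_sq_le_two (derivL u k) (derivL v k)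
      have h4 := norm_add_sq_le_two (coeffL T k u) (coeffL T k v)
      rw [map_add]
      calc _ ≤ weight N k * ((2 * ‖derivL u k‖ ^ 2 + 2 * ‖derivL v k‖ ^ 2) + freqSq T k *
            (2 * ‖coeffL T k u‖ ^ 2 + 2 * ‖coeffL T k v‖ ^ 2)) := by gcongr
        _ = _ := by simp only [normTerm]; ring

theorem memH_smul (c : ℝ) {u : RealL2 T} (hu : MemH N u) :
    MemH N (c • u) ∧ ∀ k ∈ regularSet N, derivL (c • u) k = c • derivL u k := by
  refine MemH.of_isWeakDeriv (fun k => c • derivL u k) ?_ ?_ ?_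
  · intro k hk
    rw [← coeffL_eq_zero_iff, map_smul, hu.coeffL_eq_zero hk, smul_zero]
  · intro k hk
    refine ((hu.isWeakDeriv_derivL hk).const_mul c).congr ?_ ?_
    · refine EventuallyEq.trans ?_ (coeffL_ae (c • u) k)
      rw [map_smul]
      refine EventuallyEq.trans ?_ (Lp.coeFn_smul _ _).symm
      exact Eventually.of_forall fun x => by simp
    · refine EventuallyEq.trans ?_ (Lp.coeFn_smul _ _).symm
      exact Eventually.of_forall fun x => by simp
  · refine (hu.summable.mul_left (c ^ 2)).congr fun k => ?_
    rw [map_smul, norm_smul, norm_smul, mul_pow, mul_pow, Real.norm_eq_abs, sq_abs, normTerm]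
    ring

theorem memH_zero : MemH N (0 : RealL2 T) := by
  refine (MemH.of_isWeakDeriv (fun _ => 0) ?_ ?_ ?_).1
  · intro k _
    rw [← coeffL_eq_zero_iff, map_zero]
  · intro k _
    refine isWeakDeriv_zero.congr ?_ (Lp.coeFn_zero _ _ _).symm
    have := coeffL_eq_zero_iff.1 (map_zero (coeffL T k))
    exact this.symm
  · simp [summable_zero]

/-- The space `H` as a subspace of `L²(ℝ × 𝕋)`. -/
def HSpace (hN : RegularCoeff N) : Submodule ℝ (RealL2 T) where
  carrier := {u | MemH N u}
  add_mem' hu hv := (memH_add hN hu hv).1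
  zero_mem' := memH_zero
  smul_mem' c _ hu := (memH_smul c hu).1

/-- The summand of index `k` of the bilinear form with coefficient `W`. -/
def formTerm (N : SignedMeasure (AddCircle T)) (W : ℤ → Lp ℝ ⊤ (volume : Measure ℝ))
    (u v : RealL2 T) (k : ℤ) : ℝ :=
  weight N k * (inner ℝ (derivL u k) (derivL v k) +
    freqSq T k * inner ℝ (W k • coeffL T k u : L2C) (coeffL T k v))

/-- The bilinear form with coefficient `W`. -/
def form (N : SignedMeasure (AddCircle T)) (W : ℤ → Lp ℝ ⊤ (volume : Measure ℝ))
    (u v : RealL2 T) : ℝ := ∑' k : regularSet N, formTerm N W u v k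

/-- Translates the integrals of the statement into inner products of the real Hilbert space L²(ℝ;
ℂ), with the potentials acting as bounded multiplication operators. Weak convergence is tested in
this form. -/
theorem weightedInner_eq_form {W : ℤ → ℝ → ℝ} {W' : ℤ → Lp ℝ ⊤ (volume : Measure ℝ)}
    (hW : ∀ k, W' k =ᵐ[volume] W k) {u v : RealL2 T} (hu : MemH N u) (hv : MemH N v) :
    weightedInner N W u v = form N W' u v := by
  refine tsum_congr fun k => ?_
  rw [formTerm, weight, freqSq, L2_inner_eq, L2_inner_eq]
  congr 1
  rw [← integral_const_mul]
  have hi : ∀ f g : L2C, Integrable fun x => (f x * starRingEnd ℂ (g x)).re := by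
    intro f g
    have := L2.integrable_inner (𝕜 := ℝ) f g
    refine this.congr (Eventually.of_forall fun x => ?_)
    simp only [Complex.inner, Complex.mul_re, Complex.conj_re, Complex.conj_im]
    ring
  rw [← integral_add (hi _ _) ((hi _ _).const_mul _)]
  refine integral_congr_ae ?_
  filter_upwards [hu.derivL_ae k.2, hv.derivL_ae k.2, coeffL_ae u k, coeffL_ae v k, hW k,
    Lp.coeFn_lpSMul (r := 2) (W' k) (coeffL T k u)] with x h1 h2 h3 h4 h5 h6
  rw [h1, h2, h4, h6, Pi.smul_apply', h5, h3, Complex.add_re, Complex.real_smul, mul_assoc (W k x : ℂ),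
    Complex.re_ofReal_mul, Complex.re_ofReal_mul]
  ring

end Torus

section Torus

variable {T : ℝ} [Fact (0 < T)] {N : SignedMeasure (AddCircle T)}

/-- The multiplication coefficients are uniformly bounded. -/
def CoeffBounded (W : ℤ → Lp ℝ ⊤ (volume : Measure ℝ)) (C : ℝ) : Prop :=
  ∀ k, ∀ᵐ x, |W k x| ≤ C

theorem CoeffBounded.norm_le {W : ℤ → Lp ℝ ⊤ (volume : Measure ℝ)} {C : ℝ}
    (h : CoeffBounded W C) (hC : 0 ≤ C) (k : ℤ) : ‖W k‖ ≤ C := by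
  have h1 : eLpNorm (W k) ⊤ volume ≤ ENNReal.ofReal C := by
    rw [eLpNorm_exponent_top]
    exact eLpNormEssSup_le_of_ae_bound (h k)
  rw [Lp.norm_def]
  exact ENNReal.toReal_le_of_le_ofReal hC h1

theorem RegularCoeff.normTerm_nonneg (hN : RegularCoeff N) (u : RealL2 T) (k : regularSet N) :
    0 ≤ normTerm N u k := by
  have h1 := (hN.weight_pos k).le
  have h2 := freqSq_nonneg (T := T) k
  unfold normTerm
  positivity

/-- Young's inequality. The parameter s stays free, so that either factor can be made small at the
expense of the other. -/
theorem mul_le_weighted_sq {s a b : ℝ} (hs : 0 < s) : a * b ≤ s / 2 * a ^ 2 + s⁻¹ / 2 * b ^ 2 := by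
  have h := sq_nonneg (s * a - b)
  have h1 : s⁻¹ * (s * a - b) ^ 2 = s * a ^ 2 - 2 * (a * b) + s⁻¹ * b ^ 2 := by
    field_simp
    ring
  have h2 : 0 ≤ s⁻¹ * (s * a - b) ^ 2 := by positivity
  linarith

/-- Cauchy–Schwarz and Young in each mode. The derivative part carries no potential, which is why C
≥ 1 is needed. -/
theorem abs_formTerm_le (hN : RegularCoeff N) {W : ℤ → Lp ℝ ⊤ (volume : Measure ℝ)} {C s : ℝ}
    (hW : CoeffBounded W C) (hC : 1 ≤ C) (hs : 0 < s) (u v : RealL2 T) (k : regularSet N) :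
    |formTerm N W u v k| ≤ C * (s / 2 * normTerm N u k + s⁻¹ / 2 * normTerm N v k) := by
  have h1 := (hN.weight_pos k).le
  have h2 := freqSq_nonneg (T := T) k
  have h3 : |inner ℝ (derivL u k) (derivL v k)| ≤ C *
      (s / 2 * ‖derivL u k‖ ^ 2 + s⁻¹ / 2 * ‖derivL v k‖ ^ 2) := by
    refine (abs_real_inner_le_norm _ _).trans ((mul_le_weighted_sq hs).trans ?_)
    exact le_mul_of_one_le_left (by positivity) hC
  have h4 : |inner ℝ (W k • coeffL T k u : L2C) (coeffL T k v)| ≤ C *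
      (s / 2 * ‖coeffL T k u‖ ^ 2 + s⁻¹ / 2 * ‖coeffL T k v‖ ^ 2) := by
    refine (abs_real_inner_le_norm _ _).trans ?_
    have h5 := Lp.norm_smul_le (r := 2) (W k) (coeffL T k u)
    have h6 := hW.norm_le (by linarith) k
    calc ‖(W k • coeffL T k u : L2C)‖ * ‖coeffL T k v‖
        ≤ C * (‖coeffL T k u‖ * ‖coeffL T k v‖) := by
          rw [← mul_assoc]
          gcongr
          exact h5.trans (by gcongr)
      _ ≤ _ := by
          gcongr
          exact mul_le_weighted_sq hs
  rw [formTerm, abs_mul, abs_of_nonneg h1]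
  calc weight N k * |inner ℝ (derivL u k) (derivL v k) +
        freqSq T k * inner ℝ (W k • coeffL T k u : L2C) (coeffL T k v)|
      ≤ weight N k * (C * (s / 2 * ‖derivL u k‖ ^ 2 + s⁻¹ / 2 * ‖derivL v k‖ ^ 2) +
        freqSq T k * (C * (s / 2 * ‖coeffL T k u‖ ^ 2 + s⁻¹ / 2 * ‖coeffL T k v‖ ^ 2))) := by
        gcongr
        refine (abs_add_le _ _).trans ?_
        rw [abs_mul, abs_of_nonneg h2]
        gcongr
    _ = _ := by simp only [normTerm]; ring

theorem summable_formTerm (hN : RegularCoeff N) {W : ℤ → Lp ℝ ⊤ (volume : Measure ℝ)} {C : ℝ}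
    (hW : CoeffBounded W C) (hC : 1 ≤ C) {u v : RealL2 T} (hu : MemH N u) (hv : MemH N v) :
    Summable fun k : regularSet N => formTerm N W u v k :=
  Summable.of_norm_bounded (((hu.summable.mul_left (1 / 2)).add
    (hv.summable.mul_left (1⁻¹ / 2))).mul_left C) fun k => by
      rw [Real.norm_eq_abs]
      exact abs_formTerm_le hN hW hC one_pos u v k

theorem inner_smul_comm (w : Lp ℝ ⊤ (volume : Measure ℝ)) (f g : L2C) :
    inner ℝ (w • f : L2C) g = inner ℝ (w • g : L2C) f := by
  rw [L2.inner_def, L2.inner_def]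
  refine integral_congr_ae ?_
  filter_upwards [Lp.coeFn_lpSMul (r := 2) w f, Lp.coeFn_lpSMul (r := 2) w g] with x h1 h2
  rw [h1, h2, Pi.smul_apply', Pi.smul_apply', real_inner_smul_left, real_inner_smul_left,
    real_inner_comm]

/-- The bilinear form with coefficient `W` on `H`. -/
def formB (hN : RegularCoeff N) {W : ℤ → Lp ℝ ⊤ (volume : Measure ℝ)} {C : ℝ}
    (hW : CoeffBounded W C) (hC : 1 ≤ C) : HSpace hN →ₗ[ℝ] HSpace hN →ₗ[ℝ] ℝ :=
  LinearMap.mk₂ ℝ (fun u v => form N W u v)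
    (fun u u' v => by
      have h : MemH N (u : RealL2 T) := u.2
      have h' : MemH N (u' : RealL2 T) := u'.2
      have hv : MemH N (v : RealL2 T) := v.2
      simp only [form]
      rw [← (summable_formTerm hN hW hC h hv).tsum_add (summable_formTerm hN hW hC h' hv)]
      refine tsum_congr fun k => ?_
      simp only [formTerm, Submodule.coe_add]
      rw [(memH_add hN h h').2 k k.2, map_add, Lp.add_smul, inner_add_left, inner_add_left]
      ring)
    (fun c u v => by
      have h : MemH N (u : RealL2 T) := u.2
      simp only [form]
      rw [smul_eq_mul, ← tsum_mul_left]
      refine tsum_congr fun k => ?_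
      simp only [formTerm, Submodule.coe_smul]
      rw [(memH_smul c h).2 k k.2, map_smul, ← Lp.smul_comm, real_inner_smul_left,
        real_inner_smul_left]
      ring)
    (fun u v v' => by
      have h : MemH N (u : RealL2 T) := u.2
      have h' : MemH N (v' : RealL2 T) := v'.2
      have hv : MemH N (v : RealL2 T) := v.2
      simp only [form]
      rw [← (summable_formTerm hN hW hC h hv).tsum_add (summable_formTerm hN hW hC h h')]
      refine tsum_congr fun k => ?_
      simp only [formTerm, Submodule.coe_add]
      rw [(memH_add hN hv h').2 k k.2, map_add, inner_add_right, inner_add_right]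
      ring)
    (fun c u v => by
      have h : MemH N (v : RealL2 T) := v.2
      simp only [form]
      rw [smul_eq_mul, ← tsum_mul_left]
      refine tsum_congr fun k => ?_
      simp only [formTerm, Submodule.coe_smul]
      rw [(memH_smul c h).2 k k.2, map_smul, real_inner_smul_right, real_inner_smul_right]
      ring)

theorem formB_apply (hN : RegularCoeff N) {W : ℤ → Lp ℝ ⊤ (volume : Measure ℝ)} {C : ℝ}
    (hW : CoeffBounded W C) (hC : 1 ≤ C) (u v : HSpace hN) : formB hN hW hC u v = form N W u v :=
  rfl

theorem form_comm (W : ℤ → Lp ℝ ⊤ (volume : Measure ℝ)) (u v : RealL2 T) :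
    form N W u v = form N W v u := by
  refine tsum_congr fun k => ?_
  rw [formTerm, formTerm, real_inner_comm, inner_smul_comm]

/-- The squared norm of `H`. -/
def normSq (N : SignedMeasure (AddCircle T)) (u : RealL2 T) : ℝ :=
  ∑' k : regularSet N, normTerm N u k

theorem normSq_nonneg (hN : RegularCoeff N) (u : RealL2 T) : 0 ≤ normSq N u :=
  tsum_nonneg fun k => hN.normTerm_nonneg u k

theorem normH_eq {u : RealL2 T} (hu : MemH N u) : normH N u = Real.sqrt (normSq N u) := by
  rw [normH, weightedInner_eq_form (W' := fun _ => (memLp_top_const (1 : ℝ)).toLp)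
    (fun _ => (memLp_top_const (1 : ℝ)).coeFn_toLp) hu hu]
  congr 1
  refine tsum_congr fun k => ?_
  have h : ((memLp_top_const (1 : ℝ)).toLp : Lp ℝ ⊤ (volume : Measure ℝ)) • coeffL T k u
      = (coeffL T k u : L2C) := by
    refine Lp.ext ((Lp.coeFn_lpSMul _ _).trans ?_)
    filter_upwards [(memLp_top_const (1 : ℝ) (μ := (volume : Measure ℝ))).coeFn_toLp] with x hx
    rw [Pi.smul_apply', hx, one_smul]
  rw [formTerm, h, normTerm, real_inner_self_eq_norm_sq, real_inner_self_eq_norm_sq]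

theorem inner_smul_self_le {w w' : Lp ℝ ⊤ (volume : Measure ℝ)} (h : ∀ᵐ x, w x ≤ w' x) (f : L2C) :
    inner ℝ (w • f : L2C) f ≤ inner ℝ (w' • f : L2C) f := by
  rw [L2.inner_def, L2.inner_def]
  refine integral_mono_ae (L2.integrable_inner (𝕜 := ℝ) _ _) (L2.integrable_inner (𝕜 := ℝ) _ _) ?_
  filter_upwards [h, Lp.coeFn_lpSMul (r := 2) w f, Lp.coeFn_lpSMul (r := 2) w' f] with x h0 h1 h2
  rw [h1, h2, Pi.smul_apply', Pi.smul_apply', real_inner_smul_left, real_inner_smul_left]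
  exact mul_le_mul_of_nonneg_right h0 real_inner_self_nonneg

theorem le_inner_smul_self {w : Lp ℝ ⊤ (volume : Measure ℝ)} {δ : ℝ} (h : ∀ᵐ x, δ ≤ w x)
    (f : L2C) : δ * ‖f‖ ^ 2 ≤ inner ℝ (w • f : L2C) f := by
  rw [← real_inner_self_eq_norm_sq, L2.inner_def, L2.inner_def, ← integral_const_mul]
  refine integral_mono_ae ((L2.integrable_inner (𝕜 := ℝ) _ _).const_mul _)
    (L2.integrable_inner (𝕜 := ℝ) _ _) ?_
  filter_upwards [h, Lp.coeFn_lpSMul (r := 2) w f] with x h0 h1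
  rw [h1, Pi.smul_apply', real_inner_smul_left]
  exact mul_le_mul_of_nonneg_right h0 real_inner_self_nonneg

theorem form_mono (hN : RegularCoeff N) {W W' : ℤ → Lp ℝ ⊤ (volume : Measure ℝ)} {C C' : ℝ}
    (hW : CoeffBounded W C) (hC : 1 ≤ C) (hW' : CoeffBounded W' C') (hC' : 1 ≤ C')
    (h : ∀ k, ∀ᵐ x, W k x ≤ W' k x) {u : RealL2 T} (hu : MemH N u) :
    form N W u u ≤ form N W' u u := by
  refine (summable_formTerm hN hW hC hu hu).tsum_le_tsum (fun k => ?_)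
    (summable_formTerm hN hW' hC' hu hu)
  have h1 := (hN.weight_pos k).le
  have h2 := freqSq_nonneg (T := T) k
  unfold formTerm
  gcongr
  exact inner_smul_self_le (h k) _

/-- The lower bound δ on the potential acts on the zeroth-order part only; for the derivative part δ
≤ 1 suffices. -/
theorem le_form (hN : RegularCoeff N) {W : ℤ → Lp ℝ ⊤ (volume : Measure ℝ)} {C δ : ℝ}
    (hW : CoeffBounded W C) (hC : 1 ≤ C) (hδ : δ ≤ 1) (h : ∀ k, ∀ᵐ x, δ ≤ W k x) {u : RealL2 T}
    (hu : MemH N u) : δ * normSq N u ≤ form N W u u := by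
  rw [normSq, ← tsum_mul_left]
  refine (hu.summable.mul_left δ).tsum_le_tsum (fun k => ?_) (summable_formTerm hN hW hC hu hu)
  have h1 := (hN.weight_pos k).le
  have h2 := freqSq_nonneg (T := T) k
  unfold formTerm normTerm
  calc δ * (weight N k * (‖derivL u k‖ ^ 2 + freqSq T k * ‖coeffL T k u‖ ^ 2))
      = weight N k * (δ * ‖derivL u k‖ ^ 2 + freqSq T k * (δ * ‖coeffL T k u‖ ^ 2)) := by ring
    _ ≤ _ := by
        gcongr
        · rw [real_inner_self_eq_norm_sq]
          exact mul_le_of_le_one_left (sq_nonneg _) hδ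
        · exact le_inner_smul_self (h k) _

theorem abs_form_le (hN : RegularCoeff N) {W : ℤ → Lp ℝ ⊤ (volume : Measure ℝ)} {C s : ℝ}
    (hW : CoeffBounded W C) (hC : 1 ≤ C) (hs : 0 < s) {u v : RealL2 T} (hu : MemH N u)
    (hv : MemH N v) :
    |form N W u v| ≤ C * (s / 2 * normSq N u + s⁻¹ / 2 * normSq N v) := by
  have h1 := ((hu.summable.mul_left (s / 2)).add (hv.summable.mul_left (s⁻¹ / 2))).mul_left C
  have h2 : C * (s / 2 * normSq N u + s⁻¹ / 2 * normSq N v) = ∑' k : regularSet N,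
      C * (s / 2 * normTerm N u k + s⁻¹ / 2 * normTerm N v k) := by
    rw [tsum_mul_left, (hu.summable.mul_left (s / 2)).tsum_add (hv.summable.mul_left (s⁻¹ / 2)),
      tsum_mul_left, tsum_mul_left]
    rfl
  rw [h2, ← Real.norm_eq_abs]
  refine tsum_of_norm_bounded h1.hasSum fun k => ?_
  rw [Real.norm_eq_abs]
  exact abs_formTerm_le hN hW hC hs u v k

theorem form_le (hN : RegularCoeff N) {W : ℤ → Lp ℝ ⊤ (volume : Measure ℝ)} {C : ℝ}
    (hW : CoeffBounded W C) (hC : 1 ≤ C) {u : RealL2 T} (hu : MemH N u) :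
    form N W u u ≤ C * normSq N u := by
  have := (le_abs_self _).trans (abs_form_le hN hW hC one_pos hu hu)
  rw [inv_one] at this
  linarith

end Torus

section Torus

variable {T : ℝ} [Fact (0 < T)] {N : SignedMeasure (AddCircle T)}

/-! ### The energy density and the embedding into `L⁴` -/

/-- The `k`-th summand of the energy density. -/
def densityTerm (N : SignedMeasure (AddCircle T)) (u : RealL2 T) (k : ℤ) (x : ℝ) : ENNReal :=
  ENNReal.ofReal (weight N k) *
    (‖derivL u k x‖ₑ ^ 2 + ENNReal.ofReal (freqSq T k) * ‖coeffL T k u x‖ₑ ^ 2)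

/-- The density on the line whose integral is the squared norm of `H`. -/
def density (N : SignedMeasure (AddCircle T)) (u : RealL2 T) (x : ℝ) : ENNReal :=
  ∑' k : regularSet N, densityTerm N u k x

theorem aemeasurable_densityTerm (u : RealL2 T) (k : ℤ) : AEMeasurable (densityTerm N u k) := by
  unfold densityTerm
  exact (((Lp.aestronglyMeasurable _).enorm.pow_const 2).add
    (((Lp.aestronglyMeasurable _).enorm.pow_const 2).const_mul _)).const_mul _

theorem lintegral_densityTerm (hN : RegularCoeff N) (u : RealL2 T) (k : regularSet N) :
    ∫⁻ x, densityTerm N u k x = ENNReal.ofReal (normTerm N u k) := by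
  have h2 := freqSq_nonneg (T := T) k
  unfold densityTerm
  rw [lintegral_const_mul' _ _ ENNReal.ofReal_ne_top,
    lintegral_add_left' ((Lp.aestronglyMeasurable _).enorm.pow_const 2),
    lintegral_const_mul' _ _ ENNReal.ofReal_ne_top, ← norm_toLp_sq_eq, ← norm_toLp_sq_eq,
    ← ENNReal.ofReal_mul h2, ← ENNReal.ofReal_add (sq_nonneg _) (by positivity),
    ← ENNReal.ofReal_mul (hN.weight_pos k).le]
  rfl

theorem aemeasurable_density (u : RealL2 T) : AEMeasurable (density N u) := by
  unfold density
  exact AEMeasurable.tsum fun k => aemeasurable_densityTerm u k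

theorem setLIntegral_density (u : RealL2 T) (s : Set ℝ) :
    ∫⁻ x in s, density N u x = ∑' k : regularSet N, ∫⁻ x in s, densityTerm N u k x :=
  lintegral_tsum fun k => (aemeasurable_densityTerm u k).restrict

theorem lintegral_density (hN : RegularCoeff N) {u : RealL2 T} (hu : MemH N u) :
    ∫⁻ x, density N u x = ENNReal.ofReal (normSq N u) := by
  unfold density
  rw [lintegral_tsum fun k : regularSet N => aemeasurable_densityTerm u k, normSq,
    ENNReal.ofReal_tsum_of_nonneg (fun k => hN.normTerm_nonneg u k) hu.summable]
  exact tsum_congr fun k => lintegral_densityTerm hN u k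

/-- Cauchy–Schwarz for series in [0, ∞], in a form without square roots and without summability
conditions. -/
theorem sq_tsum_le {ι : Type*} (a b c : ι → ENNReal) (h : ∀ i, a i ^ 2 ≤ b i * c i) :
    (∑' i, a i) ^ 2 ≤ (∑' i, b i) * ∑' i, c i := by
  have h1 : ∀ i, a i ≤ b i ^ (1 / 2 : ℝ) * c i ^ (1 / 2 : ℝ) := by
    intro i
    rw [← ENNReal.mul_rpow_of_nonneg _ _ (by norm_num)]
    calc a i = (a i ^ 2) ^ (1 / 2 : ℝ) := by
          rw [← ENNReal.rpow_natCast, ← ENNReal.rpow_mul]; norm_num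
      _ ≤ _ := ENNReal.rpow_le_rpow (h i) (by norm_num)
  have h2 : ∀ s : Finset ι, (∑ i ∈ s, a i) ≤
      (∑' i, b i) ^ (1 / 2 : ℝ) * (∑' i, c i) ^ (1 / 2 : ℝ) := by
    intro s
    refine (Finset.sum_le_sum fun i _ => h1 i).trans ?_
    refine (ENNReal.inner_le_Lp_mul_Lq s (fun i => b i ^ (1 / 2 : ℝ)) (fun i => c i ^ (1 / 2 : ℝ))
      Real.HolderConjugate.two_two).trans ?_
    have h3 : ∀ x : ENNReal, (x ^ (1 / 2 : ℝ)) ^ (2 : ℝ) = x := fun x => by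
      rw [← ENNReal.rpow_mul]; norm_num
    simp only [h3]
    gcongr <;> exact ENNReal.sum_le_tsum s
  have h4 : ∑' i, a i ≤ (∑' i, b i) ^ (1 / 2 : ℝ) * (∑' i, c i) ^ (1 / 2 : ℝ) := by
    rw [ENNReal.tsum_eq_iSup_sum]
    exact iSup_le h2
  calc (∑' i, a i) ^ 2 ≤ ((∑' i, b i) ^ (1 / 2 : ℝ) * (∑' i, c i) ^ (1 / 2 : ℝ)) ^ 2 := by gcongr
    _ = _ := by
      rw [mul_pow, ← ENNReal.rpow_natCast, ← ENNReal.rpow_natCast, ← ENNReal.rpow_mul,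
        ← ENNReal.rpow_mul]
      norm_num

theorem MemH.ae_coeffL {u : RealL2 T} (hu : MemH N u) :
    ∀ᵐ x, (∀ k ∉ regularSet N, timeCoeff u k x = 0) ∧ ∀ k, coeffL T k u x = timeCoeff u k x := by
  refine Filter.Eventually.and ?_ (ae_all_iff.2 fun k => coeffL_ae u k)
  rw [ae_all_iff]
  intro k
  by_cases hk : k ∈ regularSet N
  · exact Eventually.of_forall fun x h => absurd hk h
  · filter_upwards [hu.1 k hk] with x hx _
    exact hx

theorem MemH.tsum_regularSet {u : RealL2 T} (hu : MemH N u) (φ : ℂ → ENNReal) (hφ : φ 0 = 0) :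
    ∀ᵐ x, ∑' k : ℤ, φ (timeCoeff u k x) = ∑' k : regularSet N, φ (coeffL T k u x) := by
  filter_upwards [hu.ae_coeffL] with x hx
  have h1 : Function.support (fun k => φ (timeCoeff u k x)) ⊆ regularSet N := by
    intro k hk
    by_contra h
    apply hk
    simp only [hx.1 k h, hφ]
  rw [← tsum_subtype_eq_of_support_subset h1]
  exact tsum_congr fun k => by rw [hx.2 k]

theorem densityTerm_ge (hN : RegularCoeff N) (u : RealL2 T) (k : regularSet N) (x : ℝ) :
    ENNReal.ofReal (((measureCoeff N k).re)⁻¹) * ‖coeffL T k u x‖ₑ ^ 2 ≤ densityTerm N u k x := by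
  rw [densityTerm, mul_add, ← mul_assoc, ← ENNReal.ofReal_mul (hN.weight_pos k).le, hN.weight_mul]
  exact le_add_self

/-- The sum of the Fourier coefficients of `N`. -/
def coeffSum (N : SignedMeasure (AddCircle T)) : ℝ := ∑' k : regularSet N, (measureCoeff N k).re

/-- From |u(x,t)| ≤ ∑ |û_k(x)| = ∑ F_k[N]^(1/2) · F_k[N]^(-1/2) |û_k(x)| and Cauchy–Schwarz: the
first factors have finite square sum, and the squares of the second are part of the density. The
bound does not depend on t. -/
theorem ae_enorm_sq_le_density (hN : RegularCoeff N) {u : RealL2 T} (hu : MemH N u) :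
    ∀ᵐ x : ℝ, ∀ᵐ t ∂(AddCircle.haarAddCircle (T := T)),
      ‖u (x, t)‖ₑ ^ 2 ≤ ENNReal.ofReal (coeffSum N) * density N u x := by
  filter_upwards [ae_enorm_le_tsum_timeCoeff u, hu.tsum_regularSet (fun z => ‖z‖ₑ) (by simp)]
    with x h1 h2
  filter_upwards [h1] with t ht
  rw [h2] at ht
  refine (pow_le_pow_left' ht 2).trans ?_
  rw [coeffSum, ENNReal.ofReal_tsum_of_nonneg (fun k : regularSet N => (hN.pos k k.2).le) hN.summable]
  refine sq_tsum_le _ _ _ fun k => ?_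
  have hp := hN.pos k k.2
  refine le_trans (le_of_eq ?_) (mul_le_mul_right (densityTerm_ge hN u k x) _)
  rw [← mul_assoc, ← ENNReal.ofReal_mul hp.le, mul_inv_cancel₀ hp.ne', ENNReal.ofReal_one, one_mul]

/-- The integral of `u⁴` over `s × 𝕋`. -/
def quart (u : RealL2 T) (s : Set ℝ) : ENNReal :=
  ∫⁻ x in s, ∫⁻ t, ‖u (x, t)‖ₑ ^ 4 ∂AddCircle.haarAddCircle

theorem ae_tsum_enorm_sq_coeffL {u : RealL2 T} (hu : MemH N u) :
    ∀ᵐ x : ℝ, ∑' k : regularSet N, ‖coeffL T k u x‖ₑ ^ 2 =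
      ∫⁻ t, ‖u (x, t)‖ₑ ^ 2 ∂AddCircle.haarAddCircle := by
  filter_upwards [tsum_enorm_sq_timeCoeff u, hu.tsum_regularSet (fun z => ‖z‖ₑ ^ 2) (by simp)]
    with x h1 h2
  rw [← h2, h1]

/-- In u⁴ = u² · u², one factor is bounded by the energy density, uniformly in t, and the other is
integrated over t by Parseval. Smallness of ∑ |û_k(x)|² on s thus becomes smallness in L⁴. -/
theorem quart_le_of_ae_le (hN : RegularCoeff N) {u : RealL2 T} (hu : MemH N u) {s : Set ℝ}
    (hs : MeasurableSet s) {M : ENNReal}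
    (hM : ∀ᵐ x, x ∈ s → ∑' k : regularSet N, ‖coeffL T k u x‖ₑ ^ 2 ≤ M) :
    quart u s ≤ ENNReal.ofReal (coeffSum N) * M * ∫⁻ x in s, density N u x := by
  unfold quart
  rw [← lintegral_const_mul'' _ (aemeasurable_density u).restrict]
  refine lintegral_mono_ae ?_
  rw [ae_restrict_iff' hs]
  filter_upwards [ae_enorm_sq_le_density hN hu, ae_tsum_enorm_sq_coeffL hu, hM,
    (Lp.memLp u).1.prodMk_left] with x h1 h2 h3 h4 hx
  have h5 : AEMeasurable (fun t => ‖u (x, t)‖ₑ ^ 2) AddCircle.haarAddCircle := h4.enorm.pow_const 2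
  calc ∫⁻ t, ‖u (x, t)‖ₑ ^ 4 ∂AddCircle.haarAddCircle
      ≤ ∫⁻ t, (ENNReal.ofReal (coeffSum N) * density N u x) * ‖u (x, t)‖ₑ ^ 2
          ∂AddCircle.haarAddCircle := by
        refine lintegral_mono_ae (h1.mono fun t ht => ?_)
        rw [show ‖u (x, t)‖ₑ ^ 4 = ‖u (x, t)‖ₑ ^ 2 * ‖u (x, t)‖ₑ ^ 2 by ring]
        gcongr
    _ = (ENNReal.ofReal (coeffSum N) * density N u x) *
          ∑' k : regularSet N, ‖coeffL T k u x‖ₑ ^ 2 := by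
        rw [lintegral_const_mul'' _ h5, h2]
    _ ≤ (ENNReal.ofReal (coeffSum N) * density N u x) * M := by
        gcongr
        exact h3 hx
    _ = _ := by ring

/-- The constant in the one-dimensional Sobolev inequality on intervals of length `L`. -/
def sobolevConst (T L : ℝ) : ℝ := 4 / L + L * freq T ^ 2

/-- The Sobolev inequality at scale ℓ bounds |û_k|² by 2/ℓ times ∫|û_k|² plus 2ℓ times ∫|û_k'|².
Against the weights in the density, ℓ = L/(2|k|) makes both contributions of order |k| F_k[N]. This
factor is bounded, which yields the embedding, and tends to zero, which yields compactness. -/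
theorem ae_enorm_sq_coeffL_le (hN : RegularCoeff N) {u : RealL2 T} (hu : MemH N u)
    (k : regularSet N) {a L : ℝ} (hL : 0 < L) : ∀ᵐ x, x ∈ Set.Icc a (a + L) →
      ‖coeffL T k u x‖ₑ ^ 2 ≤
        ENNReal.ofReal (sobolevConst T L * (|(k : ℝ)| * (measureCoeff N k).re)) *
          ∫⁻ y in Set.Icc a (a + L), densityTerm N u k y := by
  have hk0 : (k : ℤ) ≠ 0 := k.2.1
  have hk1 : 1 ≤ |((k : ℤ) : ℝ)| := by
    rw [← Int.cast_abs]
    exact_mod_cast Int.one_le_abs hk0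
  have hN0 := hN.pos k k.2
  have hw := hN.weight_pos k
  have hf := freqSq_pos (T := T) hk0
  have hω := freq_pos (T := T)
  set κ := |((k : ℤ) : ℝ)| with hκ
  set n := (measureCoeff N k).re with hn
  have hκ0 : 0 < κ := by linarith
  set ℓ := L / 2 / κ with hℓ
  have hℓ0 : 0 < ℓ := by positivity
  have hℓL : a + 2 * ℓ ≤ a + L := by
    have : L / 2 / κ ≤ L / 2 := div_le_self (by positivity) hk1
    linarith
  filter_upwards [(hu.isWeakDeriv_derivL k.2).ae_enorm_sq_le hℓ0 hℓL] with x hx hxI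
  specialize hx hxI
  set A := ∫⁻ y in Set.Icc a (a + L), ‖coeffL T k u y‖ₑ ^ 2
  set B := ∫⁻ y in Set.Icc a (a + L), ‖derivL u k y‖ₑ ^ 2
  have hD : ∫⁻ y in Set.Icc a (a + L), densityTerm N u k y =
      ENNReal.ofReal (weight N k) * B + ENNReal.ofReal (n⁻¹) * A := by
    unfold densityTerm
    rw [lintegral_const_mul' _ _ ENNReal.ofReal_ne_top,
      lintegral_add_left' ((Lp.aestronglyMeasurable _).enorm.pow_const 2).restrict,
      lintegral_const_mul' _ _ ENNReal.ofReal_ne_top, mul_add, ← mul_assoc,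
      ← ENNReal.ofReal_mul hw.le, hN.weight_mul]
  rw [hD]
  have hwn : weight N k = 1 / (freq T ^ 2 * κ ^ 2 * n) := by
    rw [weight, freqSq, hκ, sq_abs]
  have h1 : 2 ≤ ℓ * (sobolevConst T L * (κ * n)) * n⁻¹ := by
    have : ℓ * (sobolevConst T L * (κ * n)) * n⁻¹ = 2 + L ^ 2 / 2 * freq T ^ 2 := by
      rw [hℓ, sobolevConst]
      field_simp
      ring
    rw [this]
    have : 0 ≤ L ^ 2 / 2 * freq T ^ 2 := by positivity
    linarith
  have h2 : 2 * ℓ ^ 2 ≤ ℓ * (sobolevConst T L * (κ * n)) * weight N k := by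
    have : ℓ * (sobolevConst T L * (κ * n)) * weight N k
        = 2 * ℓ ^ 2 + 2 / (freq T ^ 2 * κ ^ 2) := by
      rw [hℓ, sobolevConst, hwn]
      field_simp
      ring
    rw [this]
    have : 0 ≤ 2 / (freq T ^ 2 * κ ^ 2) := by positivity
    linarith
  have hS : 0 ≤ sobolevConst T L * (κ * n) := by
    unfold sobolevConst
    positivity
  generalize sobolevConst T L * (κ * n) = S at h1 h2 hS ⊢
  rw [← ENNReal.mul_le_mul_iff_right (a := ENNReal.ofReal ℓ) (by positivity) ENNReal.ofReal_ne_top]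
  refine hx.trans ?_
  rw [← mul_assoc, ← ENNReal.ofReal_mul hℓ0.le, mul_add, ← mul_assoc, ← mul_assoc,
    ← ENNReal.ofReal_mul (mul_nonneg hℓ0.le hS), ← ENNReal.ofReal_mul (mul_nonneg hℓ0.le hS), add_comm]
  refine add_le_add ?_ ?_
  · gcongr
    rw [← ENNReal.ofReal_pow hℓ0.le, ← ENNReal.ofReal_ofNat, ← ENNReal.ofReal_mul (by norm_num)]
    exact ENNReal.ofReal_le_ofReal h2
  · gcongr
    rw [← ENNReal.ofReal_ofNat]
    exact ENNReal.ofReal_le_ofReal h1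

theorem RegularCoeff.exists_bound {T : ℝ} {N : SignedMeasure (AddCircle T)} (hN : RegularCoeff N) :
    ∃ C : ℝ, 0 ≤ C ∧ ∀ k : regularSet N, |(k : ℝ)| * (measureCoeff N k).re ≤ C := by
  have h1 : ∀ᶠ k : regularSet N in cofinite, |(k : ℝ)| * (measureCoeff N k).re ≤ 1 :=
    (hN.tendsto.eventually_lt_const one_pos).mono fun k hk => hk.le
  have h2 : {k : regularSet N | ¬ |(k : ℝ)| * (measureCoeff N k).re ≤ 1}.Finite := h1
  obtain ⟨M, hM⟩ := (h2.image fun k : regularSet N => |(k : ℝ)| * (measureCoeff N k).re).bddAbove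
  refine ⟨max 1 M, by positivity, fun k => ?_⟩
  by_cases hk : |(k : ℝ)| * (measureCoeff N k).re ≤ 1
  · exact hk.trans (le_max_left _ _)
  · exact (hM ⟨k, hk, rfl⟩).trans (le_max_right _ _)

theorem exists_ae_tsum_le (hN : RegularCoeff N) {L : ℝ} (hL : 0 < L) :
    ∃ C : ENNReal, C ≠ ⊤ ∧ ∀ u : RealL2 T, MemH N u → ∀ a, ∀ᵐ x, x ∈ Set.Icc a (a + L) →
      ∑' k : regularSet N, ‖coeffL T k u x‖ₑ ^ 2 ≤ C * ∫⁻ y in Set.Icc a (a + L), density N u y := by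
  obtain ⟨C, hC0, hC⟩ := hN.exists_bound
  refine ⟨ENNReal.ofReal (sobolevConst T L * C), ENNReal.ofReal_ne_top, fun u hu a => ?_⟩
  have h1 : ∀ᵐ x, ∀ k : regularSet N, x ∈ Set.Icc a (a + L) → _ :=
    ae_all_iff.2 fun k => ae_enorm_sq_coeffL_le hN hu k (a := a) hL
  filter_upwards [h1] with x hx hxI
  rw [setLIntegral_density, ← ENNReal.tsum_mul_left]
  refine ENNReal.tsum_le_tsum fun k => (hx k hxI).trans ?_
  gcongr
  · unfold sobolevConst
    positivity
  · exact hC k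

theorem exists_mem_Icc_of_pos {L : ℝ} (hL : 0 < L) (x : ℝ) :
    ∃ j : ℤ, x ∈ Set.Icc ((j : ℝ) * L) (j * L + L) := by
  refine ⟨⌊x / L⌋, ?_, ?_⟩
  · have := Int.floor_le (x / L)
    rwa [le_div_iff₀ hL] at this
  · have := (Int.lt_floor_add_one (x / L)).le
    rw [div_le_iff₀ hL] at this
    linarith

/-- The embedding of `H` into `L⁴`. -/
theorem exists_quart_le (hN : RegularCoeff N) :
    ∃ C : ENNReal, C ≠ ⊤ ∧ ∀ u : RealL2 T, MemH N u →
      quart u Set.univ ≤ C * ENNReal.ofReal (normSq N u) ^ 2 := by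
  obtain ⟨C, hC, h⟩ := exists_ae_tsum_le hN one_pos
  refine ⟨ENNReal.ofReal (coeffSum N) * C, ENNReal.mul_ne_top ENNReal.ofReal_ne_top hC,
    fun u hu => ?_⟩
  have h1 : ∀ᵐ x, ∀ j : ℤ, x ∈ Set.Icc ((j : ℝ) * 1) (j * 1 + 1) → _ :=
    ae_all_iff.2 fun j => h u hu ((j : ℝ) * 1)
  -- The unit cells cover the line, and the energy in a single cell is at most the total energy.
  have h2 := quart_le_of_ae_le hN hu MeasurableSet.univ
    (M := C * ∫⁻ y, density N u y) (by
      filter_upwards [h1] with x hx _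
      obtain ⟨j, hj⟩ := exists_mem_Icc_of_pos one_pos x
      refine (hx j hj).trans ?_
      gcongr
      exact Measure.restrict_le_self)
  refine h2.trans_eq ?_
  rw [setLIntegral_univ, lintegral_density hN hu]
  ring

end Torus

/-! ### Weak limits -/

/-- Weak convergence in a real Hilbert space. -/
def WeakTendsto {ι E : Type*} [NormedAddCommGroup E] [InnerProductSpace ℝ E] (l : Filter ι)
    (x : ι → E) (x₀ : E) : Prop := ∀ y, Tendsto (fun n => inner ℝ y (x n)) l (𝓝 (inner ℝ y x₀))

/-- Banach–Alaoglu, transported to the space itself by the Riesz isomorphism. An ultrafilter takes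
the place of subsequences, so that limits in all modes can be taken simultaneously without a
diagonal argument. -/
theorem exists_weakTendsto {ι E : Type*} [NormedAddCommGroup E] [InnerProductSpace ℝ E]
    [CompleteSpace E] (𝒰 : Ultrafilter ι) {x : ι → E} {R : ℝ} (hx : ∀ n, ‖x n‖ ≤ R) :
    ∃ x₀, WeakTendsto 𝒰 x x₀ := by
  let φ : ι → WeakDual ℝ E := fun n => StrongDual.toWeakDual (InnerProductSpace.toDual ℝ E (x n))
  have hc := WeakDual.isCompact_closedBall (0 : StrongDual ℝ E) R
  obtain ⟨ψ, -, hψ⟩ := hc.ultrafilter_le_nhds (𝒰.map φ) (by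
    rw [le_principal_iff, Ultrafilter.mem_coe, Ultrafilter.mem_map]
    refine Filter.univ_mem' fun n => ?_
    simp only [Set.mem_preimage, φ, WeakDual.toStrongDual, Metric.mem_closedBall, dist_zero_right]
    change ‖InnerProductSpace.toDual ℝ E (x n)‖ ≤ R
    rw [LinearIsometryEquiv.norm_map]
    exact hx n)
  refine ⟨(InnerProductSpace.toDual ℝ E).symm (WeakDual.toStrongDual ψ), fun y => ?_⟩
  have h1 : Tendsto φ 𝒰 (𝓝 ψ) := hψ
  have h2 := (WeakDual.eval_continuous (𝕜 := ℝ) (E := E) y).tendsto ψ |>.comp h1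
  have h3 : inner ℝ y ((InnerProductSpace.toDual ℝ E).symm (WeakDual.toStrongDual ψ)) = ψ y := by
    rw [real_inner_comm, InnerProductSpace.toDual_symm_apply]
    rfl
  rw [h3]
  refine h2.congr fun n => ?_
  change (InnerProductSpace.toDual ℝ E (x n)) y = _
  rw [InnerProductSpace.toDual_apply_apply, real_inner_comm]

theorem WeakTendsto.sub {ι E : Type*} [NormedAddCommGroup E] [InnerProductSpace ℝ E] {l : Filter ι}
    {x : ι → E} {x₀ : E} (h : WeakTendsto l x x₀) : WeakTendsto l (fun n => x n - x₀) 0 := by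
  intro y
  simp only [inner_sub_right, inner_zero_right]
  have := (h y).sub_const (inner ℝ y x₀)
  rwa [sub_self] at this

theorem WeakTendsto.clm {ι E F : Type*} [NormedAddCommGroup E] [InnerProductSpace ℝ E]
    [NormedAddCommGroup F] [InnerProductSpace ℝ F] [CompleteSpace E] [CompleteSpace F]
    {l : Filter ι} {x : ι → E} {x₀ : E} (h : WeakTendsto l x x₀) (A : E →L[ℝ] F) :
    WeakTendsto l (fun n => A (x n)) (A x₀) := by
  intro y
  simpa only [ContinuousLinearMap.adjoint_inner_left] using h (ContinuousLinearMap.adjoint A y)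

/-- Only the real inner product is available, so the real and imaginary parts of the complex
integral are obtained by pairing with ψ and iψ. -/
theorem exists_inner_eq_integral {ψ : ℝ → ℝ} (hψ : Continuous ψ) (hψc : HasCompactSupport ψ) :
    ∃ p q : L2C, ∀ f : L2C, ∫ x, (ψ x : ℂ) * f x = ⟨inner ℝ p f, inner ℝ q f⟩ := by
  have h1 : MemLp (fun x => (ψ x : ℂ)) 2 (volume : Measure ℝ) :=
    (Complex.continuous_ofReal.comp hψ).memLp_of_hasCompactSupport
      (hψc.comp_left Complex.ofReal_zero)
  have h2 : MemLp (fun x => (ψ x : ℂ) * Complex.I) 2 (volume : Measure ℝ) := h1.mul_const _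
  refine ⟨h1.toLp, h2.toLp, fun f => ?_⟩
  have hf : LocallyIntegrable f := (Lp.memLp f).locallyIntegrable one_le_two
  have hi := integrable_ofReal_mul hψ hψc hf
  apply Complex.ext
  · change _ = inner ℝ h1.toLp f
    rw [re_integral_ofReal_mul hi, L2_inner_eq]
    refine integral_congr_ae ?_
    filter_upwards [h1.coeFn_toLp] with x hx
    rw [hx, Complex.re_ofReal_mul, Complex.conj_re]
  · change _ = inner ℝ h2.toLp f
    rw [im_integral_ofReal_mul hi, L2_inner_eq]
    refine integral_congr_ae ?_
    filter_upwards [h2.coeFn_toLp] with x hx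
    rw [hx, mul_assoc, Complex.re_ofReal_mul]
    simp

theorem WeakTendsto.tendsto_integral {ι : Type*} {l : Filter ι} {f : ι → L2C} {f₀ : L2C}
    (h : WeakTendsto l f f₀) {ψ : ℝ → ℝ} (hψ : Continuous ψ) (hψc : HasCompactSupport ψ) :
    Tendsto (fun n => ∫ x, (ψ x : ℂ) * f n x) l (𝓝 (∫ x, (ψ x : ℂ) * f₀ x)) := by
  obtain ⟨p, q, hpq⟩ := exists_inner_eq_integral hψ hψc
  simp only [hpq]
  have h1 := (Complex.continuous_ofReal.tendsto _).comp (h p)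
  have h2 := (Complex.continuous_ofReal.tendsto _).comp (h q)
  have h3 := h1.add (h2.mul_const Complex.I)
  simpa only [Function.comp_def, Complex.mk_eq_add_mul_I] using h3

theorem IsWeakDeriv.of_weakTendsto {ι : Type*} {l : Filter ι} [l.NeBot] {f g : ι → L2C} {f₀ g₀ : L2C}
    (h : ∀ n, IsWeakDeriv (f n) (g n)) (hf : WeakTendsto l f f₀) (hg : WeakTendsto l g g₀) :
    IsWeakDeriv f₀ g₀ := by
  refine ⟨(Lp.memLp f₀).locallyIntegrable one_le_two, (Lp.memLp g₀).locallyIntegrable one_le_two,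
    fun φ hφ hφc => ?_⟩
  have h1 := hf.tendsto_integral (hφ.continuous_deriv (by simp)) hφc.deriv
  have h2 := (hg.tendsto_integral hφ.continuous hφc).neg
  exact tendsto_nhds_unique h1 (h2.congr fun n => ((h n).2.2 φ hφ hφc).symm)

theorem WeakTendsto.tendsto_setIntegral_zero {ι : Type*} {l : Filter ι} {f : ι → L2C}
    (h : WeakTendsto l f 0) (a b : ℝ) :
    Tendsto (fun n => ∫ x in Set.Icc a b, f n x) l (𝓝 0) := by
  have hμ : (volume : Measure ℝ) (Set.Icc a b) ≠ ⊤ := by simp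
  have h1 := h (indicatorConstLp 2 measurableSet_Icc hμ (1 : ℂ))
  have h2 := h (indicatorConstLp 2 measurableSet_Icc hμ Complex.I)
  simp only [L2.inner_indicatorConstLp_eq_inner_setIntegral, inner_zero_right, Complex.inner] at h1 h2
  simp only [map_one, mul_one, Complex.conj_I, mul_neg, Complex.neg_re, Complex.mul_I_re, neg_neg]
    at h1 h2
  have h3 := ((Complex.continuous_ofReal.tendsto _).comp h1).add
    (((Complex.continuous_ofReal.tendsto _).comp h2).mul_const Complex.I)
  simpa only [Function.comp_def, Complex.re_add_im, Complex.ofReal_zero, zero_mul, add_zero] using h3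

/-! ### Weak limits in H and local compactness in L⁴ -/

section Torus

variable {T : ℝ} [Fact (0 < T)] {N : SignedMeasure (AddCircle T)}

theorem exists_norm_sq_le (hN : RegularCoeff N) :
    ∃ C : ℝ, 0 ≤ C ∧ ∀ u : RealL2 T, MemH N u → ‖u‖ ^ 2 ≤ C * normSq N u := by
  obtain ⟨C, hC0, hC⟩ := hN.exists_bound
  refine ⟨C, hC0, fun u hu => ?_⟩
  rw [← ENNReal.ofReal_le_ofReal_iff (mul_nonneg hC0 (normSq_nonneg hN u)), norm_toLp_sq_eq,
    lintegral_spaceTime ((Lp.memLp u).1.enorm.pow_const 2),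
    ← lintegral_congr_ae (ae_tsum_enorm_sq_coeffL hu), ENNReal.ofReal_mul hC0,
    ← lintegral_density hN hu, ← lintegral_const_mul'' _ (aemeasurable_density u)]
  refine lintegral_mono fun x => ?_
  rw [density, ← ENNReal.tsum_mul_left]
  refine ENNReal.tsum_le_tsum fun k => ?_
  have hp := hN.pos k k.2
  have h1 : 1 ≤ C * ((measureCoeff N k).re)⁻¹ := by
    rw [← div_eq_mul_inv, one_le_div hp]
    refine le_trans (le_mul_of_one_le_left hp.le ?_) (hC k)
    rw [← Int.cast_abs]
    exact_mod_cast Int.one_le_abs k.2.1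
  refine le_trans ?_ (mul_le_mul_right (densityTerm_ge hN u k x) _)
  rw [← mul_assoc, ← ENNReal.ofReal_mul hC0]
  refine le_mul_of_one_le_left (by positivity) ?_
  rw [← ENNReal.ofReal_one]
  exact ENNReal.ofReal_le_ofReal h1

theorem normTerm_le_normSq (hN : RegularCoeff N) {u : RealL2 T} (hu : MemH N u)
    (k : regularSet N) : normTerm N u k ≤ normSq N u :=
  hu.summable.le_tsum k fun j _ => hN.normTerm_nonneg u j

theorem norm_derivL_sq_le (hN : RegularCoeff N) {u : RealL2 T} (hu : MemH N u)
    (k : regularSet N) : ‖derivL u k‖ ^ 2 ≤ normSq N u / weight N k := by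
  rw [le_div_iff₀ (hN.weight_pos k)]
  refine le_trans ?_ (normTerm_le_normSq hN hu k)
  have h1 := (hN.weight_pos k).le
  have h2 := freqSq_nonneg (T := T) k
  rw [normTerm, mul_comm]
  gcongr
  exact le_add_of_nonneg_right (by positivity)

/-- Bounded sequences in `H` have weak limits along ultrafilters. -/
theorem exists_weak_limit (hN : RegularCoeff N) {ι : Type*} (𝒰 : Ultrafilter ι) {u : ι → RealL2 T}
    {R : ℝ} (hu : ∀ n, MemH N (u n)) (hR : ∀ n, normSq N (u n) ≤ R) :
    ∃ u₀, MemH N u₀ ∧ ∀ k ∈ regularSet N,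
      WeakTendsto 𝒰 (fun n => coeffL T k (u n)) (coeffL T k u₀) ∧
      WeakTendsto 𝒰 (fun n => derivL (u n) k) (derivL u₀ k) := by
  obtain ⟨C, hC0, hC⟩ := exists_norm_sq_le hN
  obtain ⟨u₀, hu₀⟩ := exists_weakTendsto 𝒰 (x := u) (R := Real.sqrt (C * R)) fun n =>
    Real.le_sqrt_of_sq_le ((hC _ (hu n)).trans (by gcongr; exact hR n))
  have hg : ∀ k : ℤ, ∃ g : L2C, k ∈ regularSet N → WeakTendsto 𝒰 (fun n => derivL (u n) k) g := by
    intro k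
    by_cases hk : k ∈ regularSet N
    · obtain ⟨g, hg⟩ := exists_weakTendsto 𝒰 (x := fun n => derivL (u n) k)
        (R := Real.sqrt (R / weight N k)) fun n =>
        Real.le_sqrt_of_sq_le ((norm_derivL_sq_le hN (hu n) ⟨k, hk⟩).trans (by
          have := (hN.weight_pos ⟨k, hk⟩).le
          gcongr; exact hR n))
      exact ⟨g, fun _ => hg⟩
    · exact ⟨0, fun h => absurd h hk⟩
  choose g hg using hg
  have ha : ∀ k, WeakTendsto 𝒰 (fun n => coeffL T k (u n)) (coeffL T k u₀) := fun k =>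
    hu₀.clm (coeffL T k)
  have hmem := MemH.of_isWeakDeriv (N := N) (u := u₀) g (by
      intro k hk
      rw [← coeffL_eq_zero_iff, ← inner_self_eq_zero (𝕜 := ℝ)]
      have h1 := ha k (coeffL T k u₀)
      simp only [(hu _).coeffL_eq_zero hk, inner_zero_right] at h1
      exact (tendsto_nhds_unique h1 tendsto_const_nhds))
    (fun k hk => (IsWeakDeriv.of_weakTendsto (fun n => (hu n).isWeakDeriv_derivL hk) (ha k)
      (hg k hk)).congr (coeffL_ae u₀ k) EventuallyEq.rfl)
    (by
      have hnn : ∀ k : regularSet N, 0 ≤ weight N k * (‖g k‖ ^ 2 + freqSq T k * ‖coeffL T k u₀‖ ^ 2) :=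
        fun k => by
          have h1 := (hN.weight_pos k).le
          have h2 := freqSq_nonneg (T := T) k
          positivity
      refine summable_of_sum_le (c := R) hnn fun s => ?_
      set S := ∑ k ∈ s, weight N k * (‖g k‖ ^ 2 + freqSq T k * ‖coeffL T k u₀‖ ^ 2) with hS
      have h1 : Tendsto (fun n => ∑ k ∈ s, weight N k * (inner ℝ (g k) (derivL (u n) k) +
          freqSq T k * inner ℝ (coeffL T k u₀) (coeffL T k (u n)))) 𝒰 (𝓝 S) := by
        rw [hS]
        refine tendsto_finsetSum _ fun k _ => ?_
        have h2 := ((hg k k.2 (g k)).add ((ha k (coeffL T k u₀)).const_mul (freqSq T k))).const_mul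
          (weight N k)
        simpa only [real_inner_self_eq_norm_sq] using h2
      -- Weak lower semicontinuity for a finite partial sum: S is the limit of the pairings of the
      -- limit with the sequence, and Young bounds each pairing by S/2 + R/2. Hence S ≤ R for every
      -- finite set of modes.
      have h3 : S ≤ S / 2 + R / 2 := by
        refine le_of_tendsto h1 (Eventually.of_forall fun n => ?_)
        have h4 : ∑ k ∈ s, normTerm N (u n) k ≤ R :=
          ((hu n).summable.sum_le_tsum s fun k _ => hN.normTerm_nonneg _ k).trans (hR n)
        have h5 : ∑ k ∈ s, weight N k * (inner ℝ (g k) (derivL (u n) k) +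
          freqSq T k * inner ℝ (coeffL T k u₀) (coeffL T k (u n))) ≤
            S / 2 + (∑ k ∈ s, normTerm N (u n) k) / 2 := by
          rw [hS, Finset.sum_div, Finset.sum_div, ← Finset.sum_add_distrib]
          refine Finset.sum_le_sum fun k _ => ?_
          have e1 := (hN.weight_pos k).le
          have e2 := freqSq_nonneg (T := T) k
          have e3 := (real_inner_le_norm (g k) (derivL (u n) k)).trans
            (mul_le_weighted_sq (s := 1) one_pos)
          have e4 := (real_inner_le_norm (coeffL T k u₀) (coeffL T k (u n))).trans
            (mul_le_weighted_sq (s := 1) one_pos)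
          calc _ ≤ weight N k * ((1 / 2 * ‖g k‖ ^ 2 + 1⁻¹ / 2 * ‖derivL (u n) k‖ ^ 2) +
                freqSq T k * (1 / 2 * ‖coeffL T k u₀‖ ^ 2 + 1⁻¹ / 2 * ‖coeffL T k (u n)‖ ^ 2)) := by
                gcongr
            _ = _ := by rw [normTerm]; ring
        linarith
      linarith)
  refine ⟨u₀, hmem.1, fun k hk => ⟨ha k, ?_⟩⟩
  rw [hmem.2 k hk]
  exact hg k hk

/-- A bounded sequence in `H` converging weakly to zero. -/
structure WeakNull (N : SignedMeasure (AddCircle T)) {ι : Type*} (l : Filter ι) (R : ℝ)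
    (r : ι → RealL2 T) : Prop where
  mem : ∀ n, MemH N (r n)
  bound : ∀ n, normSq N (r n) ≤ R
  coeff : ∀ k ∈ regularSet N, WeakTendsto l (fun n => coeffL T k (r n)) 0
  deriv : ∀ k ∈ regularSet N, WeakTendsto l (fun n => derivL (r n) k) 0

/-- Weak convergence is known only mode by mode. A large s makes the contribution of r in Young's
inequality small for all n; then finitely many modes are split off so that the tail of u is small
despite the factor s, and on those modes weak convergence applies. -/
theorem WeakNull.tendsto_form (hN : RegularCoeff N) {ι : Type*} {l : Filter ι} {R : ℝ}
    {r : ι → RealL2 T} (hr : WeakNull N l R r) {W : ℤ → Lp ℝ ⊤ (volume : Measure ℝ)} {C : ℝ}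
    (hW : CoeffBounded W C) (hC : 1 ≤ C) {u : RealL2 T} (hu : MemH N u) :
    Tendsto (fun n => form N W u (r n)) l (𝓝 0) := by
  rw [Metric.tendsto_nhds]
  intro ε hε
  obtain ⟨s, hs, hsε⟩ : ∃ s : ℝ, 0 < s ∧ C * (s⁻¹ / 2 * R) ≤ ε / 3 := by
    refine ⟨3 * C * (|R| + 1) / ε, by positivity, ?_⟩
    have hR : R / (|R| + 1) ≤ 1 := by
      rw [div_le_one (by positivity)]
      linarith [le_abs_self R]
    have h1 : C * ((3 * C * (|R| + 1) / ε)⁻¹ / 2 * R) = ε / 6 * (R / (|R| + 1)) := by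
      field_simp
      ring
    rw [h1]
    nlinarith
  obtain ⟨F, hF⟩ : ∃ F : Finset (regularSet N),
      C * (s / 2 * ∑' k : {k // k ∉ F}, normTerm N u k) < ε / 3 := by
    have h1 := ((tendsto_tsum_compl_atTop_zero fun k : regularSet N => normTerm N u k).const_mul
      (s / 2)).const_mul C
    simp only [mul_zero] at h1
    exact (h1.eventually_lt_const (by positivity)).exists
  have hfin : Tendsto (fun n => ∑ k ∈ F, formTerm N W u (r n) k) l (𝓝 0) := by
    rw [show (0 : ℝ) = ∑ k ∈ F, 0 by simp]
    refine tendsto_finsetSum _ fun k _ => ?_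
    have h1 := hr.deriv k k.2 (derivL u k)
    have h2 := hr.coeff k k.2 (W k • coeffL T k u : L2C)
    have h3 := (h1.add (h2.const_mul (freqSq T k))).const_mul (weight N k)
    simpa only [formTerm, inner_zero_right, mul_zero, add_zero] using h3
  filter_upwards [(Metric.tendsto_nhds.1 hfin) (ε / 3) (by positivity)] with n hn
  rw [Real.dist_eq, sub_zero] at hn ⊢
  have hsum := summable_formTerm hN hW hC hu (hr.mem n)
  have hsplit := hsum.sum_add_tsum_subtype_compl F
  have hu' : Summable fun k : {k // k ∉ F} => normTerm N u k :=
    hu.summable.comp_injective Subtype.val_injective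
  have hr' : Summable fun k : {k // k ∉ F} => normTerm N (r n) k :=
    (hr.mem n).summable.comp_injective Subtype.val_injective
  have htail : |∑' k : {k // k ∉ F}, formTerm N W u (r n) k| ≤
      C * (s / 2 * ∑' k : {k // k ∉ F}, normTerm N u k) +
        C * (s⁻¹ / 2 * ∑' k : {k // k ∉ F}, normTerm N (r n) k) := by
    have h1 := ((hu'.mul_left (s / 2)).add (hr'.mul_left (s⁻¹ / 2))).mul_left C
    have h2 := h1.hasSum
    rw [tsum_mul_left, (hu'.mul_left (s / 2)).tsum_add (hr'.mul_left (s⁻¹ / 2)), tsum_mul_left,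
      tsum_mul_left, mul_add] at h2
    rw [← Real.norm_eq_abs]
    refine tsum_of_norm_bounded h2 fun k => ?_
    rw [Real.norm_eq_abs]
    exact abs_formTerm_le hN hW hC hs u (r n) k
  have htail2 : ∑' k : {k // k ∉ F}, normTerm N (r n) k ≤ R := by
    refine le_trans ?_ (hr.bound n)
    exact (hr.mem n).summable.tsum_subtype_le _ _ (fun k => hN.normTerm_nonneg _ k)
  have h4 : C * (s⁻¹ / 2 * ∑' k : {k // k ∉ F}, normTerm N (r n) k) ≤ C * (s⁻¹ / 2 * R) := by
    gcongr
  rw [form, ← hsplit]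
  refine (abs_add_le _ _).trans_lt ?_
  linarith

/-- The recurring choice b / (a + 1) of a small constant, which avoids treating a = 0 separately. -/
theorem mul_div_mul_add_one_le {a b : ℝ} (ha : 0 ≤ a) (hb : 0 ≤ b) : a * (b / (a + 1)) ≤ b := by
  rw [mul_div_assoc', div_le_iff₀ (by positivity)]
  nlinarith

theorem WeakNull.lintegral_density_le (hN : RegularCoeff N) {ι : Type*} {l : Filter ι} {R : ℝ}
    {r : ι → RealL2 T} (hr : WeakNull N l R r) (n : ι) :
    ∫⁻ x, density N (r n) x ≤ ENNReal.ofReal |R| := by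
  rw [lintegral_density hN (hr.mem n)]
  exact ENNReal.ofReal_le_ofReal ((hr.bound n).trans (le_abs_self R))

theorem WeakNull.eventually_ae_coeffL_le (hN : RegularCoeff N) {ι : Type*} {l : Filter ι} {R : ℝ}
    {r : ι → RealL2 T} (hr : WeakNull N l R r) (ρ : ℝ) (F : Finset (regularSet N)) {ε : ℝ}
    (hε : 0 < ε) : ∀ᶠ n in l, ∀ᵐ x, ∀ k ∈ F, x ∈ Set.Icc (-ρ) ρ → ‖coeffL T k (r n) x‖ ≤ ε := by
  have h1 : ∀ᶠ n in l, ∀ k ∈ F, ∀ᵐ x, x ∈ Set.Icc (-ρ) ρ → ‖coeffL T k (r n) x‖ ≤ ε := by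
    rw [eventually_all_finset]
    intro k _
    refine eventually_ae_norm_le (f := fun n => coeffL T k (r n)) (g := fun n => derivL (r n) k)
      (G := Real.sqrt (|R| / weight N k)) (Real.sqrt_nonneg _)
      (fun n => (hr.mem n).isWeakDeriv_derivL k.2) (fun n => ?_)
      (fun a b => (hr.coeff k k.2).tendsto_setIntegral_zero a b) ρ hε
    have hw := (hN.weight_pos k).le
    rw [← norm_toLp_sq_eq, Real.sq_sqrt (by positivity)]
    refine ENNReal.ofReal_le_ofReal ((norm_derivL_sq_le hN (hr.mem n) k).trans ?_)
    gcongr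
    exact (hr.bound n).trans (le_abs_self R)
  filter_upwards [h1] with n hn
  exact (Finset.eventually_all F (l := ae volume) (p := fun k x => x ∈ Set.Icc (-ρ) ρ →
    ‖coeffL T k (r n) x‖ ≤ ε)).2 hn

/-- All but finitely many modes have |k| F_k[N] < η, and together they contribute at most a multiple
of η times the bounded energy. Each remaining mode tends to zero uniformly on [-ρ, ρ] by the
one-dimensional argument. -/
theorem WeakNull.eventually_tsum_le (hN : RegularCoeff N) {ι : Type*} {l : Filter ι} {R : ℝ}
    {r : ι → RealL2 T} (hr : WeakNull N l R r) {ρ : ℝ} (hρ : 0 < ρ) {τ : ℝ} (hτ : 0 < τ) :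
    ∀ᶠ n in l, ∀ᵐ x, x ∈ Set.Icc (-ρ) ρ →
      ∑' k : regularSet N, ‖coeffL T k (r n) x‖ₑ ^ 2 ≤ ENNReal.ofReal τ := by
  have hL : 0 < 2 * ρ := by positivity
  have hρ2 : -ρ + 2 * ρ = ρ := by ring
  obtain ⟨S, hS⟩ : ∃ S, S = sobolevConst T (2 * ρ) := ⟨_, rfl⟩
  have hS0 : 0 ≤ S := by rw [hS, sobolevConst]; positivity
  have hR0 : 0 ≤ |R| := abs_nonneg R
  obtain ⟨η, hη, hηS⟩ : ∃ η, 0 < η ∧ S * |R| * η ≤ τ / 2 :=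
    ⟨τ / 2 / (S * |R| + 1), by positivity, mul_div_mul_add_one_le (by positivity) (by positivity)⟩
  have hfin : {k : regularSet N | ¬ |(k : ℝ)| * (measureCoeff N k).re < η}.Finite :=
    hN.tendsto.eventually_lt_const hη
  obtain ⟨F, hF⟩ : ∃ F : Finset (regularSet N), ∀ k ∉ F, |(k : ℝ)| * (measureCoeff N k).re < η :=
    ⟨hfin.toFinset, fun k hk => by simpa using hk⟩
  obtain ⟨θ, hθ, hθF⟩ : ∃ θ : ℝ, 0 < θ ∧ F.card * θ ≤ τ / 2 :=
    ⟨τ / 2 / (F.card + 1), by positivity, mul_div_mul_add_one_le (by positivity) (by positivity)⟩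
  filter_upwards [hr.eventually_ae_coeffL_le hN ρ F (Real.sqrt_pos.2 hθ)] with n h2
  have h3 : ∀ᵐ x, ∀ k : regularSet N, x ∈ Set.Icc (-ρ) (-ρ + 2 * ρ) → _ :=
    ae_all_iff.2 fun k => ae_enorm_sq_coeffL_le hN (hr.mem n) k (a := -ρ) hL
  filter_upwards [h2, h3] with x hx2 hx3 hxI
  rw [hρ2, ← hS] at hx3
  have h4 : ∀ k : regularSet N, ‖coeffL T k (r n) x‖ₑ ^ 2 ≤
      (if k ∈ F then ENNReal.ofReal θ else 0) +
        ENNReal.ofReal (S * η) * ∫⁻ y, densityTerm N (r n) k y := by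
    intro k
    by_cases hk : k ∈ F
    · rw [if_pos hk]
      refine le_trans ?_ le_self_add
      rw [enorm_sq_eq_ofReal]
      refine ENNReal.ofReal_le_ofReal ?_
      rw [← Real.sq_sqrt hθ.le]
      exact pow_le_pow_left₀ (norm_nonneg _) (hx2 k hk hxI) 2
    · rw [if_neg hk, zero_add]
      refine (hx3 k hxI).trans (mul_le_mul' ?_ (setLIntegral_le_lintegral _ _))
      exact ENNReal.ofReal_le_ofReal (mul_le_mul_of_nonneg_left (hF k hk).le hS0)
  have h5 : ∑' k : regularSet N, ∫⁻ y, densityTerm N (r n) k y ≤ ENNReal.ofReal |R| := by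
    rw [← lintegral_tsum fun k : regularSet N => aemeasurable_densityTerm (r n) k]
    exact hr.lintegral_density_le hN n
  have h6 : ∑' k : regularSet N, (if k ∈ F then ENNReal.ofReal θ else 0) =
      ENNReal.ofReal (F.card * θ) := by
    rw [tsum_eq_sum (s := F) (fun k hk => if_neg hk),
      Finset.sum_congr rfl (fun k hk => if_pos hk), Finset.sum_const, nsmul_eq_mul,
      ENNReal.ofReal_mul (by positivity), ENNReal.ofReal_natCast]
  calc ∑' k : regularSet N, ‖coeffL T k (r n) x‖ₑ ^ 2
      ≤ ENNReal.ofReal (F.card * θ) + ENNReal.ofReal (S * η) * ENNReal.ofReal |R| := by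
        refine (ENNReal.tsum_le_tsum h4).trans ?_
        rw [ENNReal.tsum_add, ENNReal.tsum_mul_left, h6]
        exact add_le_add le_rfl (mul_le_mul_right h5 _)
    _ = ENNReal.ofReal (F.card * θ + S * η * |R|) := by
        rw [← ENNReal.ofReal_mul (by positivity), ← ENNReal.ofReal_add (by positivity) (by positivity)]
    _ ≤ ENNReal.ofReal τ := by
        refine ENNReal.ofReal_le_ofReal ?_
        have : S * η * |R| = S * |R| * η := by ring
        linarith

/-- Local compactness of the embedding into `L⁴`. -/
theorem WeakNull.tendsto_quart (hN : RegularCoeff N) {ι : Type*} {l : Filter ι} {R : ℝ}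
    {r : ι → RealL2 T} (hr : WeakNull N l R r) {ρ : ℝ} (hρ : 0 < ρ) :
    Tendsto (fun n => quart (r n) (Set.Icc (-ρ) ρ)) l (𝓝 0) := by
  rw [ENNReal.tendsto_nhds_zero]
  intro ε hε
  by_cases hε' : ε = ⊤
  · simp [hε']
  have hK : 0 ≤ coeffSum N := tsum_nonneg fun k => (hN.pos k k.2).le
  have hεr : 0 < ε.toReal := ENNReal.toReal_pos hε.ne' hε'
  have hR0 : 0 ≤ |R| := abs_nonneg R
  obtain ⟨τ, hτ, hτε⟩ : ∃ τ, 0 < τ ∧ coeffSum N * |R| * τ ≤ ε.toReal :=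
    ⟨ε.toReal / (coeffSum N * |R| + 1), by positivity,
      mul_div_mul_add_one_le (by positivity) hεr.le⟩
  filter_upwards [hr.eventually_tsum_le hN hρ hτ] with n hn
  refine (quart_le_of_ae_le hN (hr.mem n) measurableSet_Icc hn).trans ?_
  have h1 : ∫⁻ x in Set.Icc (-ρ) ρ, density N (r n) x ≤ ENNReal.ofReal |R| :=
    (setLIntegral_le_lintegral _ _).trans (hr.lintegral_density_le hN n)
  refine (mul_le_mul_right h1 _).trans ?_
  rw [← ENNReal.ofReal_mul hK, ← ENNReal.ofReal_mul (by positivity),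
    ← ENNReal.ofReal_toReal hε']
  refine ENNReal.ofReal_le_ofReal ?_
  have : coeffSum N * τ * |R| = coeffSum N * |R| * τ := by ring
  linarith

end Torus

/-! ### The quartic functional -/

theorem sq_mul_sq_le {s a b : ℝ} (hs : 0 < s) : a ^ 2 * b ^ 2 ≤ s / 2 * a ^ 4 + s⁻¹ / 2 * b ^ 4 := by
  have h := mul_le_weighted_sq (a := a ^ 2) (b := b ^ 2) hs
  rwa [← pow_mul, ← pow_mul] at h

/-- The elementary inequality behind the Brezis–Lieb splitting: Young's inequality absorbs the mixed
terms of the binomial expansion. -/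
theorem exists_abs_add_pow_four_sub_le {ε : ℝ} (hε : 0 < ε) : ∃ C : ℝ, 0 ≤ C ∧ ∀ a b : ℝ,
    |(a + b) ^ 4 - a ^ 4 - b ^ 4| ≤ ε * a ^ 4 + C * b ^ 4 := by
  -- The term a³b costs 2t a⁴ = (ε/2) a⁴ and leaves multiples of a²b². The total coefficient of a²b²
  -- is 2t⁻¹ + 8, and s is chosen so that absorbing it costs another (ε/2) a⁴.
  obtain ⟨t, ht, htε⟩ : ∃ t, 0 < t ∧ t = ε / 4 := ⟨ε / 4, by positivity, rfl⟩
  obtain ⟨s, hs, hsε⟩ : ∃ s, 0 < s ∧ (2 * t⁻¹ + 8) * s = ε := by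
    refine ⟨ε / (2 * t⁻¹ + 8), by positivity, ?_⟩
    field_simp
  refine ⟨(2 * t⁻¹ + 8) * (s⁻¹ / 2) + 2, by positivity, fun a b => ?_⟩
  have h1 : |a * b| ≤ t / 2 * a ^ 2 + t⁻¹ / 2 * b ^ 2 := by
    have := mul_le_weighted_sq (a := |a|) (b := |b|) ht
    rwa [← abs_mul, sq_abs, sq_abs] at this
  have h2 : |a * b| ≤ 1 / 2 * a ^ 2 + 1 / 2 * b ^ 2 := by
    have := mul_le_weighted_sq (a := |a|) (b := |b|) one_pos
    rw [← abs_mul, sq_abs, sq_abs] at this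
    simpa using this
  have h3 := sq_mul_sq_le (a := a) (b := b) hs
  have h4 : |(a + b) ^ 4 - a ^ 4 - b ^ 4| ≤
      4 * a ^ 2 * |a * b| + 6 * (a ^ 2 * b ^ 2) + 4 * b ^ 2 * |a * b| := by
    have e : (a + b) ^ 4 - a ^ 4 - b ^ 4 =
        4 * a ^ 2 * (a * b) + 6 * (a ^ 2 * b ^ 2) + 4 * b ^ 2 * (a * b) := by ring
    rw [e]
    refine (abs_add_le _ _).trans (add_le_add ((abs_add_le _ _).trans (add_le_add ?_ ?_)) ?_)
    · rw [abs_mul, abs_of_nonneg (by positivity : (0 : ℝ) ≤ 4 * a ^ 2)]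
    · rw [abs_of_nonneg (by positivity)]
    · rw [abs_mul, abs_of_nonneg (by positivity : (0 : ℝ) ≤ 4 * b ^ 2)]
  have h5 : 4 * a ^ 2 * |a * b| ≤ 2 * t * a ^ 4 + 2 * t⁻¹ * (a ^ 2 * b ^ 2) := by
    calc 4 * a ^ 2 * |a * b| ≤ 4 * a ^ 2 * (t / 2 * a ^ 2 + t⁻¹ / 2 * b ^ 2) := by gcongr
      _ = _ := by ring
  have h6 : 4 * b ^ 2 * |a * b| ≤ 2 * (a ^ 2 * b ^ 2) + 2 * b ^ 4 := by
    calc 4 * b ^ 2 * |a * b| ≤ 4 * b ^ 2 * (1 / 2 * a ^ 2 + 1 / 2 * b ^ 2) := by gcongr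
      _ = _ := by ring
  have h7 : (2 * t⁻¹ + 8) * (a ^ 2 * b ^ 2) ≤
      (2 * t⁻¹ + 8) * s / 2 * a ^ 4 + (2 * t⁻¹ + 8) * (s⁻¹ / 2) * b ^ 4 := by
    calc (2 * t⁻¹ + 8) * (a ^ 2 * b ^ 2)
        ≤ (2 * t⁻¹ + 8) * (s / 2 * a ^ 4 + s⁻¹ / 2 * b ^ 4) := by gcongr
      _ = _ := by ring
  rw [hsε] at h7
  rw [htε] at h5 h7
  rw [htε]
  nlinarith

section Torus

variable {T : ℝ} [Fact (0 < T)] {N : SignedMeasure (AddCircle T)}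

/-- The integral of `h u⁴` over space-time. -/
def quartic (h : ℝ → ℝ) (u : RealL2 T) : ℝ :=
  ∫ p : ℝ × AddCircle T, h p.1 * u p ^ 4 ∂(spaceTime T)

/-- The integral of `u⁴` over `s × 𝕋`, as a real number. -/
def quarticOn (u : RealL2 T) (s : Set ℝ) : ℝ :=
  ∫ p in s ×ˢ (Set.univ : Set (AddCircle T)), u p ^ 4 ∂(spaceTime T)

theorem lintegral_pow_four_eq_quart (u : RealL2 T) (s : Set ℝ) :
    ∫⁻ p in s ×ˢ (Set.univ : Set (AddCircle T)), ENNReal.ofReal (u p ^ 4) ∂(spaceTime T) =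
      quart u s := by
  have h1 : ∀ p, ENNReal.ofReal (u p ^ 4) = ‖u p‖ₑ ^ 4 := fun p => by
    rw [← ofReal_norm, ← ENNReal.ofReal_pow (norm_nonneg _), Real.norm_eq_abs,
      Even.pow_abs (by decide)]
  simp only [h1]
  have h2 : (spaceTime T).restrict (s ×ˢ (Set.univ : Set (AddCircle T))) =
      ((volume : Measure ℝ).restrict s).prod AddCircle.haarAddCircle := by
    rw [← Measure.restrict_univ (μ := AddCircle.haarAddCircle (T := T)), Measure.prod_restrict]
    rfl
  have h3 : AEMeasurable (fun p => ‖u p‖ₑ ^ 4)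
      (((volume : Measure ℝ).restrict s).prod (AddCircle.haarAddCircle (T := T))) := by
    rw [← h2]
    exact ((Lp.aestronglyMeasurable u).enorm.pow_const 4).restrict
  rw [h2, lintegral_prod _ h3]
  rfl

theorem integrable_pow_four (hN : RegularCoeff N) {u : RealL2 T} (hu : MemH N u) :
    Integrable (fun p => u p ^ 4) (spaceTime T) := by
  obtain ⟨C, hC, h⟩ := exists_quart_le hN
  refine ⟨(Lp.aestronglyMeasurable u).pow 4, ?_⟩
  rw [hasFiniteIntegral_iff_ofReal (Eventually.of_forall fun p => by positivity)]
  have h1 := lintegral_pow_four_eq_quart u Set.univ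
  rw [Set.univ_prod_univ, setLIntegral_univ] at h1
  rw [h1]
  exact (h u hu).trans_lt (ENNReal.mul_lt_top hC.lt_top (by simp))

theorem ofReal_quarticOn (hN : RegularCoeff N) {u : RealL2 T} (hu : MemH N u) (s : Set ℝ) :
    ENNReal.ofReal (quarticOn u s) = quart u s := by
  rw [quarticOn, ofReal_integral_eq_lintegral_ofReal (integrable_pow_four hN hu).integrableOn
    (Eventually.of_forall fun p => by positivity), lintegral_pow_four_eq_quart]

theorem quarticOn_nonneg (u : RealL2 T) (s : Set ℝ) : 0 ≤ quarticOn u s :=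
  integral_nonneg fun p => by positivity

theorem quarticOn_eq_toReal (hN : RegularCoeff N) {u : RealL2 T} (hu : MemH N u) (s : Set ℝ) :
    quarticOn u s = (quart u s).toReal := by
  rw [← ofReal_quarticOn hN hu, ENNReal.toReal_ofReal (quarticOn_nonneg u s)]

theorem quarticOn_univ (u : RealL2 T) : quarticOn u Set.univ = ∫ p, u p ^ 4 ∂(spaceTime T) := by
  rw [quarticOn, Set.univ_prod_univ, setIntegral_univ]

theorem quarticOn_le_univ (hN : RegularCoeff N) {u : RealL2 T} (hu : MemH N u) (s : Set ℝ) :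
    quarticOn u s ≤ quarticOn u Set.univ := by
  rw [quarticOn_univ]
  exact setIntegral_le_integral (integrable_pow_four hN hu)
    (Eventually.of_forall fun p => by positivity)

theorem exists_quarticOn_le (hN : RegularCoeff N) :
    ∃ C : ℝ, 0 ≤ C ∧ ∀ u : RealL2 T, MemH N u → quarticOn u Set.univ ≤ C * normSq N u ^ 2 := by
  obtain ⟨C, hC, h⟩ := exists_quart_le hN
  refine ⟨C.toReal, ENNReal.toReal_nonneg, fun u hu => ?_⟩
  have h1 := h u hu
  rw [← ofReal_quarticOn hN hu, ← ENNReal.ofReal_toReal hC, ← ENNReal.ofReal_pow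
    (normSq_nonneg hN u), ← ENNReal.ofReal_mul ENNReal.toReal_nonneg] at h1
  exact (ENNReal.ofReal_le_ofReal_iff (mul_nonneg ENNReal.toReal_nonneg (sq_nonneg _))).1 h1

/-- Essentially bounded measurable coefficients. -/
structure BoundedCoeff (h : ℝ → ℝ) (M : ℝ) : Prop where
  meas : AEStronglyMeasurable h volume
  bound : ∀ᵐ x, |h x| ≤ M
  nonneg : 0 ≤ M

theorem ae_fst {p : ℝ → Prop} (h : ∀ᵐ x, p x) : ∀ᵐ z ∂(spaceTime T), p z.1 :=
  Measure.quasiMeasurePreserving_fst.ae h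

theorem BoundedCoeff.integrable_mul {h : ℝ → ℝ} {M : ℝ} (hh : BoundedCoeff h M)
    {f : ℝ × AddCircle T → ℝ} (hf : Integrable f (spaceTime T)) :
    Integrable (fun p => h p.1 * f p) (spaceTime T) :=
  hf.bdd_mul (c := M) hh.meas.comp_fst (ae_fst (p := fun x => ‖h x‖ ≤ M) hh.bound)

theorem integrable_of_abs_le (hN : RegularCoeff N) {u v : RealL2 T} (hu : MemH N u)
    (hv : MemH N v) {f : ℝ × AddCircle T → ℝ} (hf : AEStronglyMeasurable f (spaceTime T))
    (h : ∀ p, |f p| ≤ u p ^ 4 + v p ^ 4) : Integrable f (spaceTime T) :=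
  Integrable.mono' ((integrable_pow_four hN hu).add (integrable_pow_four hN hv)) hf
    (Eventually.of_forall h)

theorem abs_cube_mul_le (a b : ℝ) : |a ^ 3 * b| ≤ a ^ 4 + b ^ 4 := by
  rw [abs_le]
  constructor <;> nlinarith [sq_nonneg (a ^ 2 - b ^ 2), sq_nonneg (a - b), sq_nonneg (a + b),
    sq_nonneg (a ^ 2 + a * b), sq_nonneg (a ^ 2 - a * b), sq_nonneg (a * b), sq_nonneg (a^2),
    sq_nonneg (b ^ 2)]

theorem integrable_cube_mul (hN : RegularCoeff N) {u v : RealL2 T} (hu : MemH N u)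
    (hv : MemH N v) : Integrable (fun p => u p ^ 3 * v p) (spaceTime T) :=
  integrable_of_abs_le hN hu hv
    (((Lp.aestronglyMeasurable u).pow 3).mul (Lp.aestronglyMeasurable v)) fun _ =>
    abs_cube_mul_le _ _

theorem integrable_sq_mul_sq (hN : RegularCoeff N) {u v : RealL2 T} (hu : MemH N u)
    (hv : MemH N v) : Integrable (fun p => u p ^ 2 * v p ^ 2) (spaceTime T) :=
  integrable_of_abs_le hN hu hv
    (((Lp.aestronglyMeasurable u).pow 2).mul ((Lp.aestronglyMeasurable v).pow 2)) fun p => by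
    rw [abs_of_nonneg (by positivity)]
    nlinarith [sq_nonneg (u p ^ 2 - v p ^ 2), sq_nonneg (u p ^ 2), sq_nonneg (v p ^ 2)]

theorem abs_quartic_le (hN : RegularCoeff N) {h : ℝ → ℝ} {M : ℝ} (hh : BoundedCoeff h M)
    {u : RealL2 T} (hu : MemH N u) : |quartic h u| ≤ M * quarticOn u Set.univ := by
  rw [quarticOn_univ, ← integral_const_mul, ← Real.norm_eq_abs, quartic]
  refine norm_integral_le_of_norm_le ((integrable_pow_four hN hu).const_mul M) ?_
  filter_upwards [ae_fst (p := fun x => |h x| ≤ M) hh.bound] with p hp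
  rw [Real.norm_eq_abs, abs_mul, abs_of_nonneg (by positivity : (0 : ℝ) ≤ u p ^ 4)]
  gcongr

/-- The expansion of the quartic functional along a line. -/
theorem quartic_add_smul (hN : RegularCoeff N) {h : ℝ → ℝ} {M : ℝ} (hh : BoundedCoeff h M)
    {u v : RealL2 T} (hu : MemH N u) (hv : MemH N v) (s : ℝ) :
    quartic h (u + s • v) = quartic h u + 4 * s * (∫ p, h p.1 * (u p ^ 3 * v p) ∂(spaceTime T)) +
      6 * s ^ 2 * (∫ p, h p.1 * (u p ^ 2 * v p ^ 2) ∂(spaceTime T)) +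
      4 * s ^ 3 * (∫ p, h p.1 * (v p ^ 3 * u p) ∂(spaceTime T)) + s ^ 4 * quartic h v := by
  have i0 := hh.integrable_mul (integrable_pow_four hN hu)
  have i1 := (hh.integrable_mul (integrable_cube_mul hN hu hv)).const_mul (4 * s)
  have i2 := (hh.integrable_mul (integrable_sq_mul_sq hN hu hv)).const_mul (6 * s ^ 2)
  have i3 := (hh.integrable_mul (integrable_cube_mul hN hv hu)).const_mul (4 * s ^ 3)
  have i4 := (hh.integrable_mul (integrable_pow_four hN hv)).const_mul (s ^ 4)
  have i01 := i0.add i1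
  have i02 := i01.add i2
  have i03 := i02.add i3
  simp only [quartic]
  rw [← integral_const_mul, ← integral_const_mul, ← integral_const_mul, ← integral_const_mul,
    ← integral_add' i0 i1, ← integral_add' i01 i2, ← integral_add' i02 i3,
    ← integral_add' i03 i4]
  refine integral_congr_ae ?_
  filter_upwards [Lp.coeFn_add u (s • v), Lp.coeFn_smul s v] with p h1 h2
  rw [h1, Pi.add_apply, h2, Pi.smul_apply, smul_eq_mul]
  simp only [Pi.add_apply]
  ring

theorem quartic_smul (h : ℝ → ℝ) (s : ℝ) (u : RealL2 T) :
    quartic h (s • u) = s ^ 4 * quartic h u := by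
  rw [quartic, quartic, ← integral_const_mul]
  refine integral_congr_ae ?_
  filter_upwards [Lp.coeFn_smul s u] with p h1
  rw [h1, Pi.smul_apply, smul_eq_mul]
  ring

theorem tendsto_quarticOn_compl (hN : RegularCoeff N) {u : RealL2 T} (hu : MemH N u) :
    Tendsto (fun ρ : ℝ => quarticOn u (Set.Icc (-ρ) ρ)ᶜ) atTop (𝓝 0) := by
  have hm : ∀ ρ : ℝ, MeasurableSet (Set.Icc (-ρ) ρ ×ˢ (Set.univ : Set (AddCircle T))) := fun ρ =>
    measurableSet_Icc.prod MeasurableSet.univ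
  have hcov : AECover (spaceTime T) atTop
      fun ρ : ℝ => Set.Icc (-ρ) ρ ×ˢ (Set.univ : Set (AddCircle T)) := by
    refine ⟨Eventually.of_forall fun p => ?_, hm⟩
    filter_upwards [eventually_ge_atTop |p.1|] with ρ hρ
    exact ⟨abs_le.1 hρ, Set.mem_univ _⟩
  have h1 := hcov.integral_tendsto_of_countably_generated (integrable_pow_four hN hu)
  have h2 := h1.const_sub (∫ p, u p ^ 4 ∂(spaceTime T))
  rw [sub_self] at h2
  refine h2.congr fun ρ => ?_
  rw [← integral_add_compl (hm ρ) (integrable_pow_four hN hu), add_sub_cancel_left, quarticOn]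
  congr 2
  ext p
  simp

theorem WeakNull.tendsto_quarticOn (hN : RegularCoeff N) {ι : Type*} {l : Filter ι} {R : ℝ}
    {r : ι → RealL2 T} (hr : WeakNull N l R r) {ρ : ℝ} (hρ : 0 < ρ) :
    Tendsto (fun n => quarticOn (r n) (Set.Icc (-ρ) ρ)) l (𝓝 0) := by
  have h1 := (ENNReal.tendsto_toReal ENNReal.zero_ne_top).comp (hr.tendsto_quart hN hρ)
  rw [ENNReal.toReal_zero] at h1
  exact h1.congr fun n => (quarticOn_eq_toReal hN (hr.mem n) _).symm

theorem WeakNull.exists_quarticOn_le (hN : RegularCoeff N) {ι : Type*} {l : Filter ι} {R : ℝ}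
    {r : ι → RealL2 T} (hr : WeakNull N l R r) :
    ∃ A : ℝ, 0 ≤ A ∧ ∀ n, quarticOn (r n) Set.univ ≤ A := by
  obtain ⟨C, hC0, hC⟩ := Breather.exists_quarticOn_le hN
  refine ⟨C * R ^ 2, by positivity, fun n => (hC _ (hr.mem n)).trans ?_⟩
  have := normSq_nonneg hN (r n)
  have := hr.bound n
  gcongr

/-- The integral over space-time of a function dominated differently on `s × 𝕋` and its complement. -/
theorem integral_le_of_le_on {f g₁ g₂ : ℝ × AddCircle T → ℝ} {s : Set ℝ} (hs : MeasurableSet s)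
    (hf : Integrable f (spaceTime T)) (hg₁ : Integrable g₁ (spaceTime T))
    (hg₂ : Integrable g₂ (spaceTime T)) (h₁ : ∀ᵐ p ∂(spaceTime T), p.1 ∈ s → f p ≤ g₁ p)
    (h₂ : ∀ᵐ p ∂(spaceTime T), p.1 ∉ s → f p ≤ g₂ p) :
    ∫ p, f p ∂(spaceTime T) ≤ ∫ p in s ×ˢ Set.univ, g₁ p ∂(spaceTime T) +
      ∫ p in sᶜ ×ˢ Set.univ, g₂ p ∂(spaceTime T) := by
  have hm : MeasurableSet (s ×ˢ (Set.univ : Set (AddCircle T))) := hs.prod MeasurableSet.univ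
  have hc : (s ×ˢ (Set.univ : Set (AddCircle T)))ᶜ = sᶜ ×ˢ Set.univ := by ext p; simp
  rw [← integral_add_compl hm hf, hc]
  refine add_le_add (setIntegral_mono_on_ae hf.integrableOn hg₁.integrableOn hm ?_)
    (setIntegral_mono_on_ae hf.integrableOn hg₂.integrableOn (hc ▸ hm.compl) ?_)
  · filter_upwards [h₁] with p hp hps
    exact hp hps.1
  · filter_upwards [h₂] with p hp hps
    exact hp hps.1

/-- The Brezis–Lieb splitting of the quartic functional. -/
theorem WeakNull.tendsto_quartic_add (hN : RegularCoeff N) {ι : Type*} {l : Filter ι} {R : ℝ}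
    {r : ι → RealL2 T} (hr : WeakNull N l R r) {h : ℝ → ℝ} {M : ℝ} (hh : BoundedCoeff h M)
    {u : RealL2 T} (hu : MemH N u) :
    Tendsto (fun n => quartic h (u + r n) - quartic h u - quartic h (r n)) l (𝓝 0) := by
  obtain ⟨A, hA0, hA⟩ := hr.exists_quarticOn_le hN
  have hM := hh.nonneg
  have hU := quarticOn_nonneg u Set.univ
  rw [Metric.tendsto_nhds]
  intro ε hε
  obtain ⟨θ, hθ, hθε⟩ : ∃ θ, 0 < θ ∧ (M * (quarticOn u Set.univ + A)) * θ ≤ ε / 3 :=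
    ⟨ε / 3 / (M * (quarticOn u Set.univ + A) + 1), by positivity,
      mul_div_mul_add_one_le (by positivity) (by positivity)⟩
  obtain ⟨C, hC0, hC⟩ := exists_abs_add_pow_four_sub_le hθ
  obtain ⟨θ', hθ', hθε'⟩ : ∃ θ', 0 < θ' ∧ (M * C) * θ' ≤ ε / 4 :=
    ⟨ε / 4 / (M * C + 1), by positivity, mul_div_mul_add_one_le (by positivity) (by positivity)⟩
  obtain ⟨ρ, hρ, hρ0⟩ := (((tendsto_quarticOn_compl hN hu).eventually_lt_const hθ').and
    (eventually_gt_atTop 0)).exists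
  filter_upwards [(hr.tendsto_quarticOn hN hρ0).eventually_lt_const hθ'] with n hn
  rw [Real.dist_eq, sub_zero]
  have hur := (memH_add hN hu (hr.mem n)).1
  have iu := integrable_pow_four hN hu
  have ir := integrable_pow_four hN (hr.mem n)
  have iur := integrable_pow_four hN hur
  have e1 : quartic h (u + r n) - quartic h u - quartic h (r n) =
      ∫ p, h p.1 * ((u + r n : RealL2 T) p ^ 4 - u p ^ 4 - r n p ^ 4) ∂(spaceTime T) := by
    simp only [quartic, mul_sub]
    have i1 := (hh.integrable_mul iur).sub (hh.integrable_mul iu)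
    rw [← integral_sub' (hh.integrable_mul iur) (hh.integrable_mul iu),
      ← integral_sub' i1 (hh.integrable_mul ir)]
    rfl
  have hpt : ∀ᵐ p ∂(spaceTime T), |h p.1 * ((u + r n : RealL2 T) p ^ 4 - u p ^ 4 - r n p ^ 4)| ≤
      M * |(u p + r n p) ^ 4 - u p ^ 4 - r n p ^ 4| := by
    filter_upwards [ae_fst (p := fun x => |h x| ≤ M) hh.bound, Lp.coeFn_add u (r n)] with p h1 h2
    rw [h2, Pi.add_apply, abs_mul]
    gcongr
  rw [e1]
  have iabs := (hh.integrable_mul ((iur.sub iu).sub ir)).abs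
  simp only [Pi.sub_apply] at iabs
  refine (abs_integral_le_integral_abs).trans_lt ?_
  -- Inside [-ρ, ρ] the remainder r n is small in L⁴, outside it u is. The elementary inequality is
  -- used with exchanged roles in the two regions, so that the large constant C always multiplies
  -- the small quantity.
  have h3 := integral_le_of_le_on (s := Set.Icc (-ρ) ρ) measurableSet_Icc iabs
    (((iu.const_mul θ).add (ir.const_mul C)).const_mul M)
    (((ir.const_mul θ).add (iu.const_mul C)).const_mul M) (by
      filter_upwards [hpt] with p hp _
      exact hp.trans (mul_le_mul_of_nonneg_left (hC _ _) hM)) (by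
      filter_upwards [hpt] with p hp _
      refine hp.trans (mul_le_mul_of_nonneg_left ?_ hM)
      have := hC (r n p) (u p)
      rwa [add_comm (r n p), sub_right_comm] at this)
  simp only [Pi.add_apply] at h3
  rw [integral_const_mul, integral_const_mul, integral_add (iu.const_mul θ).integrableOn
    (ir.const_mul C).integrableOn, integral_add (ir.const_mul θ).integrableOn
    (iu.const_mul C).integrableOn, integral_const_mul, integral_const_mul, integral_const_mul,
    integral_const_mul] at h3
  change _ ≤ M * (θ * quarticOn u (Set.Icc (-ρ) ρ) + C * quarticOn (r n) (Set.Icc (-ρ) ρ)) +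
    M * (θ * quarticOn (r n) (Set.Icc (-ρ) ρ)ᶜ + C * quarticOn u (Set.Icc (-ρ) ρ)ᶜ) at h3
  refine h3.trans_lt ?_
  calc M * (θ * quarticOn u (Set.Icc (-ρ) ρ) + C * quarticOn (r n) (Set.Icc (-ρ) ρ)) +
        M * (θ * quarticOn (r n) (Set.Icc (-ρ) ρ)ᶜ + C * quarticOn u (Set.Icc (-ρ) ρ)ᶜ)
      ≤ M * (θ * quarticOn u Set.univ + C * θ') + M * (θ * A + C * θ') := by
        have := quarticOn_le_univ hN hu (Set.Icc (-ρ) ρ)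
        have := (quarticOn_le_univ hN (hr.mem n) (Set.Icc (-ρ) ρ)ᶜ).trans (hA n)
        gcongr
    _ = (M * (quarticOn u Set.univ + A)) * θ + 2 * ((M * C) * θ') := by ring
    _ < ε := by linarith

end Torus

/-! ### Maximizers of the quotient of the quartic and the quadratic functional -/

section Torus

variable {T : ℝ} [Fact (0 < T)] {N : SignedMeasure (AddCircle T)}

/-- Essentially bounded coefficients of the quadratic form, uniformly bounded from below. -/
structure CoercivePotential (W : ℤ → Lp ℝ ⊤ (volume : Measure ℝ)) (C δ : ℝ) : Prop where
  bounded : CoeffBounded W C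
  one_le : 1 ≤ C
  pos : 0 < δ
  le_one : δ ≤ 1
  lower : ∀ k, ∀ᵐ x, δ ≤ W k x

theorem form_add_smul (hN : RegularCoeff N) {W : ℤ → Lp ℝ ⊤ (volume : Measure ℝ)} {C : ℝ}
    (hW : CoeffBounded W C) (hC : 1 ≤ C) {u v : RealL2 T} (hu : MemH N u) (hv : MemH N v) (s : ℝ) :
    form N W (u + s • v) (u + s • v) =
      form N W u u + 2 * s * form N W u v + s ^ 2 * form N W v v := by
  have h := formB_apply hN hW hC (⟨u, hu⟩ + s • ⟨v, hv⟩) (⟨u, hu⟩ + s • ⟨v, hv⟩)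
  simp only [map_add, map_smul, LinearMap.add_apply, LinearMap.smul_apply, formB_apply,
    smul_eq_mul] at h
  have e : ((⟨u, hu⟩ + s • ⟨v, hv⟩ : HSpace hN) : RealL2 T) = u + s • v := rfl
  rw [e] at h
  rw [← h, form_comm W v u]
  ring

theorem form_smul (hN : RegularCoeff N) {W : ℤ → Lp ℝ ⊤ (volume : Measure ℝ)} {C : ℝ}
    (hW : CoeffBounded W C) (hC : 1 ≤ C) {u : RealL2 T} (hu : MemH N u) (s : ℝ) :
    form N W (s • u) (s • u) = s ^ 2 * form N W u u := by
  have h := formB_apply hN hW hC (s • ⟨u, hu⟩) (s • ⟨u, hu⟩)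
  simp only [map_smul, LinearMap.smul_apply, formB_apply, smul_eq_mul] at h
  have e : ((s • ⟨u, hu⟩ : HSpace hN) : RealL2 T) = s • u := rfl
  rw [e] at h
  rw [← h]
  ring

theorem CoercivePotential.form_nonneg (hN : RegularCoeff N)
    {W : ℤ → Lp ℝ ⊤ (volume : Measure ℝ)} {C δ : ℝ} (hW : CoercivePotential W C δ) {u : RealL2 T}
    (hu : MemH N u) : 0 ≤ form N W u u :=
  (mul_nonneg hW.pos.le (normSq_nonneg hN u)).trans
    (le_form hN hW.bounded hW.one_le hW.le_one hW.lower hu)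

theorem normSq_pos (hN : RegularCoeff N) {u : RealL2 T} (hu : MemH N u) (h : u ≠ 0) :
    0 < normSq N u := by
  obtain ⟨C, hC0, hC⟩ := exists_norm_sq_le hN
  refine (normSq_nonneg hN u).lt_of_ne' fun h0 => h ?_
  have h1 := hC u hu
  rw [h0, mul_zero] at h1
  exact norm_eq_zero.1 (pow_eq_zero_iff two_ne_zero |>.1 (le_antisymm h1 (sq_nonneg _)))

theorem CoercivePotential.form_pos (hN : RegularCoeff N)
    {W : ℤ → Lp ℝ ⊤ (volume : Measure ℝ)} {C δ : ℝ} (hW : CoercivePotential W C δ) {u : RealL2 T}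
    (hu : MemH N u) (h : u ≠ 0) : 0 < form N W u u :=
  (mul_pos hW.pos (normSq_pos hN hu h)).trans_le
    (le_form hN hW.bounded hW.one_le hW.le_one hW.lower hu)

/-- `M` bounds the quotient of the quartic functional and the squared quadratic form. -/
def IsQuotientBound (N : SignedMeasure (AddCircle T)) (W : ℤ → Lp ℝ ⊤ (volume : Measure ℝ))
    (h : ℝ → ℝ) (M : ℝ) : Prop :=
  ∀ v : RealL2 T, MemH N v → quartic h v ≤ M * form N W v v ^ 2

/-- The value `M` of the quotient is attained at `w`. -/
structure IsMaximizer (N : SignedMeasure (AddCircle T)) (W : ℤ → Lp ℝ ⊤ (volume : Measure ℝ))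
    (h : ℝ → ℝ) (M : ℝ) (w : RealL2 T) : Prop where
  mem : MemH N w
  ne_zero : w ≠ 0
  eq : quartic h w = M * form N W w w ^ 2

/-- A nonzero weak limit of a normalized maximizing sequence is a maximizer. -/
theorem isMaximizer_of_weakNull (hN : RegularCoeff N) {W : ℤ → Lp ℝ ⊤ (volume : Measure ℝ)}
    {C δ : ℝ} (hW : CoercivePotential W C δ) {h : ℝ → ℝ} {A : ℝ} (hh : BoundedCoeff h A) {M : ℝ}
    (hM0 : 0 < M) (hM : IsQuotientBound N W h M) {ι : Type*} {l : Filter ι} [l.NeBot]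
    {u : RealL2 T} (hu : MemH N u) (hu0 : u ≠ 0) {R : ℝ} {r : ι → RealL2 T}
    (hr : WeakNull N l R r)
    (hform : Tendsto (fun n => form N W (u + r n) (u + r n)) l (𝓝 1))
    (hquart : Tendsto (fun n => quartic h (u + r n)) l (𝓝 M)) : IsMaximizer N W h M u := by
  refine ⟨hu, hu0, ?_⟩
  have hq := hW.form_pos hN hu hu0
  have h1 : Tendsto (fun n => form N W (r n) (r n)) l (𝓝 (1 - form N W u u)) := by
    have h2 := hr.tendsto_form hN hW.bounded hW.one_le hu
    have h3 := (hform.sub_const (form N W u u)).sub (h2.const_mul 2)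
    rw [mul_zero, sub_zero] at h3
    refine h3.congr fun n => ?_
    have := form_add_smul hN hW.bounded hW.one_le hu (hr.mem n) 1
    rw [one_smul] at this
    rw [this]
    ring
  have h2 : Tendsto (fun n => quartic h (r n)) l (𝓝 (M - quartic h u)) := by
    have h3 := (hquart.sub_const (quartic h u)).sub (hr.tendsto_quartic_add hN hh hu)
    rw [sub_zero] at h3
    exact h3.congr fun n => by ring
  have h3 : 0 ≤ 1 - form N W u u :=
    ge_of_tendsto h1 (Eventually.of_forall fun n => hW.form_nonneg hN (hr.mem n))
  have h4 : M - quartic h u ≤ M * (1 - form N W u u) ^ 2 :=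
    le_of_tendsto_of_tendsto' h2 ((h1.pow 2).const_mul M) fun n => hM _ (hr.mem n)
  have h5 := hM u hu
  -- With q = ⟨u, u⟩, the bounds on u and on the remainder add up to M ≤ M (q² + (1 - q)²), which
  -- fails for 0 < q < 1.
  have h6 : 1 ≤ form N W u u := by
    by_contra hlt
    push Not at hlt
    nlinarith [mul_pos (mul_pos hM0 hq) (sub_pos.2 hlt)]
  have h7 : form N W u u = 1 := by linarith
  rw [h7] at h4 h5 ⊢
  linarith

/-- A polynomial that is nonnegative and vanishes at zero has no linear term. -/
theorem linear_coeff_eq_zero {a b c d : ℝ}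
    (h : ∀ s : ℝ, 0 ≤ a * s + b * s ^ 2 + c * s ^ 3 + d * s ^ 4) : a = 0 := by
  have h1 : HasDerivAt (fun s : ℝ => a * s + b * s ^ 2 + c * s ^ 3 + d * s ^ 4) a 0 := by
    have := ((((hasDerivAt_id (0 : ℝ)).const_mul a).add ((hasDerivAt_pow 2 (0 : ℝ)).const_mul b)).add
      ((hasDerivAt_pow 3 (0 : ℝ)).const_mul c)).add ((hasDerivAt_pow 4 (0 : ℝ)).const_mul d)
    refine (this.congr_deriv (by simp)).congr_of_eventuallyEq (Eventually.of_forall fun s => ?_)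
    simp
  refine IsLocalMin.hasDerivAt_eq_zero (Eventually.of_forall fun s => ?_) h1
  have := h s
  simpa using this

/-- Taking s to be the squared norm of v makes both terms of second order in v, since the integral
of v⁴ is bounded by a multiple of s². -/
theorem abs_integral_sq_mul_sq_le (hN : RegularCoeff N) {h : ℝ → ℝ} {A : ℝ}
    (hh : BoundedCoeff h A) {u v : RealL2 T} (hu : MemH N u) (hv : MemH N v) {s : ℝ} (hs : 0 < s) :
    |∫ p, h p.1 * (u p ^ 2 * v p ^ 2) ∂(spaceTime T)| ≤
      A * (s / 2 * quarticOn u Set.univ + s⁻¹ / 2 * quarticOn v Set.univ) := by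
  have iu := (integrable_pow_four hN hu).const_mul (s / 2)
  have iv := (integrable_pow_four hN hv).const_mul (s⁻¹ / 2)
  rw [quarticOn_univ, quarticOn_univ, ← integral_const_mul, ← integral_const_mul,
    ← integral_add' iu iv, ← integral_const_mul, ← Real.norm_eq_abs]
  refine norm_integral_le_of_norm_le ((iu.add iv).const_mul A) ?_
  filter_upwards [ae_fst (p := fun x => |h x| ≤ A) hh.bound] with p hp
  rw [Real.norm_eq_abs, abs_mul, abs_of_nonneg (by positivity : (0 : ℝ) ≤ u p ^ 2 * v p ^ 2)]
  exact mul_le_mul hp (sq_mul_sq_le hs) (by positivity) hh.nonneg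

theorem abs_integral_cube_mul_le (hN : RegularCoeff N) {h : ℝ → ℝ} {A : ℝ}
    (hh : BoundedCoeff h A) {u v : RealL2 T} (hu : MemH N u) (hv : MemH N v) {s : ℝ} (hs : 0 < s) :
    |∫ p, h p.1 * (v p ^ 3 * u p) ∂(spaceTime T)| ≤
      A * (s / 2 * quarticOn u Set.univ + (s⁻¹ / 2 + 1) * quarticOn v Set.univ) := by
  have iu := (integrable_pow_four hN hu).const_mul (s / 2)
  have iv := (integrable_pow_four hN hv).const_mul (s⁻¹ / 2 + 1)
  rw [quarticOn_univ, quarticOn_univ, ← integral_const_mul, ← integral_const_mul,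
    ← integral_add' iu iv, ← integral_const_mul, ← Real.norm_eq_abs]
  refine norm_integral_le_of_norm_le ((iu.add iv).const_mul A) ?_
  filter_upwards [ae_fst (p := fun x => |h x| ≤ A) hh.bound] with p hp
  rw [Real.norm_eq_abs, abs_mul]
  refine mul_le_mul hp ?_ (abs_nonneg _) hh.nonneg
  have h1 := sq_mul_sq_le (a := u p) (b := v p) hs
  have h2 : |v p ^ 3 * u p| ≤ u p ^ 2 * v p ^ 2 + v p ^ 4 := by
    rw [abs_le]
    constructor <;> nlinarith [sq_nonneg (v p ^ 2 + v p * u p), sq_nonneg (v p ^ 2 - v p * u p),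
      sq_nonneg (v p * u p), sq_nonneg (v p ^ 2)]
  simp only [Pi.add_apply]
  linarith

/-! ### From maximizers of the quotient to critical points and ground states -/

theorem energy_eq {c : ℝ} {𝒢 : ℝ → SignedMeasure (AddCircle T)}
    {W : ℤ → Lp ℝ ⊤ (volume : Measure ℝ)} (hW : ∀ k, W k =ᵐ[volume] potential c 𝒢 k) {h : ℝ → ℝ}
    {u : RealL2 T} (hu : MemH N u) :
    energy c 𝒢 N h u = 1 / 2 * form N W u u - 1 / 4 * quartic h u := by
  rw [energy, weightedInner_eq_form hW hu hu]
  rfl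

/-- The first variation of the quotient vanishes at a maximizer. -/
theorem IsMaximizer.integral_cube_mul_eq (hN : RegularCoeff N)
    {W : ℤ → Lp ℝ ⊤ (volume : Measure ℝ)} {C δ : ℝ} (hW : CoercivePotential W C δ) {h : ℝ → ℝ}
    {A : ℝ} (hh : BoundedCoeff h A) {M : ℝ} (hM : IsQuotientBound N W h M) {u : RealL2 T}
    (hu : IsMaximizer N W h M u) (hu1 : M * form N W u u = 1) {v : RealL2 T} (hv : MemH N v) :
    ∫ p, h p.1 * (u p ^ 3 * v p) ∂(spaceTime T) = form N W u v := by
  -- The polynomial is M ⟨u + sv, u + sv⟩² - ∫ h (u + sv)⁴. It is nonnegative because M bounds the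
  -- quotient and vanishes at s = 0 because u attains M; its linear coefficient is the first
  -- variation.
  have key := linear_coeff_eq_zero (a := 4 * (M * form N W u u) * form N W u v -
      4 * ∫ p, h p.1 * (u p ^ 3 * v p) ∂(spaceTime T))
    (b := M * (4 * form N W u v ^ 2 + 2 * form N W u u * form N W v v) -
      6 * ∫ p, h p.1 * (u p ^ 2 * v p ^ 2) ∂(spaceTime T))
    (c := M * (4 * form N W u v * form N W v v) - 4 * ∫ p, h p.1 * (v p ^ 3 * u p) ∂(spaceTime T))
    (d := M * form N W v v ^ 2 - quartic h v) (fun s => by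
      have h1 := hM _ (memH_add hN hu.mem (memH_smul s hv).1).1
      rw [quartic_add_smul hN hh hu.mem hv, form_add_smul hN hW.bounded hW.one_le hu.mem hv,
        hu.eq] at h1
      nlinarith)
  rw [hu1] at key
  linarith

/-- The variable f stands both for the linear term of the quadratic form and for that of the quartic
functional. These cancel, and only the higher-order terms have to be estimated. -/
theorem abs_remainder_le {q f F b I₁ I₂ B c d e : ℝ} (hF : |F| ≤ c) (h₁ : |I₁| ≤ d)
    (h₂ : |I₂| ≤ d + e) (hB : |B| ≤ e) :
    |1 / 2 * (q + 2 * 1 * f + 1 ^ 2 * F) -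
        1 / 4 * (b + 4 * 1 * f + 6 * 1 ^ 2 * I₁ + 4 * 1 ^ 3 * I₂ + 1 ^ 4 * B) -
      (1 / 2 * q - 1 / 4 * b)| ≤ c + 3 * d + 2 * e := by
  obtain ⟨hF1, hF2⟩ := abs_le.1 hF
  obtain ⟨h11, h12⟩ := abs_le.1 h₁
  obtain ⟨h21, h22⟩ := abs_le.1 h₂
  obtain ⟨hB1, hB2⟩ := abs_le.1 hB
  rw [abs_le]
  constructor <;> linarith

/-- The first variation cancels the linear terms of J(u + v) - J(u). The other terms are at most K
‖v‖² when ‖v‖ ≤ 1, hence at most ε ‖v‖ when also ‖v‖ ≤ ε / (K + 1). -/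
theorem IsMaximizer.isCriticalPoint (hN : RegularCoeff N) {c : ℝ}
    {𝒢 : ℝ → SignedMeasure (AddCircle T)} {W : ℤ → Lp ℝ ⊤ (volume : Measure ℝ)} {C δ : ℝ}
    (hW : CoercivePotential W C δ) (hWc : ∀ k, W k =ᵐ[volume] potential c 𝒢 k) {h : ℝ → ℝ} {A : ℝ}
    (hh : BoundedCoeff h A) {M : ℝ} (hM : IsQuotientBound N W h M) {u : RealL2 T}
    (hu : IsMaximizer N W h M u) (hu1 : M * form N W u u = 1) : IsCriticalPoint c 𝒢 N h u := by
  refine ⟨hu.mem, fun ε hε => ?_⟩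
  obtain ⟨D, hD0, hD⟩ := exists_quarticOn_le hN
  obtain ⟨U, hU⟩ : ∃ U, U = quarticOn u Set.univ := ⟨_, rfl⟩
  have hU0 : 0 ≤ U := hU ▸ quarticOn_nonneg u _
  have hA := hh.nonneg
  have hC := hW.one_le
  obtain ⟨K, hK⟩ : ∃ K, K = C + 3 * (A * (U + D)) + 2 * (A * D) := ⟨_, rfl⟩
  have hK0 : 0 ≤ K := by rw [hK]; positivity
  refine ⟨min 1 (ε / (K + 1)), by positivity, fun v hv hvδ => ?_⟩
  rw [normH_eq hv] at hvδ ⊢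
  by_cases hv0 : v = 0
  · rw [hv0, add_zero, sub_self, abs_zero]
    positivity
  have hs := normSq_pos hN hv hv0
  obtain ⟨s, hsdef⟩ : ∃ s, s = normSq N v := ⟨_, rfl⟩
  rw [← hsdef] at hs hvδ ⊢
  have hroot1 : √s ≤ 1 := hvδ.trans (min_le_left _ _)
  have hroot2 := hvδ.trans (min_le_right _ _)
  have hs1 : s ≤ 1 := by
    rw [← Real.sq_sqrt hs.le]
    exact pow_le_one₀ (Real.sqrt_nonneg s) hroot1
  have hVD : quarticOn v Set.univ ≤ D * s ^ 2 := hsdef ▸ hD v hv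
  have hV0 := quarticOn_nonneg v Set.univ
  have huv := (memH_add hN hu.mem hv).1
  have e1 := quartic_add_smul hN hh hu.mem hv 1
  have e2 := form_add_smul hN hW.bounded hW.one_le hu.mem hv 1
  rw [one_smul] at e1 e2
  rw [energy_eq hWc huv, energy_eq hWc hu.mem, e1, e2,
    hu.integral_cube_mul_eq hN hW hh hM hu1 hv]
  have b1 : |form N W v v| ≤ C * s := by
    rw [abs_of_nonneg (hW.form_nonneg hN hv), hsdef]
    exact form_le hN hW.bounded hW.one_le hv
  have b2 := abs_integral_sq_mul_sq_le hN hh hu.mem hv hs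
  have b3 := abs_integral_cube_mul_le hN hh hu.mem hv hs
  have b4 := abs_quartic_le hN hh hv
  rw [← hU] at b2 b3
  have t1 : s⁻¹ * (D * s ^ 2) = D * s := by field_simp
  have t2 : D * s ^ 2 ≤ D * s := by nlinarith
  have t3 : s⁻¹ * quarticOn v Set.univ ≤ D * s :=
    t1 ▸ mul_le_mul_of_nonneg_left hVD (inv_nonneg.2 hs.le)
  have b2' : |∫ p, h p.1 * (u p ^ 2 * v p ^ 2) ∂(spaceTime T)| ≤ A * (U + D) * s := by
    refine b2.trans ?_
    rw [mul_assoc]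
    refine mul_le_mul_of_nonneg_left ?_ hA
    nlinarith
  have b3' : |∫ p, h p.1 * (v p ^ 3 * u p) ∂(spaceTime T)| ≤ A * (U + D) * s + A * D * s := by
    refine b3.trans ?_
    rw [← add_mul, ← mul_add, mul_assoc]
    refine mul_le_mul_of_nonneg_left ?_ hA
    nlinarith
  have b4' : |quartic h v| ≤ A * D * s := by
    refine b4.trans ?_
    rw [mul_assoc]
    exact mul_le_mul_of_nonneg_left (hVD.trans t2) hA
  obtain ⟨I1, hI1⟩ : ∃ I, I = ∫ p, h p.1 * (u p ^ 2 * v p ^ 2) ∂(spaceTime T) := ⟨_, rfl⟩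
  obtain ⟨I2, hI2⟩ : ∃ I, I = ∫ p, h p.1 * (v p ^ 3 * u p) ∂(spaceTime T) := ⟨_, rfl⟩
  rw [← hI1] at b2' ⊢
  rw [← hI2] at b3' ⊢
  have hfin : K * s ≤ ε * √s := by
    calc K * s = √s * K * √s := by
          conv_lhs => rw [← Real.mul_self_sqrt hs.le]
          ring
      _ ≤ ε * √s := by
          refine mul_le_mul_of_nonneg_right ?_ (Real.sqrt_nonneg s)
          rw [le_div_iff₀ (by positivity)] at hroot2
          nlinarith [Real.sqrt_nonneg s]
  refine le_trans ?_ hfin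
  have hKs : K * s = C * s + 3 * (A * (U + D) * s) + 2 * (A * D * s) := by
    rw [hK]
    ring
  rw [hKs]
  exact abs_remainder_le b1 b2' b3' b4'

/-- A nonzero critical point lies on the Nehari manifold. -/
theorem IsCriticalPoint.form_eq_quartic (hN : RegularCoeff N) {c : ℝ}
    {𝒢 : ℝ → SignedMeasure (AddCircle T)} {W : ℤ → Lp ℝ ⊤ (volume : Measure ℝ)} {C : ℝ}
    (hW : CoeffBounded W C) (hC : 1 ≤ C) (hWc : ∀ k, W k =ᵐ[volume] potential c 𝒢 k) {h : ℝ → ℝ}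
    {u : RealL2 T} (hu : IsCriticalPoint c 𝒢 N h u) : form N W u u = quartic h u := by
  obtain ⟨hmem, hcrit⟩ := hu
  have hn : ∀ t : ℝ, normH N (t • u) = |t| * normH N u := fun t => by
    rw [normH_eq hmem, normH_eq (memH_smul t hmem).1]
    have h1 : normSq N (t • u) = t ^ 2 * normSq N u := by
      rw [normSq, normSq, ← tsum_mul_left]
      refine tsum_congr fun k => ?_
      rw [normTerm, normTerm, (memH_smul t hmem).2 k k.2, map_smul, norm_smul, norm_smul,
        mul_pow, mul_pow, Real.norm_eq_abs, sq_abs]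
      ring
    rw [h1, Real.sqrt_mul (sq_nonneg t), Real.sqrt_sq_eq_abs]
  -- The derivative of t ↦ J(u + tu) at 0 is computed twice: it vanishes by criticality, and it
  -- equals ⟨u, u⟩ - ∫ h u⁴ by homogeneity.
  have h1 : HasDerivAt (fun t : ℝ => energy c 𝒢 N h (u + t • u)) 0 0 := by
    rw [hasDerivAt_iff_isLittleO_nhds_zero, Asymptotics.isLittleO_iff]
    intro ε hε
    have hN0 : 0 ≤ normH N u := Real.sqrt_nonneg _
    obtain ⟨δ, hδ, hd⟩ := hcrit (ε / (normH N u + 1)) (by positivity)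
    filter_upwards [Metric.ball_mem_nhds (0 : ℝ) (show 0 < δ / (normH N u + 1) by positivity)]
      with t ht
    rw [Metric.mem_ball, dist_zero_right, Real.norm_eq_abs, lt_div_iff₀ (by positivity)] at ht
    have h2 := hd (t • u) (memH_smul t hmem).1 (by
      rw [hn]
      nlinarith [abs_nonneg t])
    rw [hn] at h2
    simp only [zero_add, zero_smul, add_zero, smul_zero, sub_zero, Real.norm_eq_abs]
    refine h2.trans ?_
    have h3 : ε / (normH N u + 1) * (|t| * normH N u) = normH N u * (ε / (normH N u + 1)) * |t| := by
      ring
    rw [h3]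
    exact mul_le_mul_of_nonneg_right (mul_div_mul_add_one_le hN0 hε.le) (abs_nonneg t)
  have h2 : HasDerivAt (fun t : ℝ => energy c 𝒢 N h (u + t • u))
      (form N W u u - quartic h u) 0 := by
    have e : ∀ t : ℝ, energy c 𝒢 N h (u + t • u) =
        1 / 2 * form N W u u * (1 + t) ^ 2 - 1 / 4 * quartic h u * (1 + t) ^ 4 := fun t => by
      have e1 : u + t • u = (1 + t) • u := by rw [add_smul, one_smul]
      rw [e1, energy_eq hWc (memH_smul (1 + t) hmem).1, form_smul hN hW hC hmem, quartic_smul]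
      ring
    simp only [e]
    have h3 : HasDerivAt (fun t : ℝ => 1 + t) 1 0 := (hasDerivAt_id (0 : ℝ)).const_add 1
    refine (((h3.pow 2).const_mul _).sub ((h3.pow 4).const_mul _)).congr_deriv ?_
    norm_num
    ring
  linarith [h1.unique h2]

/-- A maximizer of the quotient gives rise to a ground state. -/
theorem IsMaximizer.exists_isGroundState (hN : RegularCoeff N) {c : ℝ}
    {𝒢 : ℝ → SignedMeasure (AddCircle T)} {W : ℤ → Lp ℝ ⊤ (volume : Measure ℝ)} {C δ : ℝ}
    (hW : CoercivePotential W C δ) (hWc : ∀ k, W k =ᵐ[volume] potential c 𝒢 k) {h : ℝ → ℝ} {A : ℝ}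
    (hh : BoundedCoeff h A) {M : ℝ} (hM0 : 0 < M) (hM : IsQuotientBound N W h M) {w : RealL2 T}
    (hw : IsMaximizer N W h M w) : ∃ u, IsGroundState c 𝒢 N h u := by
  have hq := hW.form_pos hN hw.mem hw.ne_zero
  -- The scaling with M ⟨u, u⟩ = 1 is the one for which the Euler–Lagrange equation holds with
  -- multiplier 1.
  obtain ⟨s, hs⟩ : ∃ s, s = (√(M * form N W w w))⁻¹ := ⟨_, rfl⟩
  have hs0 : 0 < s := by rw [hs]; positivity
  have hs2 : s ^ 2 * (M * form N W w w) = 1 := by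
    rw [hs, inv_pow, Real.sq_sqrt (by positivity), inv_mul_cancel₀ (by positivity)]
  have hf := form_smul hN hW.bounded hW.one_le hw.mem s
  have hmax : IsMaximizer N W h M (s • w) := by
    refine ⟨(memH_smul s hw.mem).1, smul_ne_zero hs0.ne' hw.ne_zero, ?_⟩
    rw [quartic_smul, hf, hw.eq]
    ring
  have h1 : M * form N W (s • w) (s • w) = 1 := by
    rw [hf]
    linarith
  have hcrit := hmax.isCriticalPoint hN hW hWc hh hM h1
  refine ⟨s • w, hmax.ne_zero, hcrit, ?_⟩
  have hval : energy c 𝒢 N h (s • w) = 1 / 4 * form N W (s • w) (s • w) := by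
    rw [energy_eq hWc hmax.mem, ← hcrit.form_eq_quartic hN hW.bounded hW.one_le hWc]
    ring
  refine le_antisymm (le_iInf fun v => ?_) (iInf_le (fun v : {u : RealL2 T // u ≠ 0 ∧
    IsCriticalPoint c 𝒢 N h u} => (energy c 𝒢 N h v : EReal)) ⟨s • w, hmax.ne_zero, hcrit⟩)
  obtain ⟨v, hv0, hv⟩ := v
  have e1 := hv.form_eq_quartic hN hW.bounded hW.one_le hWc
  have e2 := hM v hv.1
  have e3 := hW.form_pos hN hv.1 hv0
  rw [EReal.coe_le_coe_iff, hval, energy_eq hWc hv.1, ← e1]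
  rw [← e1] at e2
  -- On the Nehari manifold ⟨v, v⟩ = ∫ h v⁴ ≤ M ⟨v, v⟩², which can be divided by ⟨v, v⟩ > 0.
  have e4 : 1 ≤ M * form N W v v := by
    by_contra hlt
    push Not at hlt
    nlinarith
  have e5 : form N W (s • w) (s • w) ≤ form N W v v := by
    rw [← h1] at e4
    exact le_of_mul_le_mul_left e4 hM0
  linarith

end Torus

/-! ### Maximizing sequences -/

section Torus

variable {T : ℝ} [Fact (0 < T)] {N : SignedMeasure (AddCircle T)}

theorem quartic_zero (h : ℝ → ℝ) : quartic h (0 : RealL2 T) = 0 := by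
  have := quartic_smul h 0 (0 : RealL2 T)
  rwa [smul_zero, zero_pow four_ne_zero, zero_mul] at this

/-- A normalized maximizing sequence for the quotient. -/
structure IsMaximizingSeq (N : SignedMeasure (AddCircle T))
    (W : ℤ → Lp ℝ ⊤ (volume : Measure ℝ)) (h : ℝ → ℝ) (M : ℝ) (u : ℕ → RealL2 T) : Prop where
  mem : ∀ n, MemH N (u n)
  form_eq : ∀ n, form N W (u n) (u n) = 1
  tendsto : Tendsto (fun n => quartic h (u n)) atTop (𝓝 M)

theorem CoercivePotential.normSq_le (hN : RegularCoeff N)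
    {W : ℤ → Lp ℝ ⊤ (volume : Measure ℝ)} {C δ : ℝ} (hW : CoercivePotential W C δ) {u : RealL2 T}
    (hu : MemH N u) : normSq N u ≤ form N W u u / δ := by
  rw [le_div_iff₀' hW.pos]
  exact le_form hN hW.bounded hW.one_le hW.le_one hW.lower hu

/-- The quotient is bounded by the L⁴ embedding and coercivity, and positive somewhere. Since it is
invariant under scaling, a maximizing sequence can be normalized. -/
theorem exists_isMaximizingSeq (hN : RegularCoeff N) {W : ℤ → Lp ℝ ⊤ (volume : Measure ℝ)}
    {C δ : ℝ} (hW : CoercivePotential W C δ) {h : ℝ → ℝ} {A : ℝ} (hh : BoundedCoeff h A)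
    (hpos : ∃ v : RealL2 T, MemH N v ∧ 0 < quartic h v) :
    ∃ M, 0 < M ∧ IsQuotientBound N W h M ∧ ∃ u, IsMaximizingSeq N W h M u := by
  obtain ⟨D, hD0, hD⟩ := exists_quarticOn_le hN
  obtain ⟨S, hS⟩ : ∃ S : Set ℝ,
    S = {q | ∃ v : RealL2 T, MemH N v ∧ v ≠ 0 ∧ q = quartic h v / form N W v v ^ 2} := ⟨_, rfl⟩
  have hA := hh.nonneg
  have hbdd : BddAbove S := by
    refine ⟨A * D / δ ^ 2, ?_⟩
    rw [hS]
    rintro q ⟨v, hv, hv0, rfl⟩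
    have hq := hW.form_pos hN hv hv0
    have hδ := hW.pos
    rw [div_le_iff₀ (by positivity)]
    calc quartic h v ≤ A * quarticOn v Set.univ := (le_abs_self _).trans (abs_quartic_le hN hh hv)
      _ ≤ A * (D * normSq N v ^ 2) := mul_le_mul_of_nonneg_left (hD v hv) hA
      _ ≤ A * (D * (form N W v v / δ) ^ 2) := by
          have := hW.normSq_le hN hv
          have := normSq_nonneg hN v
          gcongr
      _ = _ := by ring
  obtain ⟨v₀, hv₀, hv₀pos⟩ := hpos
  have hv₀0 : v₀ ≠ 0 := by
    rintro rfl
    rw [quartic_zero] at hv₀pos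
    exact hv₀pos.ne rfl
  have hmem : quartic h v₀ / form N W v₀ v₀ ^ 2 ∈ S := hS ▸ ⟨v₀, hv₀, hv₀0, rfl⟩
  have hM : 0 < sSup S := by
    have := hW.form_pos hN hv₀ hv₀0
    exact (div_pos hv₀pos (by positivity)).trans_le (le_csSup hbdd hmem)
  refine ⟨sSup S, hM, fun v hv => ?_, ?_⟩
  · by_cases hv0 : v = 0
    · rw [hv0, quartic_zero]
      positivity
    · have hq := hW.form_pos hN hv hv0
      rw [← div_le_iff₀ (by positivity)]
      exact le_csSup hbdd (hS ▸ ⟨v, hv, hv0, rfl⟩)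
  · obtain ⟨q, -, hq, hqS⟩ := exists_seq_tendsto_sSup ⟨_, hmem⟩ hbdd
    rw [hS] at hqS
    choose v hv hv0 hqv using hqS
    have hf := fun n => hW.form_pos hN (hv n) (hv0 n)
    have hs : ∀ n, (√(form N W (v n) (v n)))⁻¹ ^ 2 = (form N W (v n) (v n))⁻¹ := fun n => by
      rw [inv_pow, Real.sq_sqrt (hf n).le]
    refine ⟨fun n => (√(form N W (v n) (v n)))⁻¹ • v n, fun n => (memH_smul _ (hv n)).1,
      fun n => ?_, hq.congr fun n => ?_⟩
    · rw [form_smul hN hW.bounded hW.one_le (hv n), hs, inv_mul_cancel₀ (hf n).ne']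
    · rw [hqv, quartic_smul, show 4 = 2 * 2 from rfl, pow_mul, hs, inv_pow, div_eq_inv_mul]

theorem memH_neg {u : RealL2 T} (hu : MemH N u) :
    MemH N (-u) ∧ ∀ k ∈ regularSet N, derivL (-u) k = -derivL u k := by
  have h := memH_smul (-1) hu
  simpa only [neg_smul, one_smul] using h

theorem normSq_add_le (hN : RegularCoeff N) {u v : RealL2 T} (hu : MemH N u) (hv : MemH N v) :
    normSq N (u + v) ≤ 2 * normSq N u + 2 * normSq N v := by
  obtain ⟨huv, hd⟩ := memH_add hN hu hv
  rw [normSq, normSq, normSq, ← tsum_mul_left, ← tsum_mul_left,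
    ← (hu.summable.mul_left 2).tsum_add (hv.summable.mul_left 2)]
  refine huv.summable.tsum_le_tsum (fun k => ?_) ((hu.summable.mul_left 2).add (hv.summable.mul_left 2))
  rw [normTerm, hd k k.2, map_add]
  have h1 := norm_add_sq_le_two (derivL u k) (derivL v k)
  have h2 := norm_add_sq_le_two (coeffL T k u) (coeffL T k v)
  have h3 := (hN.weight_pos k).le
  have h4 := freqSq_nonneg (T := T) k
  calc _ ≤ weight N k * ((2 * ‖derivL u k‖ ^ 2 + 2 * ‖derivL v k‖ ^ 2) + freqSq T k *
        (2 * ‖coeffL T k u‖ ^ 2 + 2 * ‖coeffL T k v‖ ^ 2)) := by gcongr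
    _ = _ := by simp only [normTerm]; ring

theorem normSq_neg {u : RealL2 T} (hu : MemH N u) : normSq N (-u) = normSq N u := by
  refine tsum_congr fun k => ?_
  rw [normTerm, normTerm, (memH_neg hu).2 k k.2, map_neg, norm_neg, norm_neg]

/-- Bounded sequences in `H` have weak limits along ultrafilters. -/
theorem exists_weakNull_sub (hN : RegularCoeff N) {ι : Type*} (𝒰 : Ultrafilter ι)
    {u : ι → RealL2 T} {R : ℝ} (hu : ∀ n, MemH N (u n)) (hR : ∀ n, normSq N (u n) ≤ R) :
    ∃ u₀ R', MemH N u₀ ∧ WeakNull N 𝒰 R' fun n => u n - u₀ := by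
  obtain ⟨u₀, hu₀, hw⟩ := exists_weak_limit hN 𝒰 hu hR
  refine ⟨u₀, 2 * R + 2 * normSq N u₀, hu₀, fun n => ?_, fun n => ?_, fun k hk => ?_, fun k hk => ?_⟩
  · rw [sub_eq_add_neg]
    exact (memH_add hN (hu n) (memH_neg hu₀).1).1
  · rw [sub_eq_add_neg]
    refine (normSq_add_le hN (hu n) (memH_neg hu₀).1).trans ?_
    rw [normSq_neg hu₀]
    linarith [hR n]
  · simpa only [map_sub] using (hw k hk).1.sub
  · have h1 := (hw k hk).2.sub
    refine (funext fun n => ?_ : (fun n => derivL (u n - u₀) k) = _) ▸ h1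
    rw [sub_eq_add_neg, (memH_add hN (hu n) (memH_neg hu₀).1).2 k hk, (memH_neg hu₀).2 k hk,
      sub_eq_add_neg]

/-- The dichotomy of the weak limit along a nonprincipal ultrafilter: a nonzero limit is a
maximizer, so only sequences that vanish locally remain to be handled. -/
theorem IsMaximizingSeq.exists_isMaximizer_or_weakNull (hN : RegularCoeff N)
    {W : ℤ → Lp ℝ ⊤ (volume : Measure ℝ)} {C δ : ℝ} (hW : CoercivePotential W C δ) {h : ℝ → ℝ}
    {A : ℝ} (hh : BoundedCoeff h A) {M : ℝ} (hM0 : 0 < M) (hM : IsQuotientBound N W h M)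
    {u : ℕ → RealL2 T} (hu : IsMaximizingSeq N W h M u) :
    (∃ w, IsMaximizer N W h M w) ∨ ∃ R, WeakNull N (hyperfilter ℕ) R u := by
  obtain ⟨u₀, R', hu₀, hr⟩ := exists_weakNull_sub hN (hyperfilter ℕ) hu.mem (R := 1 / δ)
    fun n => (hW.normSq_le hN (hu.mem n)).trans_eq (by rw [hu.form_eq])
  by_cases h0 : u₀ = 0
  · right
    refine ⟨R', ?_⟩
    simpa only [h0, sub_zero] using hr
  · left
    refine ⟨u₀, isMaximizer_of_weakNull hN hW hh hM0 hM hu₀ h0 hr ?_ ?_⟩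
    · simp only [add_sub_cancel, hu.form_eq]
      exact tendsto_const_nhds
    · simp only [add_sub_cancel]
      exact hu.tendsto.mono_left Nat.hyperfilter_le_atTop

/-! ### Translations -/

variable (T) in
theorem measurePreserving_translate (a : ℝ) :
    MeasurePreserving (fun p : ℝ × AddCircle T => (p.1 + a, p.2)) (spaceTime T) (spaceTime T) :=
  (measurePreserving_add_right volume a).prod (MeasurePreserving.id _)

/-- The translation of `u` by `a` in space. -/
def translate (a : ℝ) (u : RealL2 T) : RealL2 T :=
  Lp.compMeasurePreserving _ (measurePreserving_translate T a) u

theorem translate_ae (a : ℝ) (u : RealL2 T) :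
    translate a u =ᵐ[spaceTime T] fun p => u (p.1 + a, p.2) :=
  Lp.coeFn_compMeasurePreserving u (measurePreserving_translate T a)

/-- The translation by `a` on `L²(ℝ)`. -/
def translateL2 (a : ℝ) : L2C →ₗᵢ[ℝ] L2C :=
  Lp.compMeasurePreservingₗᵢ ℝ _ (measurePreserving_add_right volume a)

theorem translateL2_ae (a : ℝ) (f : L2C) : translateL2 a f =ᵐ[volume] fun x => f (x + a) :=
  Lp.coeFn_compMeasurePreserving f (measurePreserving_add_right volume a)

theorem ae_comp_add_right {p : ℝ → Prop} (h : ∀ᵐ x, p x) (a : ℝ) : ∀ᵐ x, p (x + a) :=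
  (measurePreserving_add_right volume a).quasiMeasurePreserving.ae h

theorem timeCoeff_translate (a : ℝ) (u : RealL2 T) (k : ℤ) :
    timeCoeff (translate a u) k =ᵐ[volume] fun x => timeCoeff u k (x + a) :=
  timeCoeff_of_ae_eq (translate_ae a u) k

theorem coeffL_translate (a : ℝ) (u : RealL2 T) (k : ℤ) :
    coeffL T k (translate a u) = translateL2 a (coeffL T k u) := by
  refine Lp.ext ?_
  filter_upwards [coeffL_ae (translate a u) k, timeCoeff_translate a u k,
    translateL2_ae a (coeffL T k u), ae_comp_add_right (coeffL_ae u k) a] with x h1 h2 h3 h4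
  rw [h1, h2, h3, h4]

theorem memH_translate (a : ℝ) {u : RealL2 T} (hu : MemH N u) :
    MemH N (translate a u) ∧ ∀ k ∈ regularSet N,
      derivL (translate a u) k = translateL2 a (derivL u k) := by
  refine MemH.of_isWeakDeriv (fun k => translateL2 a (derivL u k)) (fun k hk => ?_)
    (fun k hk => ?_) ?_
  · filter_upwards [timeCoeff_translate a u k, ae_comp_add_right (hu.1 k hk) a] with x h1 h2
    rw [h1, h2]
    rfl
  · refine ((hu.isWeakDeriv hk).comp_add_right a).congr (timeCoeff_translate a u k).symm ?_
    filter_upwards [translateL2_ae a (derivL u k), ae_comp_add_right (hu.derivL_ae hk) a]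
      with x h1 h2
    rw [h1, h2]
  · refine hu.summable.congr fun k => ?_
    rw [coeffL_translate, LinearIsometry.norm_map, LinearIsometry.norm_map]
    rfl

theorem smul_translateL2 {w : Lp ℝ ⊤ (volume : Measure ℝ)} {a : ℝ}
    (hw : ∀ᵐ x, w (x + a) = w x) (f : L2C) :
    (w • translateL2 a f : L2C) = translateL2 a (w • f : L2C) := by
  refine Lp.ext ?_
  filter_upwards [hw, Lp.coeFn_lpSMul (r := 2) w (translateL2 a f), translateL2_ae a f,
    translateL2_ae a (w • f : L2C), ae_comp_add_right (Lp.coeFn_lpSMul (r := 2) w f) a] with x h1 h2 h3 h4 h5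
  rw [h2, h4, h5, Pi.smul_apply', Pi.smul_apply', h3, h1]

theorem form_translate {W : ℤ → Lp ℝ ⊤ (volume : Measure ℝ)} {a : ℝ}
    (hW : ∀ k, ∀ᵐ x, W k (x + a) = W k x) {u : RealL2 T} (hu : MemH N u) :
    form N W (translate a u) (translate a u) = form N W u u := by
  refine tsum_congr fun k => ?_
  rw [formTerm, formTerm, (memH_translate a hu).2 k k.2, coeffL_translate,
    smul_translateL2 (hW k), LinearIsometry.inner_map_map, LinearIsometry.inner_map_map]

theorem quartic_translate {h : ℝ → ℝ} {a : ℝ} (hh : ∀ᵐ x, h (x + a) = h x) (u : RealL2 T) :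
    quartic h (translate a u) = quartic h u := by
  have hemb : MeasurableEmbedding (fun p : ℝ × AddCircle T => (p.1 + a, p.2)) :=
    (measurableEmbedding_addRight a).prodMap MeasurableEmbedding.id
  rw [quartic, quartic, ← (measurePreserving_translate T a).integral_comp hemb
    (fun p => h p.1 * u p ^ 4)]
  refine integral_congr_ae ?_
  filter_upwards [translate_ae a u, ae_fst hh] with p h1 h2
  rw [h1, h2]

theorem ae_add_intCast_mul_eq {α : Type*} {f : ℝ → α} {a : ℝ} (h : ∀ᵐ x, f (x + a) = f x) (j : ℤ) :
    ∀ᵐ x, f (x + j * a) = f x := by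
  have hnat : ∀ n : ℕ, ∀ᵐ x, f (x + n * a) = f x := fun n => by
    induction n with
    | zero => simp
    | succ n ih =>
      filter_upwards [ih, ae_comp_add_right h (n * a)] with x h1 h2
      rw [← h1, ← h2]
      push_cast
      ring_nf
  obtain ⟨n, rfl | rfl⟩ := j.eq_nat_or_neg
  · simpa using hnat n
  · filter_upwards [ae_comp_add_right (hnat n) (-(n * a))] with x h1
    rw [neg_add_cancel_right] at h1
    rw [h1]
    push_cast
    ring_nf

/-- Functions with nonvanishing `L⁴` norm do not vanish locally uniformly. -/
theorem exists_not_ae_tsum_le (hN : RegularCoeff N) {X : ℝ} (hX : 0 < X) {u : RealL2 T}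
    (hu : MemH N u) {τ : ℝ}
    (h : ENNReal.ofReal (coeffSum N) * ENNReal.ofReal τ * ENNReal.ofReal (normSq N u) <
      quart u Set.univ) :
    ∃ j : ℤ, ¬ ∀ᵐ x, x ∈ Set.Icc (j * X) (j * X + X) →
      ∑' k : regularSet N, ‖coeffL T k u x‖ₑ ^ 2 ≤ ENNReal.ofReal τ := by
  by_contra! hall
  refine h.not_ge ?_
  refine (quart_le_of_ae_le hN hu MeasurableSet.univ (M := ENNReal.ofReal τ) ?_).trans_eq ?_
  · filter_upwards [ae_all_iff.2 hall] with x hx _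
    obtain ⟨j, hj⟩ := exists_mem_Icc_of_pos hX x
    exact hx j hj
  · rw [setLIntegral_univ, lintegral_density hN hu]

/-- The quotient attains its supremum if the coefficients are periodic. -/
theorem exists_isMaximizer_of_periodic (hN : RegularCoeff N)
    {W : ℤ → Lp ℝ ⊤ (volume : Measure ℝ)} {C δ : ℝ} (hW : CoercivePotential W C δ) {h : ℝ → ℝ}
    {A : ℝ} (hh : BoundedCoeff h A) {X : ℝ} (hX : 0 < X)
    (hWX : ∀ k, ∀ᵐ x, W k (x + X) = W k x) (hhX : ∀ᵐ x, h (x + X) = h x)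
    (hpos : ∃ v : RealL2 T, MemH N v ∧ 0 < quartic h v) :
    ∃ M w, 0 < M ∧ IsQuotientBound N W h M ∧ IsMaximizer N W h M w := by
  obtain ⟨M, hM0, hM, u₀, hu₀⟩ := exists_isMaximizingSeq hN hW hh hpos
  obtain ⟨n₀, hn₀⟩ := (hu₀.tendsto.eventually_const_lt (half_lt_self hM0)).exists_forall_of_atTop
  have hA := hh.nonneg
  have hδ := hW.pos
  have hcs : 0 ≤ coeffSum N := tsum_nonneg fun k => (hN.pos k k.2).le
  -- From the index n₀ on, ∫ h u⁴ > M/2, which forces ∫ u⁴ > κ. The threshold τ is so small that ∑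
  -- |û_k|² ≤ τ on every cell would give ∫ u⁴ ≤ κ. So every such term exceeds τ on some cell.
  obtain ⟨κ, hκ, hκM⟩ : ∃ κ, 0 < κ ∧ A * κ ≤ M / 2 :=
    ⟨M / 2 / (A + 1), by positivity, mul_div_mul_add_one_le hA (by positivity)⟩
  obtain ⟨τ, hτ, hτκ⟩ : ∃ τ, 0 < τ ∧ coeffSum N * (1 / δ) * τ ≤ κ :=
    ⟨κ / (coeffSum N * (1 / δ) + 1), by positivity,
      mul_div_mul_add_one_le (by positivity) (by positivity)⟩
  have hj : ∀ n, ∃ j : ℤ, ¬ ∀ᵐ x, x ∈ Set.Icc (j * X) (j * X + X) →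
      ∑' k : regularSet N, ‖coeffL T k (u₀ (n + n₀)) x‖ₑ ^ 2 ≤ ENNReal.ofReal τ := fun n => by
    have hmem := hu₀.mem (n + n₀)
    refine exists_not_ae_tsum_le hN hX hmem ?_
    have h1 : normSq N (u₀ (n + n₀)) ≤ 1 / δ :=
      (hW.normSq_le hN hmem).trans_eq (by rw [hu₀.form_eq])
    have h2 : κ < quarticOn (u₀ (n + n₀)) Set.univ := by
      have h3 := hn₀ (n + n₀) (by omega)
      have h4 := (le_abs_self _).trans (abs_quartic_le hN hh hmem)
      by_contra hle
      push Not at hle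
      have := mul_le_mul_of_nonneg_left hle hA
      linarith
    have h0 := normSq_nonneg hN (u₀ (n + n₀))
    rw [← ofReal_quarticOn hN hmem, ← ENNReal.ofReal_mul hcs, ← ENNReal.ofReal_mul (by positivity)]
    refine (ENNReal.ofReal_lt_ofReal_iff (hκ.trans h2)).2 (lt_of_le_of_lt ?_ h2)
    calc coeffSum N * τ * normSq N (u₀ (n + n₀)) ≤ coeffSum N * τ * (1 / δ) := by gcongr
      _ = coeffSum N * (1 / δ) * τ := by ring
      _ ≤ κ := hτκ
  choose j hj using hj
  -- Translation by j n periods moves the chosen cell to [0, X]; periodicity of the coefficients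
  -- preserves the normalization and the quartic values.
  have hu : IsMaximizingSeq N W h M fun n => translate (j n * X) (u₀ (n + n₀)) := by
    refine ⟨fun n => (memH_translate _ (hu₀.mem _)).1, fun n => ?_, ?_⟩
    · rw [form_translate (fun k => ae_add_intCast_mul_eq (hWX k) (j n)) (hu₀.mem _), hu₀.form_eq]
    · simp only [quartic_translate (ae_add_intCast_mul_eq hhX (j _))]
      exact hu₀.tendsto.comp (tendsto_add_atTop_nat n₀)
  rcases hu.exists_isMaximizer_or_weakNull hN hW hh hM0 hM with ⟨w, hw⟩ | ⟨R, hR⟩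
  · exact ⟨M, w, hM0, hM, hw⟩
  -- A weakly null sequence would have ∑ |û_k|² ≤ τ on [-X, X], which contains the cell on which
  -- this fails.
  · obtain ⟨n, hn⟩ := (hR.eventually_tsum_le hN hX hτ).exists
    refine absurd ?_ (hj n)
    filter_upwards [ae_comp_add_right hn (-(j n * X)), ae_all_iff.2 fun k =>
      ae_comp_add_right (translateL2_ae (j n * X) (coeffL T k (u₀ (n + n₀)))) (-(j n * X))]
      with x h1 h2 hx
    simp only [neg_add_cancel_right] at h2
    simp only [coeffL_translate, h2] at h1
    exact h1 ⟨by linarith [hx.1], by linarith [hx.2]⟩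

end Torus

/-! ### Cutoff in space and comparison of potentials -/

/-- A smooth spatial cutoff function vanishing on `[-ρ, ρ]`. -/
structure IsCutoff (χ : ℝ → ℝ) (m ρ ρ' : ℝ) : Prop where
  contDiff : ContDiff ℝ ∞ χ
  nonneg : ∀ x, 0 ≤ χ x
  le_one : ∀ x, χ x ≤ 1
  deriv_le : ∀ x, |deriv χ x| ≤ m
  eq_zero : ∀ x, |x| ≤ ρ → χ x = 0
  eq_one : ∀ x, ρ' ≤ |x| → χ x = 1

/-- One minus a bump function stretched by a factor S; the slope decays like 1/S, so it can be made
as small as desired. -/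
theorem exists_isCutoff {m : ℝ} (hm : 0 < m) (ρ₀ : ℝ) :
    ∃ χ ρ ρ', ρ₀ ≤ ρ ∧ 0 < ρ' ∧ IsCutoff χ m ρ ρ' := by
  let η : ContDiffBump (0 : ℝ) := ⟨1, 2, one_pos, one_lt_two⟩
  obtain ⟨K, hK⟩ := η.hasCompactSupport.deriv.exists_bound_of_continuous
    ((η.contDiff (n := ⊤)).continuous_deriv (by simp))
  have hK0 : 0 ≤ K := (norm_nonneg _).trans (hK 0)
  obtain ⟨S, hS, hSρ, hSK⟩ : ∃ S : ℝ, 0 < S ∧ ρ₀ ≤ S ∧ K / S ≤ m := by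
    refine ⟨max (max ρ₀ 1) (K / m), lt_max_of_lt_left (lt_max_of_lt_right one_pos),
      (le_max_left _ _).trans (le_max_left _ _), ?_⟩
    have h0 : 0 < max (max ρ₀ 1) (K / m) := lt_max_of_lt_left (lt_max_of_lt_right one_pos)
    rw [div_le_iff₀ h0, ← div_le_iff₀' hm]
    exact le_max_right _ _
  refine ⟨fun x => 1 - η (x / S), S, 2 * S, hSρ, by positivity, ?_, fun x => ?_, fun x => ?_,
    fun x => ?_, fun x hx => ?_, fun x hx => ?_⟩
  · exact contDiff_const.sub (η.contDiff.comp (contDiff_id.div_const S))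
  · exact sub_nonneg.2 η.le_one
  · linarith [η.nonneg' (x / S)]
  · have h1 : HasDerivAt (fun x => 1 - η (x / S)) (-(deriv η (x / S) * (1 / S))) x := by
      have h2 : HasDerivAt η (deriv η (x / S)) (x / S) :=
        ((η.contDiff (n := ⊤)).differentiable (by simp)).differentiableAt.hasDerivAt
      exact (h2.comp x ((hasDerivAt_id x).div_const S)).const_sub 1
    rw [h1.deriv, abs_neg, abs_mul, abs_of_pos (by positivity : 0 < 1 / S), mul_one_div]
    refine le_trans ?_ hSK
    gcongr
    exact hK _
  · have : η (x / S) = 1 := η.one_of_mem_closedBall (by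
      rw [mem_closedBall_zero_iff, Real.norm_eq_abs, abs_div, abs_of_pos hS]
      exact (div_le_one hS).2 hx)
    rw [this, sub_self]
  · have : η (x / S) = 0 := η.zero_of_le_dist (by
      rw [dist_zero_right, Real.norm_eq_abs, abs_div, abs_of_pos hS]
      exact (le_div_iff₀ hS).2 hx)
    rw [this, sub_zero]

section Torus

variable {T : ℝ} [Fact (0 < T)] {N : SignedMeasure (AddCircle T)}

theorem sq_freq_le_freqSq {T : ℝ} {k : ℤ} (hk : k ≠ 0) : freq T ^ 2 ≤ freqSq T k := by
  have h1 : (1 : ℝ) ≤ (k : ℝ) ^ 2 := by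
    rw [one_le_sq_iff_one_le_abs]
    exact_mod_cast Int.one_le_abs hk
  rw [freqSq]
  exact le_mul_of_one_le_right (sq_nonneg _) h1

/-- The product of a bounded continuous function and an `L²` function. -/
theorem memLp_ofReal_mul {χ : ℝ → ℝ} (hχ : Continuous χ) {m : ℝ} (hm : ∀ x, |χ x| ≤ m) (f : L2C) :
    MemLp (fun x => (χ x : ℂ) * f x) 2 volume := by
  refine (Lp.memLp f).of_le_mul (c := m)
    ((Complex.continuous_ofReal.comp hχ).aestronglyMeasurable.mul (Lp.aestronglyMeasurable f))
    (Eventually.of_forall fun x => ?_)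
  rw [norm_mul, Complex.norm_real]
  exact mul_le_mul_of_nonneg_right (hm x) (norm_nonneg _)

theorem norm_ofReal_mul_le {χ : ℝ → ℝ} {m : ℝ} (hm : ∀ x, |χ x| ≤ m) {f : L2C}
    (h : MemLp (fun x => (χ x : ℂ) * f x) 2 volume) : ‖h.toLp‖ ≤ m * ‖f‖ := by
  refine Lp.norm_le_mul_norm_of_ae_le_mul ?_
  filter_upwards [h.coeFn_toLp] with x hx
  rw [hx, norm_mul, Complex.norm_real]
  exact mul_le_mul_of_nonneg_right (hm x) (norm_nonneg _)

theorem IsCutoff.abs_le_one {χ : ℝ → ℝ} {m ρ ρ' : ℝ} (hχ : IsCutoff χ m ρ ρ') (x : ℝ) :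
    |χ x| ≤ 1 := by
  rw [abs_of_nonneg (hχ.nonneg x)]
  exact hχ.le_one x

/-- Multiplication by a cutoff function preserves `H`. -/
theorem IsCutoff.exists_mul (hN : RegularCoeff N) {χ : ℝ → ℝ} {m ρ ρ' : ℝ}
    (hχ : IsCutoff χ m ρ ρ') {u : RealL2 T} (hu : MemH N u) :
    ∃ v : RealL2 T, MemH N v ∧ (v =ᵐ[spaceTime T] fun p => χ p.1 * u p) ∧
      (∀ k, coeffL T k v =ᵐ[volume] fun x => (χ x : ℂ) * coeffL T k u x) ∧
      ∀ k ∈ regularSet N, ‖derivL v k‖ ≤ m * ‖coeffL T k u‖ + ‖derivL u k‖ := by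
  have hc := hχ.contDiff.continuous
  have hc' : Continuous (deriv χ) := hχ.contDiff.continuous_deriv (by simp)
  have hv : MemLp (fun p : ℝ × AddCircle T => χ p.1 * u p) 2 (spaceTime T) := by
    refine (Lp.memLp u).of_le ((hc.comp continuous_fst).aestronglyMeasurable.mul
      (Lp.aestronglyMeasurable u)) (Eventually.of_forall fun p => ?_)
    rw [norm_mul]
    exact mul_le_of_le_one_left (norm_nonneg _) (hχ.abs_le_one p.1)
  have htc : ∀ k, timeCoeff hv.toLp k =ᵐ[volume] fun x => (χ x : ℂ) * timeCoeff u k x := fun k => by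
    refine (timeCoeff_of_ae_eq hv.coeFn_toLp k).trans (Eventually.of_forall fun x => ?_)
    simp only [Complex.ofReal_mul]
    exact fourierCoeff.const_mul _ _ _
  have hcl : ∀ k, coeffL T k hv.toLp =ᵐ[volume] fun x => (χ x : ℂ) * coeffL T k u x := fun k => by
    filter_upwards [coeffL_ae hv.toLp k, htc k, coeffL_ae u k] with x h1 h2 h3
    rw [h1, h2, h3]
  have m1 := fun k => memLp_ofReal_mul hc' hχ.deriv_le (coeffL T k u)
  have m2 := fun k => memLp_ofReal_mul hc hχ.abs_le_one (derivL u k)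
  have m3 := fun k => memLp_ofReal_mul hc hχ.abs_le_one (coeffL T k u)
  have hm0 : 0 ≤ m := (abs_nonneg _).trans (hχ.deriv_le 0)
  have hnorm : ∀ k, ‖(m1 k).toLp + (m2 k).toLp‖ ≤ m * ‖coeffL T k u‖ + ‖derivL u k‖ := fun k => by
    refine (norm_add_le _ _).trans (add_le_add (norm_ofReal_mul_le hχ.deriv_le _) ?_)
    exact (norm_ofReal_mul_le hχ.abs_le_one _).trans_eq (one_mul _)
  have hnorm' : ∀ k, ‖coeffL T k hv.toLp‖ ≤ ‖coeffL T k u‖ := fun k => by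
    have : coeffL T k hv.toLp = (m3 k).toLp := Lp.ext ((hcl k).trans (m3 k).coeFn_toLp.symm)
    rw [this]
    exact (norm_ofReal_mul_le hχ.abs_le_one _).trans_eq (one_mul _)
  have hmem := MemH.of_isWeakDeriv (N := N) (u := hv.toLp) (fun k => (m1 k).toLp + (m2 k).toLp)
    (fun k hk => by
      filter_upwards [htc k, hu.1 k hk] with x h1 h2
      rw [h1, h2]
      simp)
    (fun k hk => by
      refine ((hu.isWeakDeriv_derivL hk).mul_contDiff hχ.contDiff).congr ?_ ?_
      · filter_upwards [htc k, coeffL_ae u k] with x h1 h2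
        rw [h1, h2]
      · filter_upwards [Lp.coeFn_add (m1 k).toLp (m2 k).toLp, (m1 k).coeFn_toLp,
          (m2 k).coeFn_toLp] with x h1 h2 h3
        rw [h1, Pi.add_apply, h2, h3])
    (by
      refine Summable.of_nonneg_of_le (fun k => ?_) (fun k => ?_)
        (hu.summable.mul_left (2 + 2 * (m ^ 2 / freq T ^ 2) + 1))
      · have := (hN.weight_pos k).le
        have := freqSq_nonneg (T := T) k
        positivity
      · have h1 := (hN.weight_pos k).le
        have h2 := freqSq_nonneg (T := T) k
        have h3 := sq_freq_le_freqSq (T := T) k.2.1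
        have h4 : 0 < freq T ^ 2 := pow_pos freq_pos 2
        have h5 : ‖(m1 k).toLp + (m2 k).toLp‖ ^ 2 ≤
            2 * (m * ‖coeffL T k u‖) ^ 2 + 2 * ‖derivL u k‖ ^ 2 := by
          refine (pow_le_pow_left₀ (norm_nonneg _) (hnorm k) 2).trans ?_
          nlinarith [sq_nonneg (m * ‖coeffL T k u‖ - ‖derivL u k‖)]
        -- Regular indices satisfy |k| ≥ 1, so the zeroth-order term produced by χ' is absorbed by
        -- ω²k² |û_k|², uniformly in k.
        have h6 : m ^ 2 ≤ m ^ 2 / freq T ^ 2 * freqSq T k := by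
          rw [div_mul_eq_mul_div, le_div_iff₀ h4]
          gcongr
        calc _ ≤ weight N k * ((2 * (m * ‖coeffL T k u‖) ^ 2 + 2 * ‖derivL u k‖ ^ 2) +
              freqSq T k * ‖coeffL T k u‖ ^ 2) := by
              gcongr
              exact hnorm' k
          _ = weight N k * (2 * m ^ 2 * ‖coeffL T k u‖ ^ 2 + 2 * ‖derivL u k‖ ^ 2 +
              freqSq T k * ‖coeffL T k u‖ ^ 2) := by ring
          _ ≤ weight N k * (2 * (m ^ 2 / freq T ^ 2 * freqSq T k) * ‖coeffL T k u‖ ^ 2 +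
              (2 + 2 * (m ^ 2 / freq T ^ 2)) * ‖derivL u k‖ ^ 2 +
              (2 + 1) * (freqSq T k * ‖coeffL T k u‖ ^ 2) + ‖derivL u k‖ ^ 2) := by
              have h7 : 0 ≤ 2 * (m ^ 2 / freq T ^ 2) * ‖derivL u k‖ ^ 2 := by positivity
              have h8 : 0 ≤ freqSq T k * ‖coeffL T k u‖ ^ 2 := by positivity
              have h9 := sq_nonneg ‖derivL u k‖
              have h10 := mul_le_mul_of_nonneg_right h6 (sq_nonneg ‖coeffL T k u‖)
              refine mul_le_mul_of_nonneg_left ?_ h1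
              linarith
          _ = _ := by rw [normTerm]; ring)
  refine ⟨hv.toLp, hmem.1, hv.coeFn_toLp, hcl, fun k hk => ?_⟩
  rw [hmem.2 k hk]
  exact hnorm k

theorem inner_smul_cutoff_le {w w' : Lp ℝ ⊤ (volume : Measure ℝ)} {χ : ℝ → ℝ} {ε : ℝ}
    (h : ∀ᵐ x, w' x * χ x ^ 2 ≤ w x + ε) {f g : L2C} (hg : g =ᵐ[volume] fun x => (χ x : ℂ) * f x) :
    inner ℝ (w' • g : L2C) g ≤ inner ℝ (w • f : L2C) f + ε * ‖f‖ ^ 2 := by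
  rw [← real_inner_self_eq_norm_sq, L2.inner_def, L2.inner_def, L2.inner_def, ← integral_const_mul,
    ← integral_add (L2.integrable_inner (𝕜 := ℝ) _ _)
      ((L2.integrable_inner (𝕜 := ℝ) _ _).const_mul _)]
  refine integral_mono_ae (L2.integrable_inner (𝕜 := ℝ) _ _)
    ((L2.integrable_inner (𝕜 := ℝ) _ _).add ((L2.integrable_inner (𝕜 := ℝ) _ _).const_mul _)) ?_
  filter_upwards [h, hg, Lp.coeFn_lpSMul (r := 2) w f, Lp.coeFn_lpSMul (r := 2) w' g]
    with x h0 hx h1 h2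
  rw [h1, h2, Pi.smul_apply', Pi.smul_apply', real_inner_smul_left, real_inner_smul_left,
    real_inner_self_eq_norm_sq, real_inner_self_eq_norm_sq, hx, norm_mul, Complex.norm_real,
    mul_pow, Real.norm_eq_abs, sq_abs, ← mul_assoc, ← add_mul]
  exact mul_le_mul_of_nonneg_right h0 (sq_nonneg _)

/-- The quadratic form of a function cut off in space. -/
theorem form_cutoff_le (hN : RegularCoeff N) {W W' : ℤ → Lp ℝ ⊤ (volume : Measure ℝ)} {C C' : ℝ}
    (hW : CoeffBounded W C) (hC : 1 ≤ C) (hW' : CoeffBounded W' C') (hC' : 1 ≤ C') {χ : ℝ → ℝ}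
    {m ε : ℝ} (hm : 0 ≤ m) (hε : 0 ≤ ε) (h : ∀ k, ∀ᵐ x, W' k x * χ x ^ 2 ≤ W k x + ε)
    {u v : RealL2 T} (hu : MemH N u) (hv : MemH N v)
    (hc : ∀ k, coeffL T k v =ᵐ[volume] fun x => (χ x : ℂ) * coeffL T k u x)
    (hd : ∀ k ∈ regularSet N, ‖derivL v k‖ ≤ m * ‖coeffL T k u‖ + ‖derivL u k‖) :
    form N W' v v ≤ form N W u u + (m + (m + m ^ 2) / freq T ^ 2 + ε) * normSq N u := by
  rw [form, form, normSq, ← tsum_mul_left, ← (summable_formTerm hN hW hC hu hu).tsum_add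
    (hu.summable.mul_left _)]
  refine (summable_formTerm hN hW' hC' hv hv).tsum_le_tsum (fun k => ?_)
    ((summable_formTerm hN hW hC hu hu).add (hu.summable.mul_left _))
  have h1 := (hN.weight_pos k).le
  have h2 := freqSq_nonneg (T := T) k
  have h3 := sq_freq_le_freqSq (T := T) k.2.1
  have h4 : 0 < freq T ^ 2 := pow_pos freq_pos 2
  -- The cross term is split as 2m ab ≤ m a² + m b², which keeps the excess over ‖û_k'‖² of order m.
  have h5 : ‖derivL v k‖ ^ 2 ≤ (1 + m) * ‖derivL u k‖ ^ 2 + (m + m ^ 2) * ‖coeffL T k u‖ ^ 2 := by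
    refine (pow_le_pow_left₀ (norm_nonneg _) (hd k k.2) 2).trans ?_
    nlinarith [mul_nonneg hm (sq_nonneg (‖coeffL T k u‖ - ‖derivL u k‖))]
  have h6 : m + m ^ 2 ≤ (m + m ^ 2) / freq T ^ 2 * freqSq T k := by
    rw [div_mul_eq_mul_div, le_div_iff₀ h4]
    gcongr
  have h7 := inner_smul_cutoff_le (h k) (hc k)
  unfold formTerm normTerm
  rw [real_inner_self_eq_norm_sq, real_inner_self_eq_norm_sq]
  obtain ⟨q, hq⟩ : ∃ q, q = (m + m ^ 2) / freq T ^ 2 := ⟨_, rfl⟩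
  have hq0 : 0 ≤ q := by rw [hq]; positivity
  rw [← hq] at h6 ⊢
  calc _ ≤ weight N k * (((1 + m) * ‖derivL u k‖ ^ 2 + q * freqSq T k * ‖coeffL T k u‖ ^ 2) +
        freqSq T k * (inner ℝ (W k • coeffL T k u : L2C) (coeffL T k u) +
          ε * ‖coeffL T k u‖ ^ 2)) := by
        gcongr
        refine h5.trans ?_
        gcongr
    _ ≤ weight N k * (((1 + m) * ‖derivL u k‖ ^ 2 + q * freqSq T k * ‖coeffL T k u‖ ^ 2) +
        freqSq T k * (inner ℝ (W k • coeffL T k u : L2C) (coeffL T k u) +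
          ε * ‖coeffL T k u‖ ^ 2) + (q + ε) * ‖derivL u k‖ ^ 2 +
          m * (freqSq T k * ‖coeffL T k u‖ ^ 2)) := by
        refine mul_le_mul_of_nonneg_left ?_ h1
        have : 0 ≤ (q + ε) * ‖derivL u k‖ ^ 2 := by positivity
        have : 0 ≤ m * (freqSq T k * ‖coeffL T k u‖ ^ 2) := by positivity
        linarith
    _ = _ := by ring

/-- The L⁴ mass on [-ρ, ρ] tends to zero, so only the size of g outside this interval matters. -/
theorem WeakNull.eventually_quartic_le (hN : RegularCoeff N) {ι : Type*} {l : Filter ι} {R : ℝ}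
    {r : ι → RealL2 T} (hr : WeakNull N l R r) {g : ℝ → ℝ} {A : ℝ} (hg : BoundedCoeff g A)
    {ρ ε U : ℝ} (hρ : 0 < ρ) (hε : 0 ≤ ε) (hgε : ∀ᵐ x, ρ ≤ |x| → g x ≤ ε)
    (hU : ∀ n, quarticOn (r n) Set.univ ≤ U) {θ : ℝ} (hθ : 0 < θ) :
    ∀ᶠ n in l, quartic g (r n) ≤ ε * U + θ := by
  have hA := hg.nonneg
  filter_upwards [(hr.tendsto_quarticOn hN hρ).eventually_lt_const
    (show 0 < θ / (A + 1) by positivity)] with n hn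
  have ir := integrable_pow_four hN (hr.mem n)
  have h1 := integral_le_of_le_on (s := Set.Icc (-ρ) ρ) measurableSet_Icc (hg.integrable_mul ir)
    (ir.const_mul A) (ir.const_mul ε) (by
      filter_upwards [ae_fst (p := fun x => |g x| ≤ A) hg.bound] with p hp _
      exact mul_le_mul_of_nonneg_right ((le_abs_self _).trans hp) (by positivity)) (by
      filter_upwards [ae_fst hgε] with p hp hps
      refine mul_le_mul_of_nonneg_right (hp ?_) (by positivity)
      by_contra hlt
      push Not at hlt
      exact hps (abs_le.1 hlt.le))
  rw [integral_const_mul, integral_const_mul] at h1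
  refine h1.trans ?_
  change A * quarticOn (r n) (Set.Icc (-ρ) ρ) + ε * quarticOn (r n) (Set.Icc (-ρ) ρ)ᶜ ≤ _
  have h2 : A * quarticOn (r n) (Set.Icc (-ρ) ρ) ≤ θ :=
    (mul_le_mul_of_nonneg_left hn.le hA).trans (mul_div_mul_add_one_le hA hθ.le)
  have h3 := mul_le_mul_of_nonneg_left
    ((quarticOn_le_univ hN (hr.mem n) (Set.Icc (-ρ) ρ)ᶜ).trans (hU n)) hε
  linarith

/-- The quotient attains its supremum if the nonlinear coefficient vanishes at infinity. -/
theorem exists_isMaximizer_of_localized (hN : RegularCoeff N)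
    {W : ℤ → Lp ℝ ⊤ (volume : Measure ℝ)} {C δ : ℝ} (hW : CoercivePotential W C δ) {h : ℝ → ℝ}
    {A : ℝ} (hh : BoundedCoeff h A)
    (hloc : ∀ ε > 0, ∃ ρ, ∀ᵐ x, ρ ≤ |x| → h x ≤ ε)
    (hpos : ∃ v : RealL2 T, MemH N v ∧ 0 < quartic h v) :
    ∃ M w, 0 < M ∧ IsQuotientBound N W h M ∧ IsMaximizer N W h M w := by
  obtain ⟨M, hM0, hM, u, hu⟩ := exists_isMaximizingSeq hN hW hh hpos
  rcases hu.exists_isMaximizer_or_weakNull hN hW hh hM0 hM with ⟨w, hw⟩ | ⟨R, hR⟩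
  · exact ⟨M, w, hM0, hM, hw⟩
  -- For a weakly null sequence the quartic values are eventually at most εU + M/4 ≤ M/2, although
  -- they tend to M.
  exfalso
  obtain ⟨U, hU0, hU⟩ := hR.exists_quarticOn_le hN
  obtain ⟨ε, hε, hεM⟩ : ∃ ε, 0 < ε ∧ U * ε ≤ M / 4 :=
    ⟨M / 4 / (U + 1), by positivity, mul_div_mul_add_one_le hU0 (by positivity)⟩
  obtain ⟨ρ, hρ⟩ := hloc ε hε
  have h1 := hR.eventually_quartic_le hN hh (ρ := max ρ 1) (lt_max_of_lt_right one_pos) hε.le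
    (hρ.mono fun x hx hx' => hx ((le_max_left _ _).trans hx')) hU (θ := M / 4) (by positivity)
  have h2 := le_of_tendsto (hu.tendsto.mono_left Nat.hyperfilter_le_atTop) h1
  linarith

/-- The quotient attains its supremum if the coefficients are localized perturbations, with a
favourable sign, of coefficients for which the supremum is attained. -/
theorem exists_isMaximizer_of_perturbation (hN : RegularCoeff N)
    {W W' : ℤ → Lp ℝ ⊤ (volume : Measure ℝ)} {C δ : ℝ} (hW : CoercivePotential W C δ)
    (hW' : CoercivePotential W' C δ) {h h' : ℝ → ℝ} {A : ℝ} (hh : BoundedCoeff h A)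
    (hh' : BoundedCoeff h' A) (hWW' : ∀ k, ∀ᵐ x, W k x ≤ W' k x) (hh'h : ∀ᵐ x, h' x ≤ h x)
    (hWloc : ∀ ε > 0, ∃ ρ : ℝ, ∀ k, ∀ᵐ x, ρ ≤ |x| → W' k x ≤ W k x + ε)
    (hhloc : ∀ ε > 0, ∃ ρ : ℝ, ∀ᵐ x, ρ ≤ |x| → h x ≤ h' x + ε)
    (hmax : ∃ M w, 0 < M ∧ IsQuotientBound N W' h' M ∧ IsMaximizer N W' h' M w)
    (hpos : ∃ v : RealL2 T, MemH N v ∧ 0 < quartic h v) :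
    ∃ M w, 0 < M ∧ IsQuotientBound N W h M ∧ IsMaximizer N W h M w := by
  obtain ⟨M', w, hM'0, hM', hw⟩ := hmax
  obtain ⟨M, hM0, hM, u, hu⟩ := exists_isMaximizingSeq hN hW hh hpos
  rcases hu.exists_isMaximizer_or_weakNull hN hW hh hM0 hM with ⟨w, hw⟩ | ⟨R, hR⟩
  · exact ⟨M, w, hM0, hM, hw⟩
  have hA := hh.nonneg
  have hδ := hW.pos
  obtain ⟨U, hU0, hU⟩ := hR.exists_quarticOn_le hN
  -- For a cutoff of slope ε ≤ 1 and potentials differing by at most ε where the cutoff is nonzero,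
  -- the form grows by at most κε; 1/δ bounds the squared norm of the normalized sequence.
  obtain ⟨κ, hκ⟩ : ∃ κ, κ = (1 + 2 / freq T ^ 2 + 1) * (1 / δ) := ⟨_, rfl⟩
  have hfreq : 0 < freq T := freq_pos
  have hκ0 : 0 ≤ κ := by rw [hκ]; positivity
  -- The functions χ u n live where the two sets of coefficients nearly agree. Testing M' with them
  -- gives ∫ h' (χ u n)⁴ ≤ M' (1 + κε)², and the quartic mass lost by the cutoff is negligible
  -- because the sequence vanishes locally.
  have key : ∀ ε : ℝ, 0 < ε → ε ≤ 1 → M ≤ M' * (1 + κ * ε) ^ 2 + (U + 1) * ε := by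
    intro ε hε hε1
    obtain ⟨ρ₁, hρ₁⟩ := hWloc ε hε
    obtain ⟨ρ₂, hρ₂⟩ := hhloc ε hε
    obtain ⟨χ, ρ, ρ', hρ, hρ', hχ⟩ := exists_isCutoff hε (max ρ₁ ρ₂)
    choose v hv hvu hvc hvd using fun n => hχ.exists_mul hN (hu.mem n)
    have hχ4 : ∀ x, |χ x ^ 4| ≤ 1 := fun x => by
      rw [abs_pow]
      exact pow_le_one₀ (abs_nonneg _) (hχ.abs_le_one x)
    have hform : ∀ n, form N W' (v n) (v n) ≤ 1 + κ * ε := fun n => by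
      have h1 := form_cutoff_le hN hW.bounded hW.one_le hW'.bounded hW'.one_le (χ := χ) hε.le hε.le
        (fun k => by
          filter_upwards [hρ₁ k, hW.lower k, hW'.lower k] with x h1 h2 h3
          by_cases hx : |x| ≤ ρ
          · rw [hχ.eq_zero x hx]
            linarith
          · have h4 := h1 ((le_max_left _ _).trans (hρ.trans (le_of_not_ge hx)))
            have h5 : χ x ^ 2 ≤ 1 := pow_le_one₀ (hχ.nonneg x) (hχ.le_one x)
            nlinarith) (hu.mem n) (hv n) (hvc n) (hvd n)
      rw [hu.form_eq] at h1
      refine h1.trans (add_le_add le_rfl ?_)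
      have h2 : normSq N (u n) ≤ 1 / δ :=
        (hW.normSq_le hN (hu.mem n)).trans_eq (by rw [hu.form_eq])
      have h3 := normSq_nonneg hN (u n)
      calc (ε + (ε + ε ^ 2) / freq T ^ 2 + ε) * normSq N (u n)
          ≤ (ε + (ε + ε) / freq T ^ 2 + ε) * (1 / δ) := by
            gcongr
            nlinarith
        _ = κ * ε := by rw [hκ]; ring
    -- The change of the quartic functional is itself a quartic functional, with coefficient h - h'
    -- χ⁴. Where χ = 1 and |x| is large this is h - h', at most ε.
    have hg : BoundedCoeff (fun x => h x - h' x * χ x ^ 4) (A + A) := by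
      refine ⟨hh.meas.sub (hh'.meas.mul (hχ.contDiff.continuous.pow 4).aestronglyMeasurable), ?_,
        by positivity⟩
      filter_upwards [hh.bound, hh'.bound] with x h1 h2
      refine (abs_sub _ _).trans (add_le_add h1 ?_)
      rw [abs_mul]
      exact (mul_le_of_le_one_right (abs_nonneg _) (hχ4 x)).trans h2
    have hquart : ∀ n, quartic (fun x => h x - h' x * χ x ^ 4) (u n) =
        quartic h (u n) - quartic h' (v n) := fun n => by
      rw [quartic, quartic, quartic, ← integral_sub
        (hh.integrable_mul (integrable_pow_four hN (hu.mem n)))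
        (hh'.integrable_mul (integrable_pow_four hN (hv n)))]
      refine integral_congr_ae ?_
      filter_upwards [hvu n] with p hp
      rw [hp]
      ring
    have h1 := hR.eventually_quartic_le hN hg (ρ := max ρ' ρ₂) (ε := ε)
      (lt_max_of_lt_left hρ') hε.le (by
        filter_upwards [hρ₂] with x h1 hx
        rw [hχ.eq_one x ((le_max_left _ _).trans hx)]
        have := h1 ((le_max_right _ _).trans hx)
        linarith) hU hε
    refine le_of_tendsto (hu.tendsto.mono_left Nat.hyperfilter_le_atTop) (h1.mono fun n hn => ?_)
    rw [hquart] at hn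
    have h2 := hM' _ (hv n)
    have h3 : M' * form N W' (v n) (v n) ^ 2 ≤ M' * (1 + κ * ε) ^ 2 := by
      have := hW'.form_nonneg hN (hv n)
      have := hform n
      gcongr
    linarith
  have hMM' : M ≤ M' := by
    have h1 : Tendsto (fun ε : ℝ => M' * (1 + κ * ε) ^ 2 + (U + 1) * ε) (𝓝[>] 0) (𝓝 M') := by
      have h2 : Continuous fun ε : ℝ => M' * (1 + κ * ε) ^ 2 + (U + 1) * ε := by fun_prop
      have h3 := (h2.tendsto 0).mono_left (nhdsWithin_le_nhds (s := Set.Ioi 0))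
      simpa using h3
    refine ge_of_tendsto h1 ?_
    filter_upwards [Ioc_mem_nhdsGT one_pos] with ε hε
    exact key ε hε.1 hε.2
  -- With M ≤ M', W ≤ W' and h' ≤ h, the maximizer w of the primed problem satisfies M ⟨w,w⟩_W² ≤ M'
  -- ⟨w,w⟩_W'² = ∫ h' w⁴ ≤ ∫ h w⁴.
  refine ⟨M, w, hM0, hM, hw.mem, hw.ne_zero, le_antisymm (hM w hw.mem) ?_⟩
  have h1 := form_mono hN hW.bounded hW.one_le hW'.bounded hW'.one_le hWW' hw.mem
  have h2 := hW.form_nonneg hN hw.mem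
  have h3 : quartic h' w ≤ quartic h w := by
    refine integral_mono_ae (hh'.integrable_mul (integrable_pow_four hN hw.mem))
      (hh.integrable_mul (integrable_pow_four hN hw.mem)) ?_
    filter_upwards [ae_fst hh'h] with p hp
    exact mul_le_mul_of_nonneg_right hp (by positivity)
  refine le_trans ?_ h3
  rw [hw.eq]
  gcongr

end Torus

/-! ### Positivity of the quotient -/

/-- If `h` is positive on a set of positive measure then `∫ h φ⁴` is positive for some test
function `φ`. -/
theorem BoundedCoeff.exists_integral_pos {h : ℝ → ℝ} {A : ℝ} (hh : BoundedCoeff h A)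
    (hpos : ¬ ∀ᵐ x, h x ≤ 0) :
    ∃ φ : ℝ → ℝ, HasCompactSupport φ ∧ ContDiff ℝ ∞ φ ∧ 0 < ∫ x, h x * φ x ^ 4 := by
  obtain ⟨g, hg, hhg⟩ := hh.meas
  have hA := hh.nonneg
  obtain ⟨n, hn⟩ : ∃ n : ℕ, 0 < volume ({x | 0 < g x} ∩ Set.Icc (-(n : ℝ)) n) := by
    by_contra! hall
    refine hpos ?_
    have h1 : ∀ᵐ x, ∀ n : ℕ, x ∉ {x | 0 < g x} ∩ Set.Icc (-(n : ℝ)) n :=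
      ae_all_iff.2 fun n => measure_eq_zero_iff_ae_notMem.1 (le_antisymm (hall n) zero_le)
    filter_upwards [h1, hhg] with x hx hxg
    rw [hxg]
    by_contra! hlt
    obtain ⟨n, hn⟩ := exists_nat_ge |x|
    exact hx n ⟨hlt, abs_le.1 hn⟩
  obtain ⟨S, hS⟩ : ∃ S, S = {x | 0 < g x} ∩ Set.Icc (-(n : ℝ)) n := ⟨_, rfl⟩
  rw [← hS] at hn
  have hSm : MeasurableSet S := by
    rw [hS]
    exact (measurableSet_lt measurable_const hg.measurable).inter measurableSet_Icc
  have hSfin : volume S ≠ ⊤ := by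
    refine ne_top_of_le_ne_top ?_ (measure_mono (hS.trans_subset Set.inter_subset_right))
    simp
  obtain ⟨f, hf⟩ : ∃ f : ℝ → ℝ, f = S.indicator fun _ => 1 := ⟨_, rfl⟩
  have hfm : MemLp f 4 volume := hf ▸ memLp_indicator_const 4 hSm 1 (Or.inr hSfin)
  have hint : ∀ {q : ℝ → ℝ}, MemLp q 4 volume → Integrable fun x => q x ^ 4 := fun {q} hq => by
    have := hq.integrable_norm_pow (p := 4) (by norm_num)
    refine this.congr (Eventually.of_forall fun x => ?_)
    simp only [Real.norm_eq_abs]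
    rw [Even.pow_abs (by decide)]
  have hbdd : ∀ {q : ℝ → ℝ}, Integrable q → Integrable fun x => h x * q x := fun {q} hq =>
    hq.bdd_mul (c := A) hh.meas hh.bound
  obtain ⟨a, ha⟩ : ∃ a, a = ∫ x, h x * f x ^ 4 := ⟨_, rfl⟩
  -- The indicator f of a bounded set where h > 0 has the required sign; smooth functions then
  -- approximate f in L⁴.
  have ha0 : 0 < a := by
    have h1 : 0 ≤ᵐ[volume] fun x => h x * f x ^ 4 := by
      filter_upwards [hhg] with x hx
      by_cases hxS : x ∈ S
      · have h2 : 0 < g x := by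
          rw [hS] at hxS
          exact hxS.1
        rw [hx]
        simp only [Pi.zero_apply]
        positivity
      · simp [hf, hxS]
    rw [ha, integral_pos_iff_support_of_nonneg_ae h1 (hbdd (hint hfm))]
    refine hn.trans_le (measure_mono_ae ?_)
    filter_upwards [hhg] with x hx hxS
    have h2 : 0 < g x := by
      have h3 : x ∈ S := hxS
      rw [hS] at h3
      exact h3.1
    change h x * f x ^ 4 ≠ 0
    rw [hx, hf, Set.indicator_of_mem hxS, one_pow, mul_one]
    exact h2.ne'
  obtain ⟨V, hV⟩ : ∃ V, V = ∫ x, f x ^ 4 := ⟨_, rfl⟩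
  have hV0 : 0 ≤ V := hV ▸ integral_nonneg fun x => by positivity
  -- The error of the approximation has a part proportional to f⁴, made at most a/4 by θ, and a part
  -- proportional to r⁴, made at most a/4 by e. The constant C + 1 also accounts for the pure term
  -- r⁴.
  obtain ⟨θ, hθ, hθa⟩ : ∃ θ, 0 < θ ∧ (A * V) * θ ≤ a / 4 :=
    ⟨a / 4 / (A * V + 1), by positivity, mul_div_mul_add_one_le (by positivity) (by positivity)⟩
  obtain ⟨C, hC0, hC⟩ := exists_abs_add_pow_four_sub_le hθ
  obtain ⟨e, he, hea⟩ : ∃ e, 0 < e ∧ (A * (C + 1)) * e ≤ a / 4 :=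
    ⟨a / 4 / (A * (C + 1) + 1), by positivity,
      mul_div_mul_add_one_le (by positivity) (by positivity)⟩
  obtain ⟨ε, hε, hε1, hεe⟩ : ∃ ε : ℝ, 0 < ε ∧ ε ≤ 1 ∧ ε ≤ e :=
    ⟨min 1 e, by positivity, min_le_left _ _, min_le_right _ _⟩
  obtain ⟨φ, hφc, hφ, hφε⟩ := hfm.exist_eLpNorm_sub_le (by norm_num) (by norm_num) hε
  refine ⟨φ, hφc, hφ, ?_⟩
  have hφm : MemLp φ 4 volume := hφ.continuous.memLp_of_hasCompactSupport hφc
  obtain ⟨r, hr⟩ : ∃ r, r = f - φ := ⟨_, rfl⟩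
  have hrm : MemLp r 4 volume := hr ▸ hfm.sub hφm
  rw [← hr] at hφε
  have hrε : ∫ x, r x ^ 4 ≤ e := by
    have h1 : eLpNorm r 4 volume ^ 4 = ∫⁻ x, ENNReal.ofReal (r x ^ 4) := by
      have h2 := eLpNorm_nnreal_pow_eq_lintegral (μ := volume) (f := r) (p := 4) (by norm_num)
      norm_num at h2
      rw [h2]
      refine lintegral_congr fun x => ?_
      rw [← ofReal_norm, ← ENNReal.ofReal_pow (norm_nonneg _), Real.norm_eq_abs,
        Even.pow_abs (by decide)]
    have h3 : ENNReal.ofReal (∫ x, r x ^ 4) ≤ ENNReal.ofReal (ε ^ 4) := by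
      rw [ofReal_integral_eq_lintegral_ofReal (hint hrm) (Eventually.of_forall fun x => by positivity),
        ← h1, ENNReal.ofReal_pow hε.le]
      gcongr
    refine ((ENNReal.ofReal_le_ofReal_iff (by positivity)).1 h3).trans ?_
    exact (pow_le_of_le_one hε.le hε1 four_ne_zero).trans hεe
  have hpt : ∀ᵐ x, h x * f x ^ 4 ≤ h x * φ x ^ 4 + A * (θ * f x ^ 4 + (C + 1) * r x ^ 4) := by
    filter_upwards [hh.bound] with x hx
    have h1 := hC (f x) (-r x)
    have h2 : f x + -r x = φ x := by rw [hr, Pi.sub_apply]; ring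
    rw [h2] at h1
    have h3 : |φ x ^ 4 - f x ^ 4| ≤ θ * f x ^ 4 + (C + 1) * r x ^ 4 := by
      have h4 : (-r x) ^ 4 = r x ^ 4 := by ring
      rw [h4] at h1
      have h5 : 0 ≤ r x ^ 4 := by positivity
      rw [abs_le] at h1 ⊢
      constructor <;> linarith
    have h6 : |h x * (φ x ^ 4 - f x ^ 4)| ≤ A * (θ * f x ^ 4 + (C + 1) * r x ^ 4) := by
      rw [abs_mul]
      exact mul_le_mul hx h3 (abs_nonneg _) hA
    have h7 := neg_le_of_abs_le h6
    linarith
  have i1 := hbdd (hint hφm)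
  have i2 := (hint hfm).const_mul θ
  have i3 := (hint hrm).const_mul (C + 1)
  have i4 := (i2.add i3).const_mul A
  have h8 := integral_mono_ae (hbdd (hint hfm)) (i1.add i4) hpt
  rw [integral_add' i1 i4, integral_const_mul, integral_add' i2 i3, integral_const_mul,
    integral_const_mul, ← ha, ← hV] at h8
  have h9 : A * ((C + 1) * ∫ x, r x ^ 4) ≤ a / 4 := by
    refine le_trans ?_ hea
    rw [mul_assoc]
    gcongr
  linarith

section Torus

variable {T : ℝ} [Fact (0 < T)] {N : SignedMeasure (AddCircle T)}

variable (T) in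
/-- The time-periodic function `cos (k ω t)`. -/
def cosine (k : ℤ) (t : AddCircle T) : ℝ := (fourier k t : ℂ).re

theorem continuous_cosine {T : ℝ} (k : ℤ) : Continuous (cosine T k) :=
  Complex.continuous_re.comp (fourier k).continuous

theorem fourierCoeff_cosine {k j : ℤ} (hk : j ≠ k) (hk' : j ≠ -k) :
    fourierCoeff (fun t => (cosine T k t : ℂ)) j = 0 := by
  have h1 : (fun t => (cosine T k t : ℂ)) =
      fun t => (1 / 2 : ℂ) * ((fourier k : AddCircle T → ℂ) + (fourier (-k) : AddCircle T → ℂ)) t := by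
    funext t
    rw [Pi.add_apply, fourier_neg, cosine, Complex.re_eq_add_conj]
    ring
  have h2 : ∀ j : ℤ, Integrable (fourier j : AddCircle T → ℂ) AddCircle.haarAddCircle := fun j =>
    (fourier j).continuous.integrable_of_hasCompactSupport (HasCompactSupport.of_compactSpace _)
  rw [h1, fourierCoeff.const_mul, fourierCoeff.add (h2 k) (h2 (-k)), fourierCoeff_fourier,
    fourierCoeff_fourier]
  simp [hk, hk']

theorem integral_cosine_pow_pos (k : ℤ) :
    0 < ∫ t, cosine T k t ^ 4 ∂(AddCircle.haarAddCircle (T := T)) := by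
  refine ((continuous_cosine k).pow 4).integral_pos_of_hasCompactSupport_nonneg_nonzero (x := 0)
    (HasCompactSupport.of_compactSpace _) (fun t => ?_) ?_
  · simp only [Pi.zero_apply]
    positivity
  · simp [cosine]

/-- The product of a test function in space and a mode of regular frequency belongs to `H`. -/
theorem exists_memH_mul_cosine {k : ℤ} (hk : k ∈ regularSet N) (hk' : -k ∈ regularSet N)
    {φ : ℝ → ℝ} (hφ : ContDiff ℝ ∞ φ) (hφc : HasCompactSupport φ) :
    ∃ v : RealL2 T, MemH N v ∧ v =ᵐ[spaceTime T] fun p => φ p.1 * cosine T k p.2 := by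
  have hv : MemLp (fun p : ℝ × AddCircle T => φ p.1 * cosine T k p.2) 2 (spaceTime T) := by
    have h1 : HasCompactSupport fun p : ℝ × AddCircle T => φ p.1 * cosine T k p.2 := by
      refine HasCompactSupport.intro (hφc.isCompact.prod isCompact_univ) fun p hp => ?_
      rw [image_eq_zero_of_notMem_tsupport fun h => hp ⟨h, Set.mem_univ _⟩, zero_mul]
    have : IsFiniteMeasureOnCompacts (spaceTime T) := by
      unfold spaceTime
      infer_instance
    exact ((hφ.continuous.comp continuous_fst).mul
      ((continuous_cosine k).comp continuous_snd)).memLp_of_hasCompactSupport h1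
  obtain ⟨γ, hγ⟩ : ∃ γ : ℤ → ℂ, γ = fun j => fourierCoeff (fun t => (cosine T k t : ℂ)) j :=
    ⟨_, rfl⟩
  have hγ0 : ∀ j, j ≠ k → j ≠ -k → γ j = 0 := fun j h1 h2 => hγ ▸ fourierCoeff_cosine h1 h2
  have htc : ∀ j, timeCoeff hv.toLp j =ᵐ[volume] fun x => γ j * (φ x : ℂ) := fun j => by
    refine (timeCoeff_of_ae_eq hv.coeFn_toLp j).trans (Eventually.of_forall fun x => ?_)
    simp only [Complex.ofReal_mul, hγ]
    rw [mul_comm (fourierCoeff _ _)]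
    exact fourierCoeff.const_mul _ _ _
  have hdc : Continuous (deriv φ) := hφ.continuous_deriv (by simp)
  have hd : ∀ j, MemLp (fun x => γ j * ((deriv φ x : ℝ) : ℂ)) 2 volume := fun j => by
    refine (continuous_const.mul (Complex.continuous_ofReal.comp hdc)).memLp_of_hasCompactSupport ?_
    exact (hφc.deriv.comp_left Complex.ofReal_zero).mul_left
  have hmem := MemH.of_isWeakDeriv (N := N) (u := hv.toLp) (fun j => (hd j).toLp)
    (fun j hj => by
      filter_upwards [htc j] with x hx
      rw [hx, hγ0 j (fun h => hj (h ▸ hk)) (fun h => hj (h ▸ hk')), zero_mul]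
      rfl)
    (fun j _ => ((isWeakDeriv_ofReal hφ).const_mul (γ j)).congr (htc j).symm
      (hd j).coeFn_toLp.symm)
    (by
      refine summable_of_ne_finset_zero (s := {⟨k, hk⟩, ⟨-k, hk'⟩}) fun j hj => ?_
      simp only [Finset.mem_insert, Finset.mem_singleton, not_or, Subtype.ext_iff] at hj
      have h0 := hγ0 j hj.1 hj.2
      have h1 : coeffL T j hv.toLp = 0 := by
        rw [coeffL_eq_zero_iff]
        filter_upwards [htc j] with x hx
        rw [hx, h0, zero_mul]
        rfl
      have h2 : (hd j).toLp = 0 := by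
        refine Lp.ext ?_
        filter_upwards [(hd j).coeFn_toLp, Lp.coeFn_zero ℂ 2 (volume : Measure ℝ)] with x h3 h4
        rw [h3, h4, h0, zero_mul]
        rfl
      rw [h1, h2]
      simp)
  exact ⟨hv.toLp, hmem.1, hv.coeFn_toLp⟩

/-- For v = φ(x) cos(kωt) the integral factorizes. A real-valued mode occupies both k and -k, so
both must be regular. -/
theorem exists_quartic_pos {k : ℤ} (hk : k ∈ regularSet N) (hk' : -k ∈ regularSet N) {h : ℝ → ℝ}
    {A : ℝ} (hh : BoundedCoeff h A) (hpos : ¬ ∀ᵐ x, h x ≤ 0) :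
    ∃ v : RealL2 T, MemH N v ∧ 0 < quartic h v := by
  obtain ⟨φ, hφc, hφ, hφpos⟩ := hh.exists_integral_pos hpos
  obtain ⟨v, hv, hvφ⟩ := exists_memH_mul_cosine hk hk' hφ hφc
  refine ⟨v, hv, ?_⟩
  have h1 : quartic h v = (∫ x, h x * φ x ^ 4) *
      ∫ t, cosine T k t ^ 4 ∂(AddCircle.haarAddCircle (T := T)) := by
    rw [← integral_prod_mul (fun x => h x * φ x ^ 4) fun t => cosine T k t ^ 4]
    refine integral_congr_ae ?_
    filter_upwards [hvφ] with p hp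
    rw [hp]
    ring
  rw [h1]
  exact mul_pos hφpos (integral_cosine_pow_pos k)

end Torus

/-! ### Fourier coefficients of measures -/

theorem isFiniteMeasure_variation {X : Type*} [MeasurableSpace X] (μ : SignedMeasure X) :
    IsFiniteMeasure μ.variation := by
  rw [← SignedMeasure.totalVariation_eq_variation]
  infer_instance

theorem integrable_of_norm_le {X : Type*} [MeasurableSpace X] (μ : SignedMeasure X) {f : X → ℂ}
    (hf : AEStronglyMeasurable f μ.variation) {C : ℝ} (hC : ∀ x, ‖f x‖ ≤ C) : μ.Integrable f := by
  have := isFiniteMeasure_variation μ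
  exact Integrable.of_bound hf C (Eventually.of_forall hC)

section Circle

variable {T : ℝ}

theorem norm_fourier_apply (k : ℤ) (t : AddCircle T) : ‖(fourier k t : ℂ)‖ = 1 :=
  Circle.norm_coe _

theorem stronglyMeasurable_fourier (k : ℤ) : StronglyMeasurable (fourier k : AddCircle T → ℂ) :=
  (fourier k).continuous.measurable.stronglyMeasurable

theorem integrable_fourier (μ : SignedMeasure (AddCircle T)) (k : ℤ) :
    μ.Integrable (fourier k : AddCircle T → ℂ) :=
  integrable_of_norm_le μ (stronglyMeasurable_fourier k).aestronglyMeasurable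
    fun t => (norm_fourier_apply k t).le

theorem norm_measureCoeff_le (μ : SignedMeasure (AddCircle T)) (k : ℤ) :
    ‖measureCoeff μ k‖ ≤ (μ.variation Set.univ).toReal := by
  have := isFiniteMeasure_variation μ
  have h1 := VectorMeasure.norm_integral_le_of_norm_le_const (μ := μ)
    (B := (ContinuousLinearMap.lsmul ℝ ℝ (E := ℂ)).flip) (f := fun t => (fourier (-k) t : ℂ)) (C := 1)
    (Eventually.of_forall fun t => (norm_fourier_apply (-k) t).le)
  refine h1.trans ?_
  rw [one_mul, ContinuousLinearMap.opNorm_flip]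
  exact mul_le_of_le_one_left ENNReal.toReal_nonneg ContinuousLinearMap.opNorm_lsmul_le

theorem abs_re_measureCoeff_le {μ : SignedMeasure (AddCircle T)} {C : ℝ} (hC : 0 ≤ C)
    (h : μ.variation Set.univ ≤ ENNReal.ofReal C) (k : ℤ) : |(measureCoeff μ k).re| ≤ C :=
  (Complex.abs_re_le_norm _).trans ((norm_measureCoeff_le μ k).trans
    (ENNReal.toReal_le_of_le_ofReal hC h))

theorem measureCoeff_add (μ ν : SignedMeasure (AddCircle T)) (k : ℤ) :
    measureCoeff (μ + ν) k = measureCoeff μ k + measureCoeff ν k :=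
  VectorMeasure.integral_add_vectorMeasure (integrable_fourier μ (-k)) (integrable_fourier ν (-k))

theorem IsEvenMeasure.measureCoeff_neg {μ : SignedMeasure (AddCircle T)} (h : IsEvenMeasure μ)
    (k : ℤ) : measureCoeff μ (-k) = measureCoeff μ k := by
  have h1 : measureCoeff (μ.map fun t => -t) k = measureCoeff μ (-k) := by
    refine (VectorMeasure.integral_map measurable_neg
      (stronglyMeasurable_fourier (-k)).aestronglyMeasurable ?_).trans ?_
    · exact integrable_of_norm_le μ ((stronglyMeasurable_fourier (-k)).comp_measurable
        measurable_neg).aestronglyMeasurable (C := 1) fun t => (norm_fourier_apply _ _).le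
    · refine congrArg (fun f => VectorMeasure.integral μ f _) (funext fun t => ?_)
      rw [fourier_apply, fourier_apply, smul_neg, neg_smul, neg_neg, neg_neg]
  rw [← h1, h]

theorem periodicReduction_variation_le (μ : SignedMeasure ℝ) :
    (periodicReduction T μ).variation Set.univ ≤ μ.variation Set.univ := by
  have hm : Measurable fun τ : ℝ => (τ : AddCircle T) := AddCircle.measurable_mk'
  refine (VectorMeasure.variation_map_le Set.univ).trans_eq ?_
  rw [Measure.map_apply hm MeasurableSet.univ, Set.preimage_univ]

/-- Integrals depend measurably on a parameter of the measure. -/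
theorem measurable_integral_signedMeasure {Y X : Type*} [MeasurableSpace Y] [MeasurableSpace X]
    {μ : Y → SignedMeasure X} (hμ : ∀ E, MeasurableSet E → Measurable fun y => μ y E) {f : X → ℂ}
    (hf : StronglyMeasurable f) {C : ℝ} (hC0 : 0 ≤ C) (hC : ∀ x, ‖f x‖ ≤ C) :
    Measurable fun y => ∫ᵛ x, f x ∂<•(μ y) := by
  have hsimple : ∀ s : SimpleFunc X ℂ, Measurable fun y => ∫ᵛ x, s x ∂<•(μ y) := by
    intro s
    induction s using SimpleFunc.induction with
    | const c hE =>
      rename_i E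
      have h1 : ∀ y, ∫ᵛ x, (SimpleFunc.piecewise E hE (SimpleFunc.const X c)
          (SimpleFunc.const X 0)) x ∂<•(μ y) = (μ y E) • c := fun y => by
        have := isFiniteMeasure_variation (μ y)
        have h2 : ∀ x, (SimpleFunc.piecewise E hE (SimpleFunc.const X c)
          (SimpleFunc.const X 0)) x = E.indicator (fun _ => c) x := fun x => by
          by_cases hx : x ∈ E <;> simp [hx]
        simp only [h2]
        rw [VectorMeasure.integral_indicator hE, VectorMeasure.setIntegral_const]
        rfl
      simp only [h1]
      exact (hμ E hE).smul_const c
    | add hd hf hg =>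
      rename_i f g
      have h1 : ∀ y, ∫ᵛ x, (f + g) x ∂<•(μ y) = ∫ᵛ x, f x ∂<•(μ y) + ∫ᵛ x, g x ∂<•(μ y) :=
        fun y => by
        have hint : ∀ s : SimpleFunc X ℂ, (μ y).Integrable s := fun s => by
          obtain ⟨D, hD⟩ := s.exists_forall_norm_le
          exact integrable_of_norm_le (μ y) s.aestronglyMeasurable hD
        exact VectorMeasure.integral_fun_add (hint f) (hint g)
      simp only [h1]
      exact hf.add hg
  -- Uniformly bounded simple approximations of f converge under each of the finite measures by
  -- dominated convergence.
  refine measurable_of_tendsto_metrizable (fun n => hsimple (hf.approxBounded C n))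
    (tendsto_pi_nhds.2 fun y => ?_)
  have := isFiniteMeasure_variation (μ y)
  exact VectorMeasure.tendsto_integral_filter_of_norm_le_const
    (Eventually.of_forall fun n => (hf.approxBounded C n).aestronglyMeasurable)
    ⟨C, Eventually.of_forall fun n => Eventually.of_forall fun x =>
      hf.norm_approxBounded_le hC0 n x⟩
    (Eventually.of_forall fun x => hf.tendsto_approxBounded_of_norm_le (hC x))

theorem measurable_measureCoeff {G : ℝ → SignedMeasure ℝ}
    (hG : ∀ E : Set ℝ, MeasurableSet E → Measurable fun x => G x E) (k : ℤ) :
    Measurable fun x => measureCoeff (periodicReduction T (G x)) k := by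
  refine measurable_integral_signedMeasure (fun E hE => ?_) (stronglyMeasurable_fourier (-k))
    zero_le_one fun t => (norm_fourier_apply (-k) t).le
  have hm : Measurable fun τ : ℝ => (τ : AddCircle T) := AddCircle.measurable_mk'
  simp only [periodicReduction, VectorMeasure.map_apply _ hm hE]
  exact hG _ (hm hE)

end Circle

/-! ### From the assumptions on the material coefficients to bounds on the functionals -/

section Torus

variable {T : ℝ} [Fact (0 < T)] {N : SignedMeasure (AddCircle T)}

/-- The lower bound gives positivity. Since α > 1, the upper bound gives summability and also |k|
F_k[N] ≤ C₂ |k|^(1-α) → 0. -/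
theorem regularCoeff_of_decay {T : ℝ} {N : SignedMeasure (AddCircle T)} {α β C₁ C₂ : ℝ}
    (hα : 1 < α) (hC₁ : 0 < C₁)
    (h : ∀ k ∈ regularSet N, C₁ * |(k : ℝ)| ^ (-β) ≤ (measureCoeff N k).re ∧
      (measureCoeff N k).re ≤ C₂ * |(k : ℝ)| ^ (-α)) : RegularCoeff N := by
  have hpos : ∀ k ∈ regularSet N, 0 < |(k : ℝ)| := fun k hk =>
    abs_pos.2 (Int.cast_ne_zero.2 hk.1)
  have hre : ∀ k ∈ regularSet N, 0 < (measureCoeff N k).re := fun k hk =>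
    (mul_pos hC₁ (Real.rpow_pos_of_pos (hpos k hk) _)).trans_le (h k hk).1
  refine ⟨hre, ?_, ?_⟩
  · exact Summable.of_nonneg_of_le (fun k => (hre k k.2).le) (fun k => (h k k.2).2)
      (((Real.summable_abs_int_rpow hα).mul_left C₂).comp_injective Subtype.val_injective)
  · have h1 : Tendsto (fun k : ℤ => |(k : ℝ)|) cofinite atTop :=
      tendsto_norm_cocompact_atTop.comp Int.tendsto_coe_cofinite
    have h2 : Tendsto (fun k : ℤ => C₂ * |(k : ℝ)| ^ (-(α - 1))) cofinite (𝓝 0) := by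
      have := ((tendsto_rpow_neg_atTop (sub_pos.2 hα)).comp h1).const_mul C₂
      rwa [mul_zero] at this
    refine squeeze_zero (fun k => mul_nonneg (abs_nonneg _) (hre k k.2).le) (fun k => ?_)
      (h2.comp Subtype.val_injective.tendsto_cofinite)
    have h3 := hpos k k.2
    calc |((k : ℤ) : ℝ)| * (measureCoeff N k).re
        ≤ |((k : ℤ) : ℝ)| * (C₂ * |((k : ℤ) : ℝ)| ^ (-α)) := by
          gcongr
          exact (h k k.2).2
      _ = C₂ * |((k : ℤ) : ℝ)| ^ (-(α - 1)) := by
          rw [show -(α - 1) = -α + 1 by ring, Real.rpow_add_one h3.ne']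
          ring

theorem exists_coercivePotential {V : ℤ → ℝ → ℝ} (hV : ∀ k, Measurable (V k)) {C δ : ℝ}
    (hC : 1 ≤ C) (hδ : 0 < δ) (hδ1 : δ ≤ 1) (hVC : ∀ k x, |V k x| ≤ C) (hVδ : ∀ k x, δ ≤ V k x) :
    ∃ W : ℤ → Lp ℝ ⊤ (volume : Measure ℝ), CoercivePotential W C δ ∧ ∀ k, W k =ᵐ[volume] V k := by
  have hm : ∀ k, MemLp (V k) ⊤ (volume : Measure ℝ) := fun k =>
    memLp_top_of_bound (hV k).aestronglyMeasurable C (Eventually.of_forall (hVC k))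
  refine ⟨fun k => (hm k).toLp, ⟨fun k => ?_, hC, hδ, hδ1, fun k => ?_⟩, fun k => (hm k).coeFn_toLp⟩
  · filter_upwards [(hm k).coeFn_toLp] with x hx
    rw [hx]
    exact hVC k x
  · filter_upwards [(hm k).coeFn_toLp] with x hx
    rw [hx]
    exact hVδ k x

/-- Eventuality at infinity up to null sets. -/
theorem eventually_cocompact_inf_ae {p : ℝ → Prop} (h : ∀ᶠ x in cocompact ℝ ⊓ ae volume, p x) :
    ∃ ρ : ℝ, ∀ᵐ x, ρ ≤ |x| → p x := by
  obtain ⟨s, hs, t, ht, hst⟩ := mem_inf_iff.1 h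
  obtain ⟨r, hr⟩ := (Metric.mem_cocompact_iff_closedBall_compl_subset (0 : ℝ)).1 hs
  refine ⟨r + 1, ?_⟩
  filter_upwards [ht] with x hx hxr
  have h1 : x ∈ s ∩ t := ⟨hr fun hball => by
    rw [mem_closedBall_zero_iff, Real.norm_eq_abs] at hball
    linarith, hx⟩
  rwa [← hst] at h1

/-- The total variation dominates all Fourier coefficients at once, so ρ can be chosen independently
of k. -/
theorem exists_abs_le_of_tendsto_variation {T : ℝ} {μ : ℝ → SignedMeasure (AddCircle T)}
    (h : Tendsto (fun x => (μ x).variation Set.univ) (cocompact ℝ) (𝓝 0)) {ε : ℝ} (hε : 0 < ε) :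
    ∃ ρ : ℝ, ∀ k x, ρ ≤ |x| → |(measureCoeff (μ x) k).re| ≤ ε := by
  have h1 := (ENNReal.tendsto_nhds_zero.1 h) (ENNReal.ofReal ε) (ENNReal.ofReal_pos.2 hε)
  obtain ⟨r, hr⟩ := (Metric.mem_cocompact_iff_closedBall_compl_subset (0 : ℝ)).1 h1
  refine ⟨r + 1, fun k x hx => abs_re_measureCoeff_le hε.le (hr fun hball => ?_) k⟩
  rw [mem_closedBall_zero_iff, Real.norm_eq_abs] at hball
  linarith

/-- The periodic part of a potential is the limit of its translates. -/
theorem tendsto_potential_translate {T : ℝ} {c : ℝ} {𝒢 𝒢per 𝒢loc : ℝ → SignedMeasure (AddCircle T)}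
    {X : ℝ} (hX : 0 < X) (h𝒢 : ∀ x, 𝒢 x = 𝒢per x + 𝒢loc x) (hper : ∀ x, 𝒢per (x + X) = 𝒢per x)
    (hloc : Tendsto (fun x => (𝒢loc x).variation Set.univ) (cocompact ℝ) (𝓝 0)) (k : ℤ) (x : ℝ) :
    Tendsto (fun n : ℕ => potential c 𝒢 k (x + n * X)) atTop (𝓝 (potential c 𝒢per k x)) := by
  have h1 : ∀ n : ℕ, 𝒢per (x + n * X) = 𝒢per x := fun n => by
    induction n with
    | zero => simp
    | succ n ih =>
      rw [← ih, ← hper (x + n * X)]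
      push_cast
      ring_nf
  have h2 : Tendsto (fun n : ℕ => x + n * X) atTop atTop :=
    tendsto_atTop_add_const_left _ _ (tendsto_natCast_atTop_atTop.atTop_mul_const hX)
  have h3 : Tendsto (fun n : ℕ => (measureCoeff (𝒢loc (x + n * X)) k).re) atTop (𝓝 0) := by
    rw [Metric.tendsto_nhds]
    intro ε hε
    obtain ⟨ρ, hρ⟩ := exists_abs_le_of_tendsto_variation hloc (half_pos hε)
    filter_upwards [h2.eventually_ge_atTop ρ] with n hn
    rw [Real.dist_eq, sub_zero]
    exact (hρ k _ (hn.trans (le_abs_self _))).trans_lt (half_lt_self hε)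
  have h4 := h3.const_sub (potential c 𝒢per k x)
  rw [sub_zero] at h4
  refine h4.congr fun n => ?_
  rw [potential, potential, h𝒢, measureCoeff_add, Complex.add_re, h1]
  ring

/-- By periodicity hper(x) = h(x + nX) - hloc(x + nX), and for large n the last term is at most 1 in
absolute value. -/
theorem boundedCoeff_periodic {h hper hloc : ℝ → ℝ} {A X : ℝ} (hX : 0 < X)
    (hh : BoundedCoeff h A) (hmeas : AEStronglyMeasurable hper volume)
    (heq : ∀ᵐ x, h x = hper x + hloc x) (hX' : ∀ᵐ x, hper (x + X) = hper x)
    (hloc0 : ∃ ρ : ℝ, ∀ᵐ x, ρ ≤ |x| → |hloc x| ≤ 1) : BoundedCoeff hper (A + 1) := by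
  have hA := hh.nonneg
  refine ⟨hmeas, ?_, by positivity⟩
  obtain ⟨ρ, hρ⟩ := hloc0
  have hall := fun n : ℤ => ae_comp_add_right (hh.bound.and (heq.and hρ)) (n * X)
  filter_upwards [ae_all_iff.2 fun n : ℤ => ae_add_intCast_mul_eq hX' n, ae_all_iff.2 hall]
    with x h1 h2
  obtain ⟨n, hn⟩ := exists_nat_ge ((ρ - x) / X)
  have h3 : ρ ≤ |x + n * X| := by
    rw [div_le_iff₀ hX] at hn
    refine le_trans ?_ (le_abs_self _)
    linarith
  have h4 := h2 n
  simp only [Int.cast_natCast] at h4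
  obtain ⟨e1, e2, e3⟩ := h4
  have e4 := e3 h3
  have e5 := h1 n
  simp only [Int.cast_natCast] at e5
  rw [← e5, show hper (x + n * X) = h (x + n * X) - hloc (x + n * X) by linarith]
  exact (abs_sub _ _).trans (add_le_add e1 e4)

end Torus

/-! ### Maximizers in the two cases, and assembly -/

section Torus

variable {T : ℝ} [Fact (0 < T)] {N : SignedMeasure (AddCircle T)}

theorem LocalizedCase.exists_isMaximizer (hN : RegularCoeff N) {h : ℝ → ℝ}
    (hloc : LocalizedCase h) {W : ℤ → Lp ℝ ⊤ (volume : Measure ℝ)} {C δ : ℝ}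
    (hW : CoercivePotential W C δ) {A : ℝ} (hh : BoundedCoeff h A)
    (hpos : ∃ v : RealL2 T, MemH N v ∧ 0 < quartic h v) :
    ∃ M w, 0 < M ∧ IsQuotientBound N W h M ∧ IsMaximizer N W h M w :=
  exists_isMaximizer_of_localized hN hW hh (fun _ hε => eventually_cocompact_inf_ae
    ((hloc.eventually_lt_const hε).mono fun _ hx => hx.le)) hpos

/-- Nonnegativity of F_k[𝒢loc] places the potential below its periodic part, and hloc ≥ 0 places h
above hper. Both signs favour the full problem over the periodic one, as the perturbation argument
requires. -/
theorem PeriodicPlusLocalizedCase.exists_isMaximizer (hN : RegularCoeff N)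
    {k₀ : ℤ} (hk : k₀ ∈ regularSet N) (hk' : -k₀ ∈ regularSet N) {c : ℝ}
    {𝒢 : ℝ → SignedMeasure (AddCircle T)} {h : ℝ → ℝ} (hcase : PeriodicPlusLocalizedCase 𝒢 h)
    (hV : ∀ k, Measurable (potential c 𝒢 k)) {W : ℤ → Lp ℝ ⊤ (volume : Measure ℝ)} {C δ : ℝ}
    (hVC : ∀ k x, |potential c 𝒢 k x| ≤ C) (hVδ : ∀ k x, δ ≤ potential c 𝒢 k x)
    (hW : CoercivePotential W C δ) (hWV : ∀ k, W k =ᵐ[volume] potential c 𝒢 k) {A : ℝ}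
    (hh : BoundedCoeff h A) (hpos : ∃ v : RealL2 T, MemH N v ∧ 0 < quartic h v) :
    ∃ M w, 0 < M ∧ IsQuotientBound N W h M ∧ IsMaximizer N W h M w := by
  obtain ⟨𝒢per, 𝒢loc, hper, hloc, X, hX, h𝒢, hmper, -, hheq, h𝒢per, hhper, h𝒢loc, hhloc, hpd,
    hloc0, hperpos⟩ := hcase
  -- The periodic potential inherits measurability and both bounds as a pointwise limit of
  -- translates of the full potential.
  have hlim := fun k x => tendsto_potential_translate (c := c) hX h𝒢 h𝒢per h𝒢loc k x
  have hV' : ∀ k, Measurable (potential c 𝒢per k) := fun k =>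
    measurable_of_tendsto_metrizable (f := fun (n : ℕ) x => potential c 𝒢 k (x + n * X))
      (fun n => (hV k).comp (measurable_add_const _)) (tendsto_pi_nhds.2 fun x => hlim k x)
  have hVper : ∀ k x, potential c 𝒢per k (x + X) = potential c 𝒢per k x := fun k x => by
    rw [potential, potential, h𝒢per]
  have hdiff : ∀ k x, potential c 𝒢per k x = potential c 𝒢 k x + (measureCoeff (𝒢loc x) k).re :=
    fun k x => by
      rw [potential, potential, h𝒢, measureCoeff_add, Complex.add_re]
      ring
  obtain ⟨W', hW', hWV'⟩ := exists_coercivePotential hV' hW.one_le hW.pos hW.le_one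
    (fun k x => le_of_tendsto (hlim k x).abs (Eventually.of_forall fun n => hVC k _))
    (fun k x => ge_of_tendsto (hlim k x) (Eventually.of_forall fun n => hVδ k _))
  have hlocε : ∀ ε > 0, ∃ ρ : ℝ, ∀ᵐ x, ρ ≤ |x| → |hloc x| ≤ ε := fun ε hε =>
    eventually_cocompact_inf_ae ((Metric.tendsto_nhds.1 hhloc ε hε).mono fun x hx => by
      rw [Real.dist_eq, sub_zero] at hx
      exact hx.le)
  have hh' := boundedCoeff_periodic hX hh hmper hheq hhper (hlocε 1 one_pos)
  have hhA : BoundedCoeff h (A + 1) :=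
    ⟨hh.meas, hh.bound.mono fun x hx => hx.trans (by linarith), hh'.nonneg⟩
  have hmax := exists_isMaximizer_of_periodic hN hW' hh' hX (fun k => by
    filter_upwards [hWV' k, ae_comp_add_right (hWV' k) X] with x h1 h2
    rw [h1, h2, hVper]) hhper (exists_quartic_pos hk hk' hh' hperpos)
  refine exists_isMaximizer_of_perturbation hN hW hW' hhA hh' (fun k => ?_) ?_ (fun ε hε => ?_)
    (fun ε hε => ?_) hmax hpos
  · filter_upwards [hWV k, hWV' k] with x h1 h2
    rw [h1, h2, hdiff]
    exact le_add_of_nonneg_right (hpd x k).2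
  · filter_upwards [hheq, hloc0] with x h1 h2
    linarith
  · obtain ⟨ρ, hρ⟩ := exists_abs_le_of_tendsto_variation h𝒢loc hε
    refine ⟨ρ, fun k => ?_⟩
    filter_upwards [hWV k, hWV' k] with x h1 h2 hx
    rw [h1, h2, hdiff]
    exact add_le_add le_rfl ((le_abs_self _).trans (hρ k x hx))
  · obtain ⟨ρ, hρ⟩ := hlocε ε hε
    refine ⟨ρ, ?_⟩
    filter_upwards [hρ, hheq] with x h1 h2 hx
    rw [h2]
    exact add_le_add le_rfl ((le_abs_self _).trans (h1 hx))

theorem exists_isGroundState {α β C₁ C₂ : ℝ} (hα : 1 < α) (hC₁ : 0 < C₁)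
    (hNdecay : ∀ k ∈ regularSet N, C₁ * |(k : ℝ)| ^ (-β) ≤ (measureCoeff N k).re ∧
      (measureCoeff N k).re ≤ C₂ * |(k : ℝ)| ^ (-α))
    (hNeven : IsEvenMeasure N) (hNne : (regularSet N).Nonempty) {c : ℝ}
    {𝒢 : ℝ → SignedMeasure (AddCircle T)} {h : ℝ → ℝ}
    (h𝒢 : ∀ k, Measurable fun x => measureCoeff (𝒢 x) k)
    {K : ℝ} (hK : ∀ k x, |(measureCoeff (𝒢 x) k).re| ≤ K) {m : ℝ} (hm : m < 1 / c ^ 2 - 1)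
    (h𝒢m : ∀ x k, (measureCoeff (𝒢 x) k).re ≤ m) (hh : MemLp h ⊤ volume)
    (hpos : ¬ ∀ᵐ x, h x ≤ 0) (hcases : LocalizedCase h ∨ PeriodicPlusLocalizedCase 𝒢 h) :
    ∃ u, IsGroundState c 𝒢 N h u := by
  have hN := regularCoeff_of_decay hα hC₁ hNdecay
  obtain ⟨k, hk⟩ := hNne
  have hk' : -k ∈ regularSet N :=
    ⟨neg_ne_zero.2 hk.1, by rw [hNeven.measureCoeff_neg]; exact hk.2⟩
  have hV : ∀ k, Measurable (potential c 𝒢 k) := fun k =>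
    measurable_const.sub (Complex.measurable_re.comp (h𝒢 k))
  have hK0 : 0 ≤ K := (abs_nonneg _).trans (hK 0 0)
  have hVC : ∀ k x, |potential c 𝒢 k x| ≤ 1 + |1 / c ^ 2 - 1| + K := fun k x => by
    refine (abs_sub _ _).trans ?_
    have := hK k x
    linarith
  -- The coercivity constant is the spectral gap, truncated at 1 because of the derivative part of
  -- the form.
  have hVδ : ∀ k x, min 1 (1 / c ^ 2 - 1 - m) ≤ potential c 𝒢 k x := fun k x => by
    refine (min_le_right _ _).trans ?_
    rw [potential]
    linarith [h𝒢m x k]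
  have hδ : 0 < min 1 (1 / c ^ 2 - 1 - m) := lt_min one_pos (sub_pos.2 hm)
  obtain ⟨W, hW, hWV⟩ := exists_coercivePotential hV (C := 1 + |1 / c ^ 2 - 1| + K)
    (by linarith [abs_nonneg (1 / c ^ 2 - 1)]) hδ (min_le_left _ _) hVC hVδ
  have hhA : BoundedCoeff h (eLpNormEssSup h volume).toReal := by
    refine ⟨hh.1, ?_, ENNReal.toReal_nonneg⟩
    have hfin : eLpNormEssSup h volume ≠ ⊤ := by
      rw [← eLpNorm_exponent_top]
      exact hh.2.ne
    filter_upwards [ae_le_eLpNormEssSup (f := h) (μ := volume)] with x hx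
    rw [← Real.norm_eq_abs, ← toReal_enorm]
    exact ENNReal.toReal_mono hfin hx
  have hpos' := exists_quartic_pos hk hk' hhA hpos
  obtain ⟨M, w, hM0, hM, hw⟩ : ∃ M w, 0 < M ∧ IsQuotientBound N W h M ∧ IsMaximizer N W h M w := by
    rcases hcases with hcase | hcase
    · exact hcase.exists_isMaximizer hN hW hhA hpos'
    · exact hcase.exists_isMaximizer hN hk hk' hV hVC hVδ hW hWV hhA hpos'
  exact hw.exists_isGroundState hN hW hWV hhA hM0 hM

end Torus

end Breather

end

theorem theorem3p1
    (T : ℝ) [Fact (0 < T)] (c : ℝ) (hc0 : 0 < c) (hc1 : c < 1)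
    -- linear susceptibility `G`, nonlinear susceptibility `h` and `ν`, in the slab geometry
    (G : ℝ → SignedMeasure ℝ) (h : ℝ → ℝ) (ν : SignedMeasure ℝ)
    (hG_meas : ∀ E : Set ℝ, MeasurableSet E → Measurable fun x => G x E)
    (hh_bdd : MemLp h ⊤ volume)
    (hG_bdd : ∃ C : ℝ, ∀ x, (G x).variation Set.univ ≤ ENNReal.ofReal C)
    (hh_pos : ¬ ∀ᵐ x, h x ≤ 0)
    -- the periodic reduction of `G`: evenness and `sup_{x,k} F_k[𝒢(x)] < 1/c² - 1`
    (hG_even : ∀ x, Breather.IsEvenMeasure (Breather.periodicReduction T (G x)))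
    (hG_sup : ∃ m : ℝ, m < 1 / c ^ 2 - 1 ∧ ∀ (x : ℝ) (k : ℤ),
      (Breather.measureCoeff (Breather.periodicReduction T (G x)) k).re ≤ m)
    -- the periodic reduction of `ν`: evenness, nontriviality, bounds on the Fourier coefficients
    (hN_even : Breather.IsEvenMeasure (Breather.periodicReduction T ν))
    (hN_ne : (Breather.regularSet (Breather.periodicReduction T ν)).Nonempty)
    (α β : ℝ) (hα : 1 < α) (hαβ : α ≤ β)
    (hN_decay : ∃ C₁ C₂ : ℝ, 0 < C₁ ∧ 0 < C₂ ∧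
      ∀ k ∈ Breather.regularSet (Breather.periodicReduction T ν),
        C₁ * |(k : ℝ)| ^ (-β) ≤ (Breather.measureCoeff (Breather.periodicReduction T ν) k).re ∧
        (Breather.measureCoeff (Breather.periodicReduction T ν) k).re ≤ C₂ * |(k : ℝ)| ^ (-α))
    (hcases : Breather.LocalizedCase h ∨
      Breather.PeriodicPlusLocalizedCase (fun x => Breather.periodicReduction T (G x)) h) :
    ∃ u : Breather.RealL2 T,
      Breather.IsGroundState c (fun x => Breather.periodicReduction T (G x))
        (Breather.periodicReduction T ν) h u := by
  obtain ⟨C, hC⟩ := hG_bdd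
  obtain ⟨m, hm, hGm⟩ := hG_sup
  obtain ⟨C₁, C₂, hC₁, -, hdecay⟩ := hN_decay
  -- Push-forward does not increase the total variation, so the bound on G bounds all F_k[𝒢(x)]; the
  -- absolute value ensures a nonnegative constant.
  refine Breather.exists_isGroundState hα hC₁ hdecay hN_even hN_ne
    (fun k => Breather.measurable_measureCoeff hG_meas k) (K := |C|) (fun k x => ?_) hm hGm hh_bdd
    hh_pos hcases
  exact Breather.abs_re_measureCoeff_le (abs_nonneg C)
    ((Breather.periodicReduction_variation_le _).trans ((hC x).trans
      (ENNReal.ofReal_le_ofReal (le_abs_self C)))) k
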